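/- Let $U\subset\mathbb C^n$ be open, let $f_1,\dots,f_r$ be holomorphic functions on $U$, let $X=V(f_1,\dots,f_r)\subset U$ and $p\in X$. Let $\mathcal O_{\mathbb C^n,p}$ be the ring of germs at $p$ of holomorphic functions, $I\subset\mathcal O_{\mathbb C^n,p}$ the ideal generated by the germs of $f_1,\dots,f_r$, and $\mathcal O_{X,p}=\mathcal O_{\mathbb C^n,p}/I$. Assume that $X$ is a reduced complete intersection at $p$: the germs of $f_1,\dots,f_r$ form a regular sequence in $\mathcal O_{\mathbb C^n,p}$, and the ring $\mathcal O_{X,p}$ is reduced. Let $J_f=(\partial f_i/\partial x_j)_{i,j}$ be the Jacobian matrix, $\operatorname{Sing}(X)=\{q\in X:\operatorname{rank}J_f(q)<r\}$, let $\Omega^1_{X,p}$ be the module of holomorphic differentials of $(X,p)$, that is, the quotient of the free $\mathcal O_{X,p}$-module on $dx_1,\dots,dx_n$ by the submodule generated by the classes of $dg=\sum_j \frac{\partial g}{\partial x_j}dx_j$, $g\in I$, and let $T^1_{X,p}=\operatorname{Ext}^1_{\mathcal O_{X,p}}(\Omega^1_{X,p},\mathcal O_{X,p})$. An analytic set $S$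 has positive dimension through $p$ if $p\in S$ and the ring of germs at $p$ of holomorphic functions modulo those that vanish on the germ $(S,p)$ has positive Krull dimension. Then: 1. $T^1_{X,p}\cong\operatorname{coker}\big(J_f:\mathcal O_{X,p}^{\,n}\to\mathcal O_{X,p}^{\,r}\big)$ as $\mathcal O_{X,p}$-modules. 2. $\dim_{\mathbb C}T^1_{X,p}=\infty$ if and only if $\operatorname{Sing}(X)$ has positive dimension through $p$. 3. If $p\in\operatorname{Sing}(X)$ (in particular, if $\operatorname{Sing}(X)$ has positive dimension through $p$), then $T^1_{X,p}\neq0$, i.e. $X$ is not locally rigid at $p$. 4. If $r=1$ and $f=f_1$, then $$T^1_{X,p}\cong\frac{\mathcal O_{\mathbb C^n,p}}{(f,\partial f/\partial x_1,\dots,\partial f/\partial x_n)}$$ as $\mathcal O_{\mathbb C^n,p}$-modules; hence both sides have the same dimension over $\mathbb C$, and this dimension is infinite if and only if the common zero locus of $\partial f/\partial x_1,\dots,\partial f/\partial x_n$ in $U$ has positive dimension through $p$. -/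

import Mathlib

open Filter Topology

noncomputable section

namespace AnalyticGerm

/-! ### The local ring of `ℂⁿ` at a point -/

/-- The ring of germs at `p` of holomorphic functions on `ℂⁿ`, as a subring of the ring of
germs at `p` of arbitrary complex valued functions. -/
def holSubring {n : ℕ} (p : Fin n → ℂ) : Subring (Germ (𝓝 p) ℂ) where
  carrier := {φ | ∃ g : (Fin n → ℂ) → ℂ, AnalyticAt ℂ g p ∧ (g : Germ (𝓝 p) ℂ) = φ}
  mul_mem' := by
    rintro _ _ ⟨g, hg, rfl⟩ ⟨h, hh, rfl⟩
    exact ⟨g * h, hg.mul hh, rfl⟩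
  one_mem' := ⟨fun _ => 1, analyticAt_const, rfl⟩
  add_mem' := by
    rintro _ _ ⟨g, hg, rfl⟩ ⟨h, hh, rfl⟩
    exact ⟨g + h, hg.add hh, rfl⟩
  zero_mem' := ⟨fun _ => 0, analyticAt_const, rfl⟩
  neg_mem' := by
    rintro _ ⟨g, hg, rfl⟩
    exact ⟨-g, hg.neg, rfl⟩

/-- `𝒪_{ℂⁿ,p}`, the local ring of germs at `p` of holomorphic functions. -/
abbrev LocalRingAt {n : ℕ} (p : Fin n → ℂ) : Type := holSubring p

/-- The germ at `p` of a function that is holomorphic near `p`. -/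
def germ {n : ℕ} (p : Fin n → ℂ) (g : (Fin n → ℂ) → ℂ) (hg : AnalyticAt ℂ g p) :
    LocalRingAt p :=
  ⟨(g : Germ (𝓝 p) ℂ), g, hg, rfl⟩

/-- The germs of constant functions. -/
def constHom {n : ℕ} (p : Fin n → ℂ) : ℂ →+* LocalRingAt p where
  toFun c := germ p (fun _ => c) analyticAt_const
  map_one' := rfl
  map_mul' _ _ := rfl
  map_zero' := rfl
  map_add' _ _ := rfl

instance instAlgebraLocalRingAt {n : ℕ} (p : Fin n → ℂ) : Algebra ℂ (LocalRingAt p) :=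
  (constHom p).toAlgebra

/-- The partial derivative `∂g/∂x_j` of a function on `ℂⁿ`. -/
def partialDeriv {n : ℕ} (j : Fin n) (g : (Fin n → ℂ) → ℂ) : (Fin n → ℂ) → ℂ :=
  fun x => fderiv ℂ g x (Pi.single j 1)

theorem partialDeriv_congr {n : ℕ} (j : Fin n) {p : Fin n → ℂ} {g h : (Fin n → ℂ) → ℂ}
    (e : g =ᶠ[𝓝 p] h) : partialDeriv j g =ᶠ[𝓝 p] partialDeriv j h := by
  filter_upwards [e.fderiv (𝕜 := ℂ)] with x hx
  simp only [partialDeriv, hx]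

theorem analyticAt_partialDeriv {n : ℕ} (j : Fin n) {p : Fin n → ℂ} {g : (Fin n → ℂ) → ℂ}
    (hg : AnalyticAt ℂ g p) : AnalyticAt ℂ (partialDeriv j g) p :=
  ((ContinuousLinearMap.apply ℂ ℂ (Pi.single j (1 : ℂ) : Fin n → ℂ)).analyticAt _).comp hg.fderiv

/-- The partial derivative `∂/∂x_j` on germs of holomorphic functions. -/
def pderiv {n : ℕ} {p : Fin n → ℂ} (j : Fin n) (φ : LocalRingAt p) : LocalRingAt p :=
  ⟨Germ.liftOn φ.1 (fun g => ((partialDeriv j g : (Fin n → ℂ) → ℂ) : Germ (𝓝 p) ℂ))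
      (fun _ _ e => Germ.coe_eq.2 (partialDeriv_congr j e)), by
    obtain ⟨_, g, hg, rfl⟩ := φ
    exact ⟨partialDeriv j g, analyticAt_partialDeriv j hg, rfl⟩⟩

theorem pderiv_germ {n : ℕ} {p : Fin n → ℂ} (j : Fin n) (g : (Fin n → ℂ) → ℂ)
    (hg : AnalyticAt ℂ g p) :
    pderiv j (germ p g hg) = germ p (partialDeriv j g) (analyticAt_partialDeriv j hg) :=
  rfl

/-! ### Germs of complex spaces: local ring, differentials, `T¹`

The germ `(X, p)` is given by the ideal `I` of `𝒪_{ℂⁿ,p}`, and `𝒪_{X,p} = 𝒪_{ℂⁿ,p} ⧸ I`. -/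

/-- For `φ ∈ 𝒪_{ℂⁿ,p}`, the class of `dφ = ∑ⱼ (∂φ/∂xⱼ) dxⱼ` in
`Ω¹_{ℂⁿ,p} ⊗ 𝒪_{X,p}`, the free `𝒪_{X,p}`-module with basis `dx₁, …, dxₙ`. -/
def differential {n : ℕ} {p : Fin n → ℂ} (I : Ideal (LocalRingAt p)) (φ : LocalRingAt p) :
    Fin n → LocalRingAt p ⧸ I :=
  fun j => Ideal.Quotient.mk I (pderiv j φ)

/-- The module `Ω¹_{X,p}` of holomorphic differentials of the germ `(X, p)`: the quotient of
`Ω¹_{ℂⁿ,p} ⊗ 𝒪_{X,p}` by the submodule generated by all `dφ` with `φ ∈ I`. -/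
abbrev Omega {n : ℕ} {p : Fin n → ℂ} (I : Ideal (LocalRingAt p)) : Type :=
  (Fin n → LocalRingAt p ⧸ I) ⧸
    Submodule.span (LocalRingAt p ⧸ I) (differential I '' (I : Set (LocalRingAt p)))

/-- `T¹_{X,p} = Ext¹(Ω¹_{X,p}, 𝒪_{X,p})`, over the ring `𝒪_{X,p}`. -/
abbrev T1 {n : ℕ} {p : Fin n → ℂ} (I : Ideal (LocalRingAt p)) : Type :=
  CategoryTheory.Abelian.Ext (ModuleCat.of (LocalRingAt p ⧸ I) (Omega I))
    (ModuleCat.of (LocalRingAt p ⧸ I) (LocalRingAt p ⧸ I)) 1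

/-- `T¹_{X,p}` as a complex vector space. -/
abbrev T1Complex {n : ℕ} {p : Fin n → ℂ} (I : Ideal (LocalRingAt p)) : Type :=
  RestrictScalars ℂ (LocalRingAt p ⧸ I) (T1 I)

/-- `T¹_{X,p}` as a module over `𝒪_{ℂⁿ,p}`. -/
abbrev T1Ambient {n : ℕ} {p : Fin n → ℂ} (I : Ideal (LocalRingAt p)) : Type :=
  RestrictScalars (LocalRingAt p) (LocalRingAt p ⧸ I) (T1 I)

/-- The ideal `(F₁, …, F_r)` of `𝒪_{ℂⁿ,p}`. -/
abbrev idealOf {n r : ℕ} {p : Fin n → ℂ} (F : Fin r → LocalRingAt p) : Ideal (LocalRingAt p) :=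
  Ideal.span (Set.range F)

/-- The Jacobian matrix `(∂Fᵢ/∂xⱼ)` with entries in `𝒪_{X,p} = 𝒪_{ℂⁿ,p} ⧸ (F₁, …, F_r)`. -/
def jacobianGerm {n r : ℕ} {p : Fin n → ℂ} (F : Fin r → LocalRingAt p) :
    Matrix (Fin r) (Fin n) (LocalRingAt p ⧸ idealOf F) :=
  Matrix.of fun i j => Ideal.Quotient.mk (idealOf F) (pderiv j (F i))

/-- The cokernel of `J : 𝒪_{X,p}ⁿ → 𝒪_{X,p}^r`. -/
abbrev jacobianCoker {n r : ℕ} {p : Fin n → ℂ} (F : Fin r → LocalRingAt p) : Type :=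
  (Fin r → LocalRingAt p ⧸ idealOf F) ⧸ LinearMap.range (jacobianGerm F).mulVecLin

/-- The ideal `(φ, ∂φ/∂x₁, …, ∂φ/∂xₙ)` of `𝒪_{ℂⁿ,p}`. -/
def tjurinaIdeal {n : ℕ} {p : Fin n → ℂ} (φ : LocalRingAt p) : Ideal (LocalRingAt p) :=
  Ideal.span ({φ} ∪ Set.range fun j => pderiv j φ)

/-! ### Analytic sets, singular locus, dimension at a point -/

/-- `X = V(f₁, …, f_r)` inside the open set `U`. -/
def zeroLocus {n r : ℕ} (U : Set (Fin n → ℂ)) (f : Fin r → (Fin n → ℂ) → ℂ) :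
    Set (Fin n → ℂ) :=
  {q | q ∈ U ∧ ∀ i, f i q = 0}

/-- The complex `r × n` matrix `J_f(q) = (∂fᵢ/∂xⱼ (q))`. -/
def jacobianAt {n r : ℕ} (f : Fin r → (Fin n → ℂ) → ℂ) (q : Fin n → ℂ) :
    Matrix (Fin r) (Fin n) ℂ :=
  Matrix.of fun i j => partialDeriv j (f i) q

/-- `Sing(X)`: the points of `X = V(f₁, …, f_r)` at which `J_f` has rank less than `r`. -/
def singLocus {n r : ℕ} (U : Set (Fin n → ℂ)) (f : Fin r → (Fin n → ℂ) → ℂ) :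
    Set (Fin n → ℂ) :=
  {q | q ∈ zeroLocus U f ∧ (jacobianAt f q).rank < r}

/-- The common zero locus in `U` of the partial derivatives of `g`. -/
def criticalLocus {n : ℕ} (U : Set (Fin n → ℂ)) (g : (Fin n → ℂ) → ℂ) : Set (Fin n → ℂ) :=
  {q | q ∈ U ∧ ∀ j, partialDeriv j g q = 0}

/-- The ideal of `𝒪_{ℂⁿ,p}` of the germs of holomorphic functions that vanish on the germ
at `p` of the set `S`. -/
def vanishingIdeal {n : ℕ} (S : Set (Fin n → ℂ)) (p : Fin n → ℂ) : Ideal (LocalRingAt p) where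
  carrier := {φ | ∃ g : (Fin n → ℂ) → ℂ,
    (g : Germ (𝓝 p) ℂ) = (φ : Germ (𝓝 p) ℂ) ∧ ∀ᶠ x in 𝓝[S] p, g x = 0}
  add_mem' := by
    rintro φ ψ ⟨g, hg, hg'⟩ ⟨h, hh, hh'⟩
    refine ⟨g + h, ?_, ?_⟩
    · rw [Germ.coe_add, hg, hh]; rfl
    · filter_upwards [hg', hh'] with x h1 h2
      simp [h1, h2]
  zero_mem' := ⟨0, rfl, Eventually.of_forall fun _ => rfl⟩
  smul_mem' := by
    rintro ⟨_, c, hc, rfl⟩ φ ⟨g, hg, hg'⟩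
    refine ⟨c * g, ?_, ?_⟩
    · rw [Germ.coe_mul, hg]; rfl
    · filter_upwards [hg'] with x h1
      simp [h1]

/-- The (complex) dimension at `p` of the germ at `p` of an analytic set `S`: the Krull
dimension of the ring of germs at `p` of holomorphic functions on `S` (it is `⊥` when `p` is not
in the closure of `S`). -/
def dimAt {n : ℕ} (S : Set (Fin n → ℂ)) (p : Fin n → ℂ) : WithBot ℕ∞ :=
  ringKrullDim (LocalRingAt p ⧸ vanishingIdeal S p)

/-- `S` has positive dimension through `p`. -/
def PosDimAt {n : ℕ} (S : Set (Fin n → ℂ)) (p : Fin n → ℂ) : Prop :=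
  p ∈ S ∧ 0 < dimAt S p

end AnalyticGerm

end

open Filter Topology

noncomputable section

section

open scoped ENNReal NNReal

namespace AnalyticGerm

/-! ### Weighted `ℓ¹` norms of power series -/

/-! Write `I` for the ideal of `X`. Everything rests on one injectivity statement: the transposed
Jacobian matrix is injective on `𝒪_X^r`. Given it, `0 → 𝒪_X^r → 𝒪_X^n → Ω¹ → 0` is a free
resolution, and dualizing it presents `Ext¹(Ω¹, 𝒪_X)` as the cokernel of `J`
(`nonempty_ext_linearEquiv_coker`).

For injectivity (`mem_of_sum_mul_pderiv_mem`), suppose `∑ aᵢ ∂ⱼFᵢ ∈ I` for all `j`. Then `g = ∑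
aᵢFᵢ` and all its partial derivatives lie in `I`. At a minimal prime `P` of `I`, characteristic zero
forces `g` into the square of the maximal ideal of the localization
(`algebraMap_mem_maximalIdeal_sq`). As `I` is radical, that maximal ideal is generated by `I`, so `s
g ∈ I²` for some `s ∉ P`. The conormal module of a regular sequence is free, so `s aᵢ ∈ I` and `aᵢ ∈
P`. Intersecting over all `P` gives `aᵢ ∈ I`.

The cokernel has finite dimension exactly when a power of the maximal ideal kills it. A germ killing
it vanishes on `Sing(X)`, since elsewhere on `X` it may be nonzero but at a singular point `J`
cannot hit every basis vector times a unit. In the other direction, the `Fᵢ` and the maximal minors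
of `J` kill the cokernel and cut out `Sing(X)`. If `p` is isolated in `Sing(X)` or outside it, the
local Nullstellensatz for isolated zeros (`le_radical_of_isolated_zero`) puts a power of the maximal
ideal in the ideal they generate.

For a hypersurface the cokernel is visibly the Tjurina algebra. The critical locus does not impose
`f = 0`, so one more fact is needed: a germ whose derivatives lie in a prime `P` is constant modulo
`P` (`exists_sub_const_mem`). Hence each prime containing the partials of `f` contains `f` as well.

The analytic input is Weierstrass division, proved by a Neumann series in weighted `ℓ¹` norms. It
yields the Noetherian property, generation of the maximal ideal by coordinates, Noether
normalization, and the elimination step in the Nullstellensatz. -/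

/-- The monomial `x ^ α`. -/
def monom {n : ℕ} {R : Type*} [CommMonoid R] (x : Fin n → R) (α : Fin n →₀ ℕ) : R :=
  ∏ i, x i ^ α i

section Monom

variable {n : ℕ} {R : Type*} [CommMonoid R]

@[simp] theorem monom_zero (x : Fin n → R) : monom x 0 = 1 := by simp [monom]

theorem monom_add (x : Fin n → R) (α β : Fin n →₀ ℕ) :
    monom x (α + β) = monom x α * monom x β := by
  simp [monom, pow_add, Finset.prod_mul_distrib]

theorem monom_cons (x : Fin (n + 1) → R) (k : ℕ) (β : Fin n →₀ ℕ) :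
    monom x (β.cons k) = x 0 ^ k * monom (Fin.tail x) β := by
  simp [monom, Fin.prod_univ_succ, Fin.tail]

theorem monom_single_zero (x : Fin (n + 1) → R) (k : ℕ) :
    monom x (Finsupp.single 0 k) = x 0 ^ k := by
  rw [← Finsupp.cons_zero_eq_single_zero, monom_cons, monom_zero, mul_one]

end Monom

theorem enorm_monom {n : ℕ} (x : Fin n → ℂ) (α : Fin n →₀ ℕ) :
    ‖monom x α‖ₑ = monom (fun i => ‖x i‖ₑ) α := by
  simp only [monom, enorm_eq_nnnorm]
  rw [nnnorm_prod]
  simp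

theorem monom_mono {n : ℕ} {ρ σ : Fin n → ℝ≥0∞} (h : ∀ i, ρ i ≤ σ i) (α : Fin n →₀ ℕ) :
    monom ρ α ≤ monom σ α :=
  Finset.prod_le_prod' fun i _ => pow_le_pow_left' (h i) _

/-- The norm `∑ |a_α| ρ ^ α` of a power series. -/
def wnorm {n : ℕ} (ρ : Fin n → ℝ≥0∞) (a : MvPowerSeries (Fin n) ℂ) : ℝ≥0∞ :=
  ∑' α, ‖MvPowerSeries.coeff α a‖ₑ * monom ρ α

/-- The sum of a power series at a point. -/
def evalSeries {n : ℕ} (a : MvPowerSeries (Fin n) ℂ) (x : Fin n → ℂ) : ℂ :=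
  ∑' α, MvPowerSeries.coeff α a * monom x α

section WNorm

variable {n : ℕ} {ρ : Fin n → ℝ≥0∞} {a b : MvPowerSeries (Fin n) ℂ} {x : Fin n → ℂ}

theorem wnorm_mono {σ : Fin n → ℝ≥0∞} (h : ∀ i, ρ i ≤ σ i) : wnorm ρ a ≤ wnorm σ a :=
  ENNReal.tsum_le_tsum fun α => mul_le_mul_right (monom_mono h α) _

theorem wnorm_add_le : wnorm ρ (a + b) ≤ wnorm ρ a + wnorm ρ b := by
  rw [wnorm, wnorm, wnorm, ← ENNReal.tsum_add]
  refine ENNReal.tsum_le_tsum fun α => ?_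
  rw [← add_mul, map_add]
  exact mul_le_mul_left (enorm_add_le _ _) _

theorem wnorm_neg : wnorm ρ (-a) = wnorm ρ a := by simp [wnorm]

theorem wnorm_sub_le : wnorm ρ (a - b) ≤ wnorm ρ a + wnorm ρ b := by
  rw [sub_eq_add_neg, ← wnorm_neg (a := b)]
  exact wnorm_add_le

/-- The product of the two sums is regrouped along antidiagonals. With values in `ℝ≥0∞` no
convergence has to be checked. -/
theorem wnorm_mul_le : wnorm ρ (a * b) ≤ wnorm ρ a * wnorm ρ b := by
  classical
  have h1 : wnorm ρ a * wnorm ρ b =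
      ∑' γ, ∑ p ∈ Finset.HasAntidiagonal.antidiagonal γ, (‖MvPowerSeries.coeff p.1 a‖ₑ * monom ρ p.1) *
        (‖MvPowerSeries.coeff p.2 b‖ₑ * monom ρ p.2) := by
    have h2 : wnorm ρ a * wnorm ρ b = ∑' p : (Fin n →₀ ℕ) × (Fin n →₀ ℕ),
        (‖MvPowerSeries.coeff p.1 a‖ₑ * monom ρ p.1) *
        (‖MvPowerSeries.coeff p.2 b‖ₑ * monom ρ p.2) := by
      rw [ENNReal.tsum_prod', wnorm, wnorm, ← ENNReal.tsum_mul_right]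
      refine tsum_congr fun α => ?_
      rw [← ENNReal.tsum_mul_left]
    rw [h2, ← Finset.HasAntidiagonal.sigmaAntidiagonalEquivProd.tsum_eq, ENNReal.tsum_sigma']
    refine tsum_congr fun γ => ?_
    rw [tsum_fintype]
    exact Finset.sum_coe_sort (Finset.HasAntidiagonal.antidiagonal γ)
      fun p : (Fin n →₀ ℕ) × (Fin n →₀ ℕ) => (‖MvPowerSeries.coeff p.1 a‖ₑ * monom ρ p.1) *
        (‖MvPowerSeries.coeff p.2 b‖ₑ * monom ρ p.2)
  rw [h1]
  refine ENNReal.tsum_le_tsum fun γ => ?_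
  rw [MvPowerSeries.coeff_mul]
  calc _ ≤ (∑ p ∈ Finset.HasAntidiagonal.antidiagonal γ,
          ‖MvPowerSeries.coeff p.1 a * MvPowerSeries.coeff p.2 b‖ₑ) * monom ρ γ :=
        mul_le_mul_left (enorm_sum_le _ _) _
    _ = _ := by
      rw [Finset.sum_mul]
      refine Finset.sum_congr rfl fun p hp => ?_
      rw [← Finset.HasAntidiagonal.mem_antidiagonal.1 hp, monom_add, enorm_mul]
      ring

theorem summable_eval (ha : wnorm ρ a ≠ ∞) (hx : ∀ i, ‖x i‖ₑ ≤ ρ i) :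
    Summable fun α => ‖MvPowerSeries.coeff α a * monom x α‖ := by
  have h : ∑' α, ‖MvPowerSeries.coeff α a * monom x α‖ₑ ≠ ∞ := by
    refine ne_top_of_le_ne_top ha (ENNReal.tsum_le_tsum fun α => ?_)
    rw [enorm_mul, enorm_monom]
    exact mul_le_mul_right (monom_mono hx α) _
  simp only [enorm_eq_nnnorm] at h
  exact NNReal.summable_coe.2 (ENNReal.tsum_coe_ne_top_iff_summable.1 h)

theorem evalSeries_add (ha : wnorm ρ a ≠ ∞) (hb : wnorm ρ b ≠ ∞) (hx : ∀ i, ‖x i‖ₑ ≤ ρ i) :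
    evalSeries (a + b) x = evalSeries a x + evalSeries b x := by
  rw [evalSeries, evalSeries, evalSeries,
    ← (summable_eval ha hx).of_norm.tsum_add (summable_eval hb hx).of_norm]
  simp [add_mul]

/-- Absolute convergence on the polydisc of radii `ρ` permits the Cauchy product. -/
theorem evalSeries_mul (ha : wnorm ρ a ≠ ∞) (hb : wnorm ρ b ≠ ∞) (hx : ∀ i, ‖x i‖ₑ ≤ ρ i) :
    evalSeries (a * b) x = evalSeries a x * evalSeries b x := by
  classical
  have hs := summable_mul_of_summable_norm (summable_eval ha hx) (summable_eval hb hx)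
  rw [evalSeries, evalSeries, evalSeries, (summable_eval ha hx).of_norm.tsum_mul_tsum
    (summable_eval hb hx).of_norm hs, ← Finset.HasAntidiagonal.sigmaAntidiagonalEquivProd.tsum_eq]
  refine Eq.symm (((Finset.HasAntidiagonal.sigmaAntidiagonalEquivProd.summable_iff.2
    hs).tsum_sigma).trans (tsum_congr fun γ => ?_))
  rw [tsum_fintype, MvPowerSeries.coeff_mul, Finset.sum_mul]
  refine Eq.symm ((Finset.sum_coe_sort (Finset.HasAntidiagonal.antidiagonal γ)
    fun p : (Fin n →₀ ℕ) × (Fin n →₀ ℕ) => MvPowerSeries.coeff p.1 a * monom x p.1 *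
      (MvPowerSeries.coeff p.2 b * monom x p.2)).trans (Finset.sum_congr rfl fun p hp => ?_)).symm
  rw [← Finset.HasAntidiagonal.mem_antidiagonal.1 hp, monom_add]
  ring

theorem evalSeries_zero_point : evalSeries a 0 = MvPowerSeries.coeff 0 a := by
  rw [evalSeries, tsum_eq_single 0]
  · simp
  · intro α hα
    obtain ⟨i, hi⟩ := Finsupp.ne_iff.1 hα
    rw [monom, Finset.prod_eq_zero (Finset.mem_univ i), mul_zero]
    simpa using hi

end WNorm

/-! ### Power series and holomorphic functions -/

/-- The exponent of the monomial spelled by a word. -/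
def wordType {n : ℕ} (w : Σ k, (Fin k → Fin n)) : Fin n →₀ ℕ :=
  ∑ i, Finsupp.single (w.2 i) 1

theorem monom_wordType {n : ℕ} {R : Type*} [CommMonoid R] (x : Fin n → R)
    (w : Σ k, (Fin k → Fin n)) : monom x (wordType w) = ∏ i, x (w.2 i) := by
  classical
  simp only [monom, wordType, Finsupp.coe_finsetSum, Finset.sum_apply,
    ← Finset.prod_pow_eq_pow_sum]
  rw [Finset.prod_comm]
  refine Finset.prod_congr rfl fun i _ => ?_
  rw [Finset.prod_eq_single (w.2 i)]
  · simp
  · intro j _ hj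
    simp [hj.symm]
  · simp

theorem wordType_surjective {n : ℕ} : Function.Surjective (wordType (n := n)) := by
  intro α
  induction α using Finsupp.induction_linear with
  | zero => exact ⟨⟨0, Fin.elim0⟩, by simp [wordType]⟩
  | add f g hf hg =>
    obtain ⟨⟨k, v⟩, rfl⟩ := hf
    obtain ⟨⟨l, w⟩, rfl⟩ := hg
    exact ⟨⟨k + l, Fin.append v w⟩, by simp [wordType, Fin.sum_univ_add]⟩
  | single i k => exact ⟨⟨k, fun _ => i⟩, by simp [wordType]⟩

/-- A word is a noncommutative monomial, and the values of a multilinear series on basis vectors are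
indexed by words. Adding the coefficients of all words that spell the same monomial does not
increase the norm. -/
theorem exists_series_of_words {n : ℕ} (c : (Σ k, (Fin k → Fin n)) → ℂ) (ρ : Fin n → ℝ≥0∞)
    (hc : ∑' w, ‖c w‖ₑ * monom ρ (wordType w) ≠ ∞) :
    ∃ a : MvPowerSeries (Fin n) ℂ, wnorm ρ a ≠ ∞ ∧ ∀ x : Fin n → ℂ, (∀ i, ‖x i‖ₑ ≤ ρ i) →
      evalSeries a x = ∑' w, c w * monom x (wordType w) := by
  let e := Equiv.sigmaFiberEquiv (wordType (n := n))
  let a : MvPowerSeries (Fin n) ℂ := fun α => ∑' w : {w // wordType w = α}, c w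
  have ha : ∀ α, MvPowerSeries.coeff α a = ∑' w : {w // wordType w = α}, c w := fun _ => rfl
  have hsum : ∀ x : Fin n → ℂ, (∀ i, ‖x i‖ₑ ≤ ρ i) →
      Summable fun w => c w * monom x (wordType w) := by
    intro x hx
    have h : ∑' w, ‖c w * monom x (wordType w)‖ₑ ≠ ∞ := by
      refine ne_top_of_le_ne_top hc (ENNReal.tsum_le_tsum fun w => ?_)
      rw [enorm_mul, enorm_monom]
      exact mul_le_mul_right (monom_mono hx _) _
    simp only [enorm_eq_nnnorm] at h
    have := ENNReal.tsum_coe_ne_top_iff_summable.1 h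
    exact Summable.of_nnnorm this
  have hsum' : ∀ x : Fin n → ℂ, (∀ i, ‖x i‖ₑ ≤ ρ i) →
      Summable fun p : Σ α, {w // wordType (n := n) w = α} => c p.2 * monom x p.1 := by
    intro x hx
    convert e.summable_iff.2 (hsum x hx) using 1
    funext p
    obtain ⟨α, w, rfl⟩ := p
    rfl
  refine ⟨a, ?_, ?_⟩
  · refine ne_top_of_le_ne_top hc ?_
    rw [← e.tsum_eq, ENNReal.tsum_sigma']
    refine ENNReal.tsum_le_tsum fun α => ?_
    rw [ha]
    calc _ ≤ (∑' w : {w // wordType w = α}, ‖c w‖ₑ) * monom ρ α :=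
          mul_le_mul_left (enorm_tsum_le_tsum_enorm) _
      _ = ∑' w : {w // wordType w = α}, ‖c w‖ₑ * monom ρ α := ENNReal.tsum_mul_right.symm
      _ ≤ _ := by
        refine ENNReal.tsum_le_tsum fun w => ?_
        obtain ⟨w, rfl⟩ := w
        exact le_rfl
  · intro x hx
    have h := hsum' x hx
    rw [← e.tsum_eq]
    have h2 : ∀ p : Σ α, {w // wordType (n := n) w = α},
        c (e p) * monom x (wordType (e p)) = c p.2 * monom x p.1 := by
      rintro ⟨α, w, rfl⟩
      rfl
    rw [tsum_congr h2, h.tsum_sigma, evalSeries]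
    refine tsum_congr fun α => ?_
    exact tsum_mul_right.symm

/-- Each coefficient is placed on a single chosen word spelling its monomial, and all other words
get zero, so the norm is preserved exactly. -/
theorem exists_words_of_series {n : ℕ} (a : MvPowerSeries (Fin n) ℂ) :
    ∃ c : (Σ k, (Fin k → Fin n)) → ℂ,
      (∀ ρ, ∑' w, ‖c w‖ₑ * monom ρ (wordType w) = wnorm ρ a) ∧
      ∀ x : Fin n → ℂ, evalSeries a x = ∑' w, c w * monom x (wordType w) := by
  classical
  obtain ⟨s, hs⟩ := (wordType_surjective (n := n)).hasRightInverse
  have hinj := hs.injective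
  refine ⟨fun w => if s (wordType w) = w then MvPowerSeries.coeff (wordType w) a else 0,
    fun ρ => ?_, fun x => ?_⟩
  · rw [← hinj.tsum_eq, wnorm]
    · refine tsum_congr fun α => ?_
      simp [hs α]
    · intro w hw
      by_contra hne
      have : s (wordType w) ≠ w := fun h => hne ⟨_, h⟩
      simp [this] at hw
  · rw [← hinj.tsum_eq, evalSeries]
    · refine tsum_congr fun α => ?_
      simp [hs α]
    · intro w hw
      by_contra hne
      have : s (wordType w) ≠ w := fun h => hne ⟨_, h⟩
      simp [this] at hw

end AnalyticGerm

end

section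

open scoped ENNReal NNReal

namespace AnalyticGerm

/-- Expanding the degree `k` term in the standard basis gives `n ^ k` words, each with coefficient
at most `‖p k‖`. The resulting geometric factor is absorbed by shrinking the radius. -/
theorem exists_evalSeries_eq {n : ℕ} {f : (Fin n → ℂ) → ℂ} (hf : AnalyticAt ℂ f 0) :
    ∃ ρ : ℝ≥0, 0 < ρ ∧ ∃ a : MvPowerSeries (Fin n) ℂ, wnorm (fun _ => (ρ : ℝ≥0∞)) a ≠ ∞ ∧
      ∀ x : Fin n → ℂ, (∀ i, ‖x i‖ₑ ≤ ρ) → f x = evalSeries a x := by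
  obtain ⟨p, r, hp⟩ := hf
  obtain ⟨R, hR0, hRr⟩ := ENNReal.lt_iff_exists_nnreal_btwn.1 hp.r_pos
  have hR0 : 0 < R := by exact_mod_cast hR0
  obtain ⟨C, hC, hpC⟩ := p.nnnorm_mul_pow_le_of_lt_radius (hRr.trans_le hp.r_le)
  -- Chosen so that `n ρ ≤ R / 2`, which bounds the degree `k` part by `C / 2 ^ k`; `n + 1` keeps
  -- the quotient meaningful for `n = 0`.
  set ρ : ℝ≥0 := R / (2 * (n + 1)) with hρ
  have hρ0 : 0 < ρ := by positivity
  have hρR : (n : ℝ≥0) * ρ ≤ R / 2 := by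
    rw [hρ, mul_div_assoc', div_le_div_iff₀ (by positivity) (by positivity)]
    have : (n : ℝ≥0) ≤ n + 1 := by simp
    calc (n : ℝ≥0) * R * 2 ≤ (n + 1) * R * 2 := by gcongr
      _ = _ := by ring
  have hρR' : ρ < R := by
    rw [hρ]
    apply div_lt_self hR0
    have : (0 : ℝ≥0) ≤ n := zero_le
    calc (1 : ℝ≥0) < 2 * 1 := by norm_num
      _ ≤ _ := by gcongr; simp
  let c : (Σ k, (Fin k → Fin n)) → ℂ := fun w => p w.1 fun i => Pi.single (w.2 i) 1
  have hcn : ∀ w, ‖c w‖₊ ≤ ‖p w.1‖₊ := by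
    intro w
    refine (ContinuousMultilinearMap.le_opNNNorm _ _).trans ?_
    have : ∏ i, ‖(Pi.single (w.2 i) 1 : Fin n → ℂ)‖₊ = 1 := by
      refine Finset.prod_eq_one fun i _ => ?_
      have := Pi.nnnorm_single (G := fun _ : Fin n => ℂ) (i := w.2 i) (1 : ℂ)
      simpa using this
    rw [this, mul_one]
  have hcs : ∑' w, ‖c w‖ₑ * monom (fun _ => (ρ : ℝ≥0∞)) (wordType w) ≠ ∞ := by
    have h1 : ∑' w, ‖c w‖ₑ * monom (fun _ => (ρ : ℝ≥0∞)) (wordType w) ≤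
        ∑' k : ℕ, ((C * (1 / 2) ^ k : ℝ≥0) : ℝ≥0∞) := by
      rw [ENNReal.tsum_sigma']
      refine ENNReal.tsum_le_tsum fun k => ?_
      rw [tsum_fintype]
      calc _ ≤ ∑ w : Fin k → Fin n, ((‖p k‖₊ * ρ ^ k : ℝ≥0) : ℝ≥0∞) := by
            refine Finset.sum_le_sum fun w _ => ?_
            rw [monom_wordType, Finset.prod_const, Finset.card_univ, Fintype.card_fin,
              enorm_eq_nnnorm]
            push_cast
            gcongr
            exact hcn ⟨k, w⟩
        _ = ((n ^ k * (‖p k‖₊ * ρ ^ k) : ℝ≥0) : ℝ≥0∞) := by simp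
        _ ≤ _ := by
          rw [ENNReal.coe_le_coe]
          calc (n : ℝ≥0) ^ k * (‖p k‖₊ * ρ ^ k) = ‖p k‖₊ * (n * ρ) ^ k := by ring
            _ ≤ ‖p k‖₊ * (R / 2) ^ k := by gcongr
            _ = ‖p k‖₊ * R ^ k * (1 / 2) ^ k := by
              rw [div_eq_mul_one_div, mul_pow]; ring
            _ ≤ _ := by gcongr; exact hpC k
    refine ne_top_of_le_ne_top ?_ h1
    rw [ENNReal.tsum_coe_ne_top_iff_summable]
    exact (NNReal.summable_geometric (by
      rw [← NNReal.coe_lt_coe]; norm_num)).mul_left _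
  obtain ⟨a, ha, hae⟩ := exists_series_of_words c _ hcs
  refine ⟨ρ, hρ0, a, ha, fun x hx => ?_⟩
  have hxR : x ∈ Metric.eball (0 : Fin n → ℂ) r := by
    rw [Metric.mem_eball, edist_zero_right]
    refine lt_of_le_of_lt ?_ hRr
    have : ‖x‖₊ ≤ R := by
      rw [pi_nnnorm_le_iff]
      intro i
      have := hx i
      rw [enorm_eq_nnnorm, ENNReal.coe_le_coe] at this
      exact this.trans hρR'.le
    rw [enorm_eq_nnnorm]
    exact_mod_cast this
  have hs := (hp.hasSum hxR).tsum_eq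
  rw [zero_add] at hs
  rw [hae x hx, ← hs]
  have hsum : Summable fun w => c w * monom x (wordType w) := by
    have h : ∑' w, ‖c w * monom x (wordType w)‖ₑ ≠ ∞ := by
      refine ne_top_of_le_ne_top hcs (ENNReal.tsum_le_tsum fun w => ?_)
      rw [enorm_mul, enorm_monom]
      exact mul_le_mul_right (monom_mono hx _) _
    simp only [enorm_eq_nnnorm] at h
    exact Summable.of_nnnorm (ENNReal.tsum_coe_ne_top_iff_summable.1 h)
  rw [hsum.tsum_sigma]
  refine tsum_congr fun k => ?_
  rw [tsum_fintype]
  have hx' : x = ∑ j, x j • (Pi.single j 1 : Fin n → ℂ) := by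
    ext i
    simp [Finset.sum_apply, Pi.single_apply]
  conv_lhs => rw [hx']
  rw [ContinuousMultilinearMap.map_sum]
  refine Finset.sum_congr rfl fun w _ => ?_
  rw [ContinuousMultilinearMap.map_smul_univ, monom_wordType, smul_eq_mul, mul_comm]

/-- The degree `k` multilinear map is a combination over words of products of coordinate
projections, each of norm at most one. -/
theorem analyticAt_evalSeries {n : ℕ} {a : MvPowerSeries (Fin n) ℂ} {ρ : ℝ≥0} (hρ : 0 < ρ)
    (ha : wnorm (fun _ => (ρ : ℝ≥0∞)) a ≠ ∞) : AnalyticAt ℂ (evalSeries a) 0 := by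
  obtain ⟨c, hc, hce⟩ := exists_words_of_series a
  let M : ∀ w : Σ k, (Fin k → Fin n), ContinuousMultilinearMap ℂ (fun _ : Fin w.1 => Fin n → ℂ) ℂ :=
    fun w => (ContinuousMultilinearMap.mkPiAlgebra ℂ (Fin w.1) ℂ).compContinuousLinearMap
      fun i => ContinuousLinearMap.proj (w.2 i)
  have hM : ∀ w, ‖M w‖₊ ≤ 1 := by
    intro w
    refine NNReal.coe_le_coe.1 ?_
    rw [coe_nnnorm, NNReal.coe_one]
    refine ContinuousMultilinearMap.opNorm_le_bound zero_le_one fun m => ?_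
    simp only [M, ContinuousMultilinearMap.compContinuousLinearMap_apply,
      ContinuousMultilinearMap.mkPiAlgebra_apply, ContinuousLinearMap.proj_apply]
    rw [norm_prod, one_mul]
    exact Finset.prod_le_prod (fun _ _ => norm_nonneg _) fun i _ => norm_le_pi_norm (m i) _
  let p : FormalMultilinearSeries ℂ (Fin n → ℂ) ℂ := fun k =>
    ∑ w : Fin k → Fin n, c ⟨k, w⟩ • M ⟨k, w⟩
  have hcw : ∑' w, ‖c w‖ₑ * monom (fun _ => (ρ : ℝ≥0∞)) (wordType w) ≠ ∞ := by rwa [hc]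
  refine ⟨p, ρ, ?_, by exact_mod_cast hρ, ?_⟩
  · apply FormalMultilinearSeries.le_radius_of_summable_nnnorm
    rw [← ENNReal.tsum_coe_ne_top_iff_summable]
    refine ne_top_of_le_ne_top hcw ?_
    rw [ENNReal.tsum_sigma']
    refine ENNReal.tsum_le_tsum fun k => ?_
    rw [tsum_fintype]
    calc ((‖p k‖₊ * ρ ^ k : ℝ≥0) : ℝ≥0∞)
        ≤ (((∑ w : Fin k → Fin n, ‖c ⟨k, w⟩‖₊) * ρ ^ k : ℝ≥0) : ℝ≥0∞) := by
          rw [ENNReal.coe_le_coe]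
          gcongr
          refine (nnnorm_sum_le _ _).trans (Finset.sum_le_sum fun w _ => ?_)
          rw [nnnorm_smul]
          exact mul_le_of_le_one_right' (hM _)
      _ = _ := by
        push_cast
        rw [Finset.sum_mul]
        refine Finset.sum_congr rfl fun w _ => ?_
        rw [monom_wordType, Finset.prod_const, Finset.card_univ, Fintype.card_fin,
          enorm_eq_nnnorm]
  · intro x hx
    rw [Metric.mem_eball, edist_zero_right, enorm_eq_nnnorm, ENNReal.coe_lt_coe] at hx
    have hx' : ∀ i, ‖x i‖ₑ ≤ ρ := fun i => by
      rw [enorm_eq_nnnorm, ENNReal.coe_le_coe]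
      exact (nnnorm_le_pi_nnnorm x i).trans hx.le
    have hsum : Summable fun w => c w * monom x (wordType w) := by
      have h : ∑' w, ‖c w * monom x (wordType w)‖ₑ ≠ ∞ := by
        refine ne_top_of_le_ne_top hcw (ENNReal.tsum_le_tsum fun w => ?_)
        rw [enorm_mul, enorm_monom]
        exact mul_le_mul_right (monom_mono hx' _) _
      simp only [enorm_eq_nnnorm] at h
      exact Summable.of_nnnorm (ENNReal.tsum_coe_ne_top_iff_summable.1 h)
    rw [zero_add, hce]
    refine hsum.hasSum.sigma fun k => ?_
    convert hasSum_fintype (fun w : Fin k → Fin n => c ⟨k, w⟩ * monom x (wordType ⟨k, w⟩)) using 1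
    simp [p, M, monom_wordType]

end AnalyticGerm

end

section

open scoped ENNReal NNReal

namespace AnalyticGerm

/-! ### Weierstrass division for power series -/

open MvPowerSeries

/-- Division by the `d`-th power of the variable `0`, discarding the remainder. -/
def shiftZero {n : ℕ} (d : ℕ) (a : MvPowerSeries (Fin (n + 1)) ℂ) :
    MvPowerSeries (Fin (n + 1)) ℂ :=
  fun α => coeff (α + Finsupp.single 0 d) a

/-- The coefficient of the `k`-th power of the variable `0`. -/
def sliceZero {n : ℕ} (k : ℕ) (a : MvPowerSeries (Fin (n + 1)) ℂ) : MvPowerSeries (Fin n) ℂ :=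
  fun β => coeff (β.cons k) a

section Division

variable {n d : ℕ} {ρ : Fin (n + 1) → ℝ≥0∞}

@[simp] theorem coeff_shiftZero (α : Fin (n + 1) →₀ ℕ) (a : MvPowerSeries (Fin (n + 1)) ℂ) :
    coeff α (shiftZero d a) = coeff (α + Finsupp.single 0 d) a := rfl

@[simp] theorem coeff_sliceZero (k : ℕ) (β : Fin n →₀ ℕ) (a : MvPowerSeries (Fin (n + 1)) ℂ) :
    coeff β (sliceZero k a) = coeff (β.cons k) a := rfl

theorem wnorm_shiftZero_mul_le (a : MvPowerSeries (Fin (n + 1)) ℂ) :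
    wnorm ρ (shiftZero d a) * ρ 0 ^ d ≤ wnorm ρ a := by
  rw [wnorm, wnorm, ← ENNReal.tsum_mul_right]
  refine le_trans (le_of_eq (tsum_congr fun α => ?_)) (ENNReal.tsum_comp_le_tsum_of_injective
    (add_left_injective (Finsupp.single 0 d)) fun α => ‖coeff α a‖ₑ * monom ρ α)
  rw [coeff_shiftZero, monom_add, monom_single_zero, mul_assoc]

theorem wnorm_sliceZero_mul_le (k : ℕ) (a : MvPowerSeries (Fin (n + 1)) ℂ) :
    wnorm (Fin.tail ρ) (sliceZero k a) * ρ 0 ^ k ≤ wnorm ρ a := by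
  rw [wnorm, wnorm, ← ENNReal.tsum_mul_right]
  refine le_trans (le_of_eq (tsum_congr fun β => ?_)) (ENNReal.tsum_comp_le_tsum_of_injective
    (Finsupp.cons_right_injective k) fun α => ‖coeff α a‖ₑ * monom ρ α)
  rw [coeff_sliceZero, monom_cons, mul_assoc, mul_comm (monom _ _)]

/-- The vanishing hypothesis makes the series a polynomial of degree less than `d` in the variable
`0`. Summing first over the remaining exponents exhibits its coefficients. -/
theorem evalSeries_eq_sum_slice {a : MvPowerSeries (Fin (n + 1)) ℂ} (ha : wnorm ρ a ≠ ∞)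
    (had : ∀ α : Fin (n + 1) →₀ ℕ, d ≤ α 0 → coeff α a = 0) {x : Fin (n + 1) → ℂ}
    (hx : ∀ i, ‖x i‖ₑ ≤ ρ i) :
    evalSeries a x = ∑ k : Fin d, evalSeries (sliceZero k a) (Fin.tail x) * x 0 ^ (k : ℕ) := by
  let e : ℕ × (Fin n →₀ ℕ) ≃ (Fin (n + 1) →₀ ℕ) :=
    { toFun := fun p => p.2.cons p.1
      invFun := fun α => (α 0, α.tail)
      left_inv := fun p => by simp
      right_inv := fun α => by simp }
  have hs := e.summable_iff.2 (summable_eval ha hx).of_norm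
  rw [evalSeries, ← e.tsum_eq]
  refine (hs.tsum_prod).trans ?_
  rw [tsum_eq_sum (s := Finset.range d), ← Fin.sum_univ_eq_sum_range
    (fun k => ∑' c, ((fun α => coeff α a * monom x α) ∘ ⇑e) (k, c))]
  · refine Finset.sum_congr rfl fun k _ => ?_
    rw [evalSeries, ← tsum_mul_right]
    refine tsum_congr fun β => ?_
    simp only [e, Function.comp, Equiv.coe_fn_mk, coeff_sliceZero, monom_cons]
    ring
  · intro k hk
    rw [Finset.mem_range, not_lt] at hk
    refine (tsum_congr fun β => ?_).trans tsum_zero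
    simp only [e, Function.comp, Equiv.coe_fn_mk]
    rw [had _ (by simpa using hk), zero_mul]

/-- The Neumann series of Weierstrass division. -/
def divisionTerm (d : ℕ) (s b : MvPowerSeries (Fin (n + 1)) ℂ) :
    ℕ → MvPowerSeries (Fin (n + 1)) ℂ
  | 0 => shiftZero d b
  | k + 1 => -shiftZero d (divisionTerm d s b k * s)

/-- The quotient must solve `q = shiftZero d b - shiftZero d (q * s)`. The bound on `s` makes `q ↦
shiftZero d (q * s)` shrink norms by the factor `1/2`, so the Neumann series converges. -/
theorem exists_series_division (hρ : ∀ i, ρ i ≠ 0) (hρ' : ∀ i, ρ i ≠ ∞)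
    {s b : MvPowerSeries (Fin (n + 1)) ℂ} (hs : wnorm ρ s ≤ ρ 0 ^ d * 2⁻¹)
    (hb : wnorm ρ b ≠ ∞) :
    ∃ q, wnorm ρ q ≠ ∞ ∧ ∀ α : Fin (n + 1) →₀ ℕ, d ≤ α 0 →
      coeff α (b - q * (monomial (Finsupp.single 0 d) 1 + s)) = 0 := by
  classical
  set t := divisionTerm d s b with ht
  have hd0 : ρ 0 ^ d ≠ 0 := pow_ne_zero _ (hρ 0)
  have hd' : ρ 0 ^ d ≠ ∞ := ENNReal.pow_ne_top (hρ' 0)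
  have hstep : ∀ k, wnorm ρ (t (k + 1)) ≤ wnorm ρ (t k) * 2⁻¹ := by
    intro k
    have h1 : wnorm ρ (t (k + 1)) * ρ 0 ^ d ≤ wnorm ρ (t k) * 2⁻¹ * ρ 0 ^ d := by
      calc wnorm ρ (t (k + 1)) * ρ 0 ^ d = wnorm ρ (shiftZero d (t k * s)) * ρ 0 ^ d := by
            rw [ht, divisionTerm, wnorm_neg]
        _ ≤ wnorm ρ (t k * s) := wnorm_shiftZero_mul_le _
        _ ≤ wnorm ρ (t k) * wnorm ρ s := wnorm_mul_le
        _ ≤ wnorm ρ (t k) * (ρ 0 ^ d * 2⁻¹) := mul_le_mul_right hs _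
        _ = _ := by ring
    exact (ENNReal.mul_le_mul_iff_left hd0 hd').1 h1
  have hgeom : ∀ k, wnorm ρ (t k) ≤ wnorm ρ (t 0) * 2⁻¹ ^ k := by
    intro k
    induction k with
    | zero => simp
    | succ k ih =>
      refine (hstep k).trans ?_
      rw [pow_succ, ← mul_assoc]
      exact mul_le_mul_left ih _
  have ht0 : wnorm ρ (t 0) ≠ ∞ := by
    intro h
    have := wnorm_shiftZero_mul_le (ρ := ρ) (d := d) b
    rw [show shiftZero d b = t 0 from rfl, h, ENNReal.top_mul hd0] at this
    exact hb (top_le_iff.1 this)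
  have hT : ∑' k, wnorm ρ (t k) ≠ ∞ := by
    refine ne_top_of_le_ne_top ?_ (ENNReal.tsum_le_tsum hgeom)
    rw [ENNReal.tsum_mul_left, ENNReal.tsum_geometric, ENNReal.one_sub_inv_two, inv_inv]
    exact ENNReal.mul_ne_top ht0 (by norm_num)
  have hmon0 : ∀ α, monom ρ α ≠ 0 := fun α =>
    Finset.prod_ne_zero_iff.2 fun i _ => pow_ne_zero _ (hρ i)
  have hT2 : ∑' α, ∑' k, ‖coeff α (t k)‖ₑ * monom ρ α ≠ ∞ := by
    rw [ENNReal.tsum_comm]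
    exact hT
  have hsum : ∀ α, Summable fun k => coeff α (t k) := by
    intro α
    have h1 := ENNReal.ne_top_of_tsum_ne_top hT2 α
    rw [ENNReal.tsum_mul_right] at h1
    have h2 : ∑' k, ‖coeff α (t k)‖ₑ ≠ ∞ := by
      intro h
      rw [h, ENNReal.top_mul (hmon0 α)] at h1
      exact h1 rfl
    simp only [enorm_eq_nnnorm] at h2
    exact Summable.of_nnnorm (ENNReal.tsum_coe_ne_top_iff_summable.1 h2)
  let q : MvPowerSeries (Fin (n + 1)) ℂ := fun α => ∑' k, coeff α (t k)
  have hq : ∀ α, HasSum (fun k => coeff α (t k)) (coeff α q) := fun α => (hsum α).hasSum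
  have hqs : ∀ α, HasSum (fun k => coeff α (t k * s)) (coeff α (q * s)) := by
    intro α
    simp only [coeff_mul]
    exact hasSum_sum fun p _ => (hq p.1).mul_right _
  refine ⟨q, ?_, fun α hα => ?_⟩
  · refine ne_top_of_le_ne_top hT2 (ENNReal.tsum_le_tsum fun α => ?_)
    rw [ENNReal.tsum_mul_right]
    exact mul_le_mul_left enorm_tsum_le_tsum_enorm _
  · obtain ⟨β, rfl⟩ : ∃ β, α = β + Finsupp.single 0 d := by
      refine ⟨α - Finsupp.single 0 d, (tsub_add_cancel_of_le ?_).symm⟩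
      rwa [Finsupp.single_le_iff]
    have h1 : HasSum (fun k => coeff β (t (k + 1)))
        (-coeff (β + Finsupp.single 0 d) (q * s)) := by
      have h0 : ∀ k, coeff β (t (k + 1)) = -coeff (β + Finsupp.single 0 d) (t k * s) := fun k => by
        rw [ht, divisionTerm, map_neg, coeff_shiftZero]
      simp only [h0]
      exact (hqs _).neg
    -- The tail `∑ t (k + 1)` is computed twice: as `-shiftZero d (q * s)` by the recursion, and as
    -- `q - t 0`. Equating the two is the fixed point equation.
    have h2 := (hasSum_nat_add_iff' (f := fun k => coeff β (t k)) 1).2 (hq β)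
    have h3 := h1.unique h2
    rw [Finset.sum_range_one, show t 0 = shiftZero d b from rfl, coeff_shiftZero] at h3
    rw [mul_add, map_sub, map_add, coeff_add_mul_monomial, mul_one]
    linear_combination h3

/-- Restricted to the axis of the variable `0`, `a` has order at least `k`, so only the constant
term of `q` contributes in degree `k`. -/
theorem coeff_single_mul_of_forall_lt {k : ℕ} (q : MvPowerSeries (Fin (n + 1)) ℂ)
    {a : MvPowerSeries (Fin (n + 1)) ℂ} (ha : ∀ j < k, coeff (Finsupp.single 0 j) a = 0) :
    coeff (Finsupp.single 0 k) (q * a) = coeff 0 q * coeff (Finsupp.single 0 k) a := by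
  classical
  rw [coeff_mul, Finset.sum_eq_single (0, Finsupp.single 0 k)]
  · rintro ⟨α, β⟩ hp hne
    rw [Finset.HasAntidiagonal.mem_antidiagonal] at hp
    simp only at hp ⊢
    have h0 : α 0 + β 0 = k := by simpa using DFunLike.congr_fun hp 0
    have hβ : β = Finsupp.single 0 (β 0) := by
      ext i
      rcases eq_or_ne i 0 with rfl | hi
      · simp
      · have := DFunLike.congr_fun hp i
        rw [Finsupp.add_apply, Finsupp.single_eq_of_ne hi] at this
        rw [Finsupp.single_eq_of_ne hi]
        omega
    rcases lt_or_eq_of_le (show β 0 ≤ k by omega) with hlt | heq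
    · rw [hβ, ha _ hlt, mul_zero]
    · refine absurd ?_ hne
      rw [heq] at hβ
      rw [hβ, add_eq_right] at hp
      rw [hp, hβ]
  · intro h
    simp at h

/-- The radii shrink anisotropically: by `τ` in the variable `0` and by `τ ^ (d + 1)` in the others.
A monomial occurring in `s` either involves another variable or is a power of `x₀` beyond the
`d`-th, so it gains `τ ^ (d + 1)`, while the target only shrinks by `τ ^ d`. -/
theorem exists_wnorm_le {r : ℝ≥0} (hr : 0 < r) {s : MvPowerSeries (Fin (n + 1)) ℂ}
    (hs : wnorm (fun _ => (r : ℝ≥0∞)) s ≠ ∞)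
    (hsd : ∀ k ≤ d, coeff (Finsupp.single 0 k) s = 0) :
    ∃ ρ : Fin (n + 1) → ℝ≥0, (∀ i, ρ i ≠ 0) ∧ (∀ i, ρ i ≤ r) ∧
      wnorm (fun i => (ρ i : ℝ≥0∞)) s ≤ (ρ 0 : ℝ≥0∞) ^ d * 2⁻¹ := by
  set N := (wnorm (fun _ => (r : ℝ≥0∞)) s).toNNReal with hN
  have hN' : wnorm (fun _ => (r : ℝ≥0∞)) s = N := (ENNReal.coe_toNNReal hs).symm
  -- The spare factor `τ` has to beat the original norm: `τ N ≤ r ^ d / 2`. The summand `1` avoids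
  -- division by zero.
  set τ : ℝ≥0 := min 1 (r ^ d / (2 * (N + 1))) with hτ
  have hτ0 : 0 < τ := lt_min one_pos (by positivity)
  have hτ1 : τ ≤ 1 := min_le_left _ _
  have hτN : τ * N ≤ r ^ d * 2⁻¹ := by
    calc τ * N ≤ r ^ d / (2 * (N + 1)) * (N + 1) := by
          gcongr
          · exact min_le_right _ _
          · simp
      _ = _ := by field_simp
  let t : Fin (n + 1) → ℝ≥0 := Fin.cons τ fun _ => τ ^ (d + 1)
  have ht1 : ∀ i, t i ≤ 1 := by
    intro i
    refine Fin.cases ?_ (fun j => ?_) i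
    · exact hτ1
    · exact pow_le_one₀ zero_le hτ1
  have ht0 : ∀ i, t i ≠ 0 := by
    intro i
    refine Fin.cases ?_ (fun j => ?_) i
    · exact hτ0.ne'
    · exact (pow_pos hτ0 _).ne'
  refine ⟨fun i => t i * r, fun i => mul_ne_zero (ht0 i) hr.ne',
    fun i => mul_le_of_le_one_left' (ht1 i), ?_⟩
  have key : ∀ α : Fin (n + 1) →₀ ℕ, (∀ k ≤ d, α ≠ Finsupp.single 0 k) →
      monom t α ≤ τ ^ (d + 1) := by
    intro α hα
    by_cases h : ∃ j : Fin n, α j.succ ≠ 0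
    · obtain ⟨j, hj⟩ := h
      rw [monom, ← Finset.mul_prod_erase _ _ (Finset.mem_univ j.succ)]
      calc _ ≤ t j.succ ^ α j.succ * 1 := by
            gcongr
            exact Finset.prod_le_one' fun i _ => pow_le_one₀ zero_le (ht1 i)
        _ ≤ t j.succ := by
          rw [mul_one]
          exact pow_le_of_le_one zero_le (ht1 _) hj
        _ = _ := rfl
    · push Not at h
      have h1 : α = Finsupp.single 0 (α 0) := by
        ext i
        refine Fin.cases ?_ (fun j => ?_) i
        · simp
        · rw [h j, Finsupp.single_eq_of_ne (Fin.succ_ne_zero j)]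
      rw [h1, monom_single_zero]
      have : d + 1 ≤ α 0 := by
        by_contra hlt
        exact hα _ (by omega) h1
      exact pow_le_pow_of_le_one zero_le hτ1 this
  have h1 : wnorm (fun i => ((t i * r : ℝ≥0) : ℝ≥0∞)) s ≤
      ((τ ^ (d + 1) : ℝ≥0) : ℝ≥0∞) * wnorm (fun _ => (r : ℝ≥0∞)) s := by
    rw [wnorm, wnorm, ← ENNReal.tsum_mul_left]
    refine ENNReal.tsum_le_tsum fun α => ?_
    by_cases hα : ∃ k ≤ d, α = Finsupp.single 0 k
    · obtain ⟨k, hk, rfl⟩ := hα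
      simp [hsd k hk]
    · push Not at hα
      have h2 : monom (fun i => ((t i * r : ℝ≥0) : ℝ≥0∞)) α =
          ((monom t α : ℝ≥0) : ℝ≥0∞) * monom (fun _ => (r : ℝ≥0∞)) α := by
        simp [monom, mul_pow, Finset.prod_mul_distrib]
      rw [h2]
      calc _ ≤ ‖coeff α s‖ₑ * (((τ ^ (d + 1) : ℝ≥0) : ℝ≥0∞) *
            monom (fun _ => (r : ℝ≥0∞)) α) := by
            gcongr
            exact key α hα
        _ = _ := by ring
  refine h1.trans ?_
  rw [hN']
  have h3 : τ ^ (d + 1) * N ≤ (t 0 * r) ^ d * 2⁻¹ := by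
    calc τ ^ (d + 1) * N = τ ^ d * (τ * N) := by ring
      _ ≤ τ ^ d * (r ^ d * 2⁻¹) := by gcongr
      _ = (τ * r) ^ d * 2⁻¹ := by ring
  calc (((τ ^ (d + 1) : ℝ≥0) : ℝ≥0∞) * N) = ((τ ^ (d + 1) * N : ℝ≥0) : ℝ≥0∞) := by push_cast; ring
    _ ≤ (((t 0 * r) ^ d * 2⁻¹ : ℝ≥0) : ℝ≥0∞) := by exact_mod_cast h3
    _ = _ := by
      rw [ENNReal.coe_mul, ENNReal.coe_pow, ENNReal.coe_inv two_ne_zero, ENNReal.coe_ofNat]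

end Division

end AnalyticGerm

end

section

open scoped ENNReal NNReal

namespace AnalyticGerm

open MvPowerSeries

/-! ### Weierstrass division and preparation for holomorphic functions -/

theorem cons_zero_zero {n : ℕ} : (Fin.cons 0 0 : Fin (n + 1) → ℂ) = 0 := by
  ext i
  refine Fin.cases ?_ (fun j => ?_) i <;> simp

theorem eventually_enorm_le {n : ℕ} {ρ : Fin n → ℝ≥0} (hρ : ∀ i, ρ i ≠ 0) :
    ∀ᶠ x : Fin n → ℂ in 𝓝 0, ∀ i, ‖x i‖ₑ ≤ (ρ i : ℝ≥0∞) := by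
  refine eventually_all.2 fun i => ?_
  have h : Tendsto (fun x : Fin n → ℂ => ‖x i‖ₑ) (𝓝 0) (𝓝 0) := by
    have : Continuous fun x : Fin n → ℂ => ‖x i‖ₑ := (continuous_apply i).enorm
    simpa using this.tendsto 0
  refine (h.eventually (gt_mem_nhds ?_)).mono fun x hx => le_of_lt hx
  exact ENNReal.coe_pos.2 (pos_iff_ne_zero.2 (hρ i))

theorem exists_nnreal_le {n : ℕ} (ρ : Fin n → ℝ≥0) (hρ : ∀ i, ρ i ≠ 0) :
    ∃ r : ℝ≥0, 0 < r ∧ ∀ i, r ≤ ρ i := by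
  obtain rfl | hn := Nat.eq_zero_or_pos n
  · exact ⟨1, one_pos, fun i => i.elim0⟩
  · have : Nonempty (Fin n) := ⟨⟨0, hn⟩⟩
    obtain ⟨i, hi⟩ := Finite.exists_min ρ
    exact ⟨ρ i, pos_iff_ne_zero.2 (hρ i), hi⟩

theorem analyticAt_evalSeries' {n : ℕ} {a : MvPowerSeries (Fin n) ℂ} {ρ : Fin n → ℝ≥0}
    (hρ : ∀ i, ρ i ≠ 0) (ha : wnorm (fun i => (ρ i : ℝ≥0∞)) a ≠ ∞) :
    AnalyticAt ℂ (evalSeries a) 0 := by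
  obtain ⟨r, hr, hr'⟩ := exists_nnreal_le ρ hρ
  exact analyticAt_evalSeries hr
    (ne_top_of_le_ne_top ha (wnorm_mono fun i => ENNReal.coe_le_coe.2 (hr' i)))

theorem wnorm_monomial_ne_top {n : ℕ} (ρ : Fin n → ℝ≥0) (α : Fin n →₀ ℕ) (c : ℂ) :
    wnorm (fun i => (ρ i : ℝ≥0∞)) (monomial α c) ≠ ∞ := by
  classical
  rw [wnorm, tsum_eq_single α]
  · refine ENNReal.mul_ne_top enorm_ne_top ?_
    exact (ENNReal.prod_ne_top fun i _ => ENNReal.pow_ne_top ENNReal.coe_ne_top)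
  · intro β hβ
    rw [coeff_monomial_ne hβ, enorm_zero, zero_mul]

theorem evalSeries_monomial {n : ℕ} (α : Fin n →₀ ℕ) (c : ℂ) (x : Fin n → ℂ) :
    evalSeries (monomial α c) x = c * monom x α := by
  classical
  rw [evalSeries, tsum_eq_single α]
  · rw [coeff_monomial_same]
  · intro β hβ
    rw [coeff_monomial_ne hβ, zero_mul]

/-- Weierstrass division by a convergent power series that is regular in the variable `0`. -/
theorem exists_division_series {n d : ℕ} {r : ℝ≥0} (hr : 0 < r)
    {a b : MvPowerSeries (Fin (n + 1)) ℂ} (ha : wnorm (fun _ => (r : ℝ≥0∞)) a ≠ ∞)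
    (hb : wnorm (fun _ => (r : ℝ≥0∞)) b ≠ ∞) (had : ∀ k < d, coeff (Finsupp.single 0 k) a = 0)
    (hc : coeff (Finsupp.single 0 d) a ≠ 0) :
    ∃ (ρ : Fin (n + 1) → ℝ≥0) (q : MvPowerSeries (Fin (n + 1)) ℂ), (∀ i, ρ i ≠ 0) ∧
      (∀ i, ρ i ≤ r) ∧ wnorm (fun i => (ρ i : ℝ≥0∞)) q ≠ ∞ ∧
      ∀ α : Fin (n + 1) →₀ ℕ, d ≤ α 0 → coeff α (b - q * a) = 0 := by
  set c := coeff (Finsupp.single 0 d) a with hcdef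
  set s : MvPowerSeries (Fin (n + 1)) ℂ := C c⁻¹ * a - monomial (Finsupp.single 0 d) 1 with hs
  have hsa : wnorm (fun _ => (r : ℝ≥0∞)) s ≠ ∞ := by
    refine ne_top_of_le_ne_top ?_ wnorm_sub_le
    refine ENNReal.add_ne_top.2 ⟨ne_top_of_le_ne_top ?_ wnorm_mul_le, ?_⟩
    · refine ENNReal.mul_ne_top ?_ ha
      exact wnorm_monomial_ne_top (fun _ => r) 0 _
    · exact wnorm_monomial_ne_top (fun _ => r) _ _
  have hsd : ∀ k ≤ d, coeff (Finsupp.single 0 k) s = 0 := by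
    classical
    intro k hk
    rw [hs, map_sub, coeff_C_mul, coeff_monomial]
    rcases lt_or_eq_of_le hk with hlt | rfl
    · rw [had k hlt, if_neg, mul_zero, sub_zero]
      intro h
      have := (Finsupp.single_injective 0 h)
      omega
    · rw [← hcdef, inv_mul_cancel₀ hc, if_pos rfl, sub_self]
  obtain ⟨ρ, hρ0, hρr, hρs⟩ := exists_wnorm_le hr hsa hsd
  have hbρ : wnorm (fun i => (ρ i : ℝ≥0∞)) b ≠ ∞ :=
    ne_top_of_le_ne_top hb (wnorm_mono fun i => ENNReal.coe_le_coe.2 (hρr i))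
  obtain ⟨q, hq, hqb⟩ := exists_series_division (ρ := fun i => (ρ i : ℝ≥0∞))
    (fun i => ENNReal.coe_ne_zero.2 (hρ0 i)) (fun i => ENNReal.coe_ne_top) hρs hbρ
  refine ⟨ρ, q * C c⁻¹, hρ0, hρr, ?_, fun α hα => ?_⟩
  · exact ne_top_of_le_ne_top (ENNReal.mul_ne_top hq (wnorm_monomial_ne_top ρ 0 _)) wnorm_mul_le
  · rw [← hqb α hα, hs, mul_assoc, add_sub_cancel]

theorem analyticAt_evalSeries_sliceZero {n : ℕ} {ρ : Fin (n + 1) → ℝ≥0} (hρ : ∀ i, ρ i ≠ 0)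
    {a : MvPowerSeries (Fin (n + 1)) ℂ} (ha : wnorm (fun i => (ρ i : ℝ≥0∞)) a ≠ ∞) (k : ℕ) :
    AnalyticAt ℂ (evalSeries (sliceZero k a)) 0 := by
  refine analyticAt_evalSeries' (ρ := Fin.tail ρ) (fun i => hρ _) ?_
  intro h
  have := wnorm_sliceZero_mul_le (ρ := fun i => (ρ i : ℝ≥0∞)) k a
  rw [show (Fin.tail fun i => (ρ i : ℝ≥0∞)) = fun i => ((Fin.tail ρ i : ℝ≥0) : ℝ≥0∞) from rfl, h,
    ENNReal.top_mul (pow_ne_zero _ (ENNReal.coe_ne_zero.2 (hρ 0)))] at this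
  exact ha (top_le_iff.1 this)

/-- Here `d` is the order of vanishing of `h` along the axis of the variable `0`. Preparation is the
division of `x₀ ^ d` itself, with the quotient as the unit. -/
theorem weierstrass {n : ℕ} {h : (Fin (n + 1) → ℂ) → ℂ} (hh : AnalyticAt ℂ h 0)
    (hne : ¬ ∀ᶠ z : ℂ in 𝓝 0, h (Fin.cons z 0) = 0) :
    ∃ d : ℕ,
      (∃ (c : Fin d → (Fin n → ℂ) → ℂ) (u : (Fin (n + 1) → ℂ) → ℂ),
        (∀ k, AnalyticAt ℂ (c k) 0) ∧ (∀ k, c k 0 = 0) ∧ AnalyticAt ℂ u 0 ∧ u 0 ≠ 0 ∧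
        ∀ᶠ x in 𝓝 0, x 0 ^ d + ∑ k, c k (Fin.tail x) * x 0 ^ (k : ℕ) = u x * h x) ∧
      ∀ g : (Fin (n + 1) → ℂ) → ℂ, AnalyticAt ℂ g 0 →
        ∃ (q : (Fin (n + 1) → ℂ) → ℂ) (r : Fin d → (Fin n → ℂ) → ℂ),
          AnalyticAt ℂ q 0 ∧ (∀ k, AnalyticAt ℂ (r k) 0) ∧
          ∀ᶠ x in 𝓝 0, g x = q x * h x + ∑ k, r k (Fin.tail x) * x 0 ^ (k : ℕ) := by
  classical
  obtain ⟨r, hr, a, ha, hae⟩ := exists_evalSeries_eq hh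
  have hex : ∃ k, coeff (Finsupp.single 0 k) a ≠ 0 := by
    by_contra hcon
    push Not at hcon
    apply hne
    have hcont : Tendsto (fun z : ℂ => (Fin.cons z 0 : Fin (n + 1) → ℂ)) (𝓝 0) (𝓝 0) := by
      have : Continuous fun z : ℂ => (Fin.cons z 0 : Fin (n + 1) → ℂ) :=
        Continuous.finCons (A := fun _ => ℂ) continuous_id continuous_const
      have h0 := this.tendsto 0
      rwa [cons_zero_zero] at h0
    filter_upwards [hcont.eventually (eventually_enorm_le (ρ := fun _ => r) fun _ => hr.ne')]
      with z hz
    rw [hae _ hz, evalSeries]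
    refine (tsum_congr fun α => ?_).trans tsum_zero
    by_cases hα : ∃ j : Fin n, α j.succ ≠ 0
    · obtain ⟨j, hj⟩ := hα
      rw [monom, Finset.prod_eq_zero (Finset.mem_univ j.succ), mul_zero]
      simpa using hj
    · push Not at hα
      have h1 : α = Finsupp.single 0 (α 0) := by
        ext i
        refine Fin.cases ?_ (fun j => ?_) i
        · simp
        · rw [hα j, Finsupp.single_eq_of_ne (Fin.succ_ne_zero j)]
      rw [h1, hcon, zero_mul]
  set d := Nat.find hex with hd
  have hc : coeff (Finsupp.single 0 d) a ≠ 0 := Nat.find_spec hex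
  have had : ∀ k < d, coeff (Finsupp.single 0 k) a = 0 := fun k hk => by
    simpa using Nat.find_min hex hk
  -- the analytic content of an equality of power series
  have hfun : ∀ (ρ : Fin (n + 1) → ℝ≥0) (q b : MvPowerSeries (Fin (n + 1)) ℂ),
      (∀ i, ρ i ≠ 0) → (∀ i, ρ i ≤ r) → wnorm (fun i => (ρ i : ℝ≥0∞)) q ≠ ∞ →
      wnorm (fun i => (ρ i : ℝ≥0∞)) b ≠ ∞ →
      (∀ α : Fin (n + 1) →₀ ℕ, d ≤ α 0 → coeff α (b - q * a) = 0) →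
      AnalyticAt ℂ (evalSeries q) 0 ∧
      (∀ k : Fin d, AnalyticAt ℂ (evalSeries (sliceZero k (b - q * a))) 0) ∧
      ∀ᶠ x in 𝓝 0, evalSeries b x = evalSeries q x * h x +
        ∑ k : Fin d, evalSeries (sliceZero k (b - q * a)) (Fin.tail x) * x 0 ^ (k : ℕ) := by
    intro ρ q b hρ hρr hq hb hlow
    have ha' : wnorm (fun i => (ρ i : ℝ≥0∞)) a ≠ ∞ :=
      ne_top_of_le_ne_top ha (wnorm_mono fun i => ENNReal.coe_le_coe.2 (hρr i))
    have hqa : wnorm (fun i => (ρ i : ℝ≥0∞)) (q * a) ≠ ∞ :=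
      ne_top_of_le_ne_top (ENNReal.mul_ne_top hq ha') wnorm_mul_le
    have hrem : wnorm (fun i => (ρ i : ℝ≥0∞)) (b - q * a) ≠ ∞ :=
      ne_top_of_le_ne_top (ENNReal.add_ne_top.2 ⟨hb, hqa⟩) wnorm_sub_le
    refine ⟨analyticAt_evalSeries' hρ hq, fun k => analyticAt_evalSeries_sliceZero hρ hrem k, ?_⟩
    filter_upwards [eventually_enorm_le hρ] with x hx
    rw [← evalSeries_eq_sum_slice hrem hlow hx, hae x fun i => (hx i).trans
      (ENNReal.coe_le_coe.2 (hρr i)), ← evalSeries_mul hq ha' hx, ← evalSeries_add hqa hrem hx,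
      add_sub_cancel]
  refine ⟨d, ?_, fun g hg => ?_⟩
  · obtain ⟨ρ, q, hρ, hρr, hq, hlow⟩ := exists_division_series hr ha
      (wnorm_monomial_ne_top (fun _ => r) (Finsupp.single 0 d) 1) had hc
    obtain ⟨h1, h2, h3⟩ := hfun ρ q _ hρ hρr hq (wnorm_monomial_ne_top ρ _ _) hlow
    set e := monomial (Finsupp.single 0 d) (1 : ℂ) - q * a with he
    refine ⟨fun k x => -evalSeries (sliceZero k e) x, evalSeries q, fun k => (h2 k).neg,
      fun k => ?_, h1, ?_, ?_⟩
    -- The value at `0` is the coefficient of `x₀ ^ k` in `x₀ ^ d - q a`; since `k < d`, neither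
    -- term contributes.
    · beta_reduce
      rw [evalSeries_zero_point, coeff_sliceZero, Finsupp.cons_zero_eq_single_zero, he, map_sub,
        coeff_single_mul_of_forall_lt q fun j hj => had j (hj.trans k.2), had _ k.2,
        coeff_monomial_ne, mul_zero, sub_zero, neg_zero]
      intro hk
      exact k.2.ne (Finsupp.single_injective 0 hk)
    -- If `q` vanished at `0`, the coefficient of `x₀ ^ d` in `x₀ ^ d - q a` would be `1`, but the
    -- remainder has degree less than `d` in `x₀`.
    · intro h0
      rw [evalSeries_zero_point] at h0
      have := hlow (Finsupp.single 0 d) (by simp)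
      rw [map_sub, coeff_single_mul_of_forall_lt q had, h0, coeff_monomial_same] at this
      simp at this
    · filter_upwards [h3] with x hx
      rw [evalSeries_monomial, monom_single_zero, one_mul] at hx
      simp only [neg_mul, Finset.sum_neg_distrib]
      linear_combination hx
  · obtain ⟨r', hr', b, hb, hbe⟩ := exists_evalSeries_eq hg
    obtain ⟨ρ, q, hρ, hρr, hq, hlow⟩ := exists_division_series (r := min r r') (lt_min hr hr')
      (ne_top_of_le_ne_top ha (wnorm_mono fun i => ENNReal.coe_le_coe.2 (min_le_left _ _)))
      (ne_top_of_le_ne_top hb (wnorm_mono fun i => ENNReal.coe_le_coe.2 (min_le_right _ _))) had hc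
    obtain ⟨h1, h2, h3⟩ := hfun ρ q b hρ (fun i => (hρr i).trans (min_le_left _ _)) hq
      (ne_top_of_le_ne_top hb (wnorm_mono fun i => ENNReal.coe_le_coe.2
        ((hρr i).trans (min_le_right _ _)))) hlow
    refine ⟨_, _, h1, h2, ?_⟩
    filter_upwards [h3, eventually_enorm_le (ρ := fun _ => r') fun _ => hr'.ne'] with x hx hx'
    rw [hbe x hx', hx]

end AnalyticGerm

end

namespace AnalyticGerm

/-! ### Basic structure of the ring of germs -/

section Basic

variable {n m : ℕ} {p : Fin n → ℂ}

/-- The ring of functions that are holomorphic near `p`. -/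
def analyticAtSubring (p : Fin n → ℂ) : Subring ((Fin n → ℂ) → ℂ) where
  carrier := {g | AnalyticAt ℂ g p}
  mul_mem' hg hh := AnalyticAt.mul hg hh
  one_mem' := analyticAt_const
  add_mem' hg hh := AnalyticAt.add hg hh
  zero_mem' := analyticAt_const
  neg_mem' hg := AnalyticAt.neg hg

/-- Taking germs, as a ring homomorphism. -/
def germHom (p : Fin n → ℂ) : analyticAtSubring p →+* LocalRingAt p where
  toFun g := germ p g.1 g.2
  map_one' := rfl
  map_mul' _ _ := rfl
  map_zero' := rfl
  map_add' _ _ := rfl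

theorem exists_germ_eq (φ : LocalRingAt p) : ∃ g, ∃ hg : AnalyticAt ℂ g p, germ p g hg = φ := by
  obtain ⟨_, g, hg, rfl⟩ := φ
  exact ⟨g, hg, rfl⟩

theorem germHom_surjective (p : Fin n → ℂ) : Function.Surjective (germHom p) := fun φ => by
  obtain ⟨g, hg, rfl⟩ := exists_germ_eq φ
  exact ⟨⟨g, hg⟩, rfl⟩

theorem germ_eq_iff {g h : (Fin n → ℂ) → ℂ} (hg : AnalyticAt ℂ g p) (hh : AnalyticAt ℂ h p) :
    germ p g hg = germ p h hh ↔ g =ᶠ[𝓝 p] h :=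
  Subtype.ext_iff.trans Germ.coe_eq

theorem germ_eq_zero_iff {g : (Fin n → ℂ) → ℂ} (hg : AnalyticAt ℂ g p) :
    germ p g hg = 0 ↔ ∀ᶠ x in 𝓝 p, g x = 0 :=
  germ_eq_iff hg (analyticAt_const (v := (0 : ℂ)))

/-- The value of a germ at `p`. -/
def evalHom (p : Fin n → ℂ) : LocalRingAt p →ₐ[ℂ] ℂ where
  toRingHom := Germ.valueRingHom.comp (holSubring p).subtype
  commutes' _ := rfl

@[simp] theorem evalHom_germ (g : (Fin n → ℂ) → ℂ) (hg : AnalyticAt ℂ g p) :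
    evalHom p (germ p g hg) = g p := rfl

theorem isUnit_iff_evalHom_ne_zero (φ : LocalRingAt p) : IsUnit φ ↔ evalHom p φ ≠ 0 := by
  refine ⟨fun h => (h.map (evalHom p)).ne_zero, fun h => ?_⟩
  obtain ⟨g, hg, rfl⟩ := exists_germ_eq φ
  rw [evalHom_germ] at h
  refine IsUnit.of_mul_eq_one (germ p g⁻¹ (hg.inv h)) ?_
  refine (germ_eq_iff (hg.mul (hg.inv h)) analyticAt_const).2 ?_
  filter_upwards [hg.continuousAt.eventually_ne h] with x hx
  simp [hx]

instance : Nontrivial (LocalRingAt p) := (evalHom p).toRingHom.domain_nontrivial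

instance : IsLocalRing (LocalRingAt p) :=
  IsLocalRing.of_nonunits_add fun {a b} ha hb => by
    rw [mem_nonunits_iff, isUnit_iff_evalHom_ne_zero, not_not] at ha hb ⊢
    rw [map_add, ha, hb, add_zero]

open IsLocalRing in
theorem mem_maximalIdeal_iff (φ : LocalRingAt p) : φ ∈ maximalIdeal _ ↔ evalHom p φ = 0 := by
  rw [mem_maximalIdeal, mem_nonunits_iff, isUnit_iff_evalHom_ne_zero, not_not]

/-! ### Pullback of germs -/

/-- Pullback of germs along a holomorphic map. -/
def pullback {q : Fin m → ℂ} (φ : (Fin m → ℂ) → (Fin n → ℂ)) (hφ : AnalyticAt ℂ φ q)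
    (h : φ q = p) : LocalRingAt p →ₐ[ℂ] LocalRingAt q where
  toFun ψ := ⟨ψ.1.compTendsto φ (h ▸ hφ.continuousAt), by
    obtain ⟨_, g, hg, rfl⟩ := ψ
    subst h
    exact ⟨g ∘ φ, hg.comp hφ, rfl⟩⟩
  map_one' := rfl
  map_zero' := rfl
  map_mul' := by
    rintro ⟨_, g, hg, rfl⟩ ⟨_, h, hh, rfl⟩
    rfl
  map_add' := by
    rintro ⟨_, g, hg, rfl⟩ ⟨_, h, hh, rfl⟩
    rfl
  commutes' _ := rfl

theorem AnalyticAt.comp_pullback {q : Fin m → ℂ} {φ : (Fin m → ℂ) → (Fin n → ℂ)}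
    (hφ : AnalyticAt ℂ φ q) (h : φ q = p) {g : (Fin n → ℂ) → ℂ} (hg : AnalyticAt ℂ g p) :
    AnalyticAt ℂ (fun x => g (φ x)) q := by
  subst h
  exact hg.comp hφ

theorem pullback_germ {q : Fin m → ℂ} {φ : (Fin m → ℂ) → (Fin n → ℂ)} (hφ : AnalyticAt ℂ φ q)
    (h : φ q = p) {g : (Fin n → ℂ) → ℂ} (hg : AnalyticAt ℂ g p) :
    pullback φ hφ h (germ p g hg) = germ q (fun x => g (φ x)) (AnalyticAt.comp_pullback hφ h hg) :=
  rfl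

@[simp] theorem evalHom_pullback {q : Fin m → ℂ} {φ : (Fin m → ℂ) → (Fin n → ℂ)}
    (hφ : AnalyticAt ℂ φ q) (h : φ q = p) (ψ : LocalRingAt p) :
    evalHom q (pullback φ hφ h ψ) = evalHom p ψ := by
  obtain ⟨g, hg, rfl⟩ := exists_germ_eq ψ
  rw [pullback_germ, evalHom_germ, evalHom_germ, h]

/-- Pullback of germs along a biholomorphic map. -/
def pullbackEquiv {p q : Fin n → ℂ} (φ φ' : (Fin n → ℂ) → (Fin n → ℂ)) (hφ : AnalyticAt ℂ φ q)
    (hφ' : AnalyticAt ℂ φ' p) (h : φ q = p) (h' : φ' p = q) (hl : ∀ x, φ' (φ x) = x)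
    (hr : ∀ x, φ (φ' x) = x) : LocalRingAt p ≃ₐ[ℂ] LocalRingAt q :=
  AlgEquiv.ofAlgHom (pullback φ hφ h) (pullback φ' hφ' h')
    (by
      ext ψ : 1
      obtain ⟨g, hg, rfl⟩ := exists_germ_eq ψ
      rw [AlgHom.comp_apply, pullback_germ, pullback_germ, AlgHom.id_apply]
      simp only [hl])
    (by
      ext ψ : 1
      obtain ⟨g, hg, rfl⟩ := exists_germ_eq ψ
      rw [AlgHom.comp_apply, pullback_germ, pullback_germ, AlgHom.id_apply]
      simp only [hr])

/-- Pullback along a translation. -/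
def translationEquiv (p : Fin n → ℂ) : LocalRingAt p ≃ₐ[ℂ] LocalRingAt (0 : Fin n → ℂ) :=
  pullbackEquiv (fun x => p + x) (fun x => x - p) (analyticAt_const.add analyticAt_id)
    (analyticAt_id.sub analyticAt_const) (by simp) (by simp) (by simp) (by simp)

@[simp] theorem evalHom_translationEquiv (p : Fin n → ℂ) (φ : LocalRingAt p) :
    evalHom 0 (translationEquiv p φ) = evalHom p φ :=
  evalHom_pullback (analyticAt_const.add analyticAt_id) (add_zero p) φ

/-- Pullback along a linear automorphism. -/
def linearEquivPullback (A : (Fin n → ℂ) ≃L[ℂ] (Fin n → ℂ)) :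
    LocalRingAt (0 : Fin n → ℂ) ≃ₐ[ℂ] LocalRingAt (0 : Fin n → ℂ) :=
  pullbackEquiv A A.symm (A.toContinuousLinearMap.analyticAt _)
    (A.symm.toContinuousLinearMap.analyticAt _) (by simp) (by simp) (by simp) (by simp)

/-- The projection `ℂⁿ⁺¹ → ℂⁿ` forgetting the coordinate `0`. -/
def tailCLM (n : ℕ) : (Fin (n + 1) → ℂ) →L[ℂ] (Fin n → ℂ) :=
  ContinuousLinearMap.pi fun i => ContinuousLinearMap.proj i.succ

/-- The inclusion `𝒪_n → 𝒪_{n+1}` of the germs that do not depend on the coordinate `0`. -/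
def tailPullback (n : ℕ) :
    LocalRingAt (0 : Fin n → ℂ) →ₐ[ℂ] LocalRingAt (0 : Fin (n + 1) → ℂ) :=
  pullback (tailCLM n) ((tailCLM n).analyticAt _) (map_zero _)

theorem analyticAt_coord (j : Fin n) (p : Fin n → ℂ) :
    AnalyticAt ℂ (fun x : Fin n → ℂ => x j) p :=
  (ContinuousLinearMap.proj (R := ℂ) (φ := fun _ : Fin n => ℂ) j).analyticAt p

/-- The germ of the coordinate function `x_j`. -/
def coord (p : Fin n → ℂ) (j : Fin n) : LocalRingAt p := germ p (fun x => x j) (analyticAt_coord j p)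

theorem germ_weierstrass {d : ℕ} (r : Fin d → (Fin n → ℂ) → ℂ) (hr : ∀ k, AnalyticAt ℂ (r k) 0)
    (hR : AnalyticAt ℂ (fun x : Fin (n + 1) → ℂ => ∑ k, r k (Fin.tail x) * x 0 ^ (k : ℕ)) 0) :
    germ 0 (fun x => ∑ k, r k (Fin.tail x) * x 0 ^ (k : ℕ)) hR =
      ∑ k, tailPullback n (germ 0 (r k) (hr k)) * coord 0 0 ^ (k : ℕ) := by
  let T : Fin d → analyticAtSubring (0 : Fin (n + 1) → ℂ) := fun k =>
    ⟨fun x => r k (Fin.tail x), AnalyticAt.comp_pullback ((tailCLM n).analyticAt _)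
      (map_zero _) (hr k)⟩ * ⟨fun x => x 0, analyticAt_coord 0 _⟩ ^ (k : ℕ)
  have h1 : (⟨_, hR⟩ : analyticAtSubring (0 : Fin (n + 1) → ℂ)) = ∑ k, T k := by
    apply Subtype.ext
    rw [AddSubmonoidClass.coe_finsetSum]
    funext x
    simp [T]
  have h2 := congrArg (germHom 0) h1
  rw [map_sum] at h2
  exact h2

theorem analyticAt_weierstrass {d : ℕ} (r : Fin d → (Fin n → ℂ) → ℂ)
    (hr : ∀ k, AnalyticAt ℂ (r k) 0) :
    AnalyticAt ℂ (fun x : Fin (n + 1) → ℂ => ∑ k, r k (Fin.tail x) * x 0 ^ (k : ℕ)) 0 := by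
  refine Finset.analyticAt_fun_sum _ fun k _ => ?_
  exact (AnalyticAt.comp_pullback ((tailCLM n).analyticAt _) (map_zero _) (hr k)).mul
    ((analyticAt_coord 0 0).pow _)

/-- A germ is regular in the coordinate `0` if it does not vanish identically on the axis. -/
theorem exists_weierstrass {g : (Fin (n + 1) → ℂ) → ℂ} (hg : AnalyticAt ℂ g 0)
    (hne : ¬ ∀ᶠ z : ℂ in 𝓝 0, g (Fin.cons z 0) = 0) :
    ∃ (d : ℕ) (c : Fin d → LocalRingAt (0 : Fin n → ℂ)),
      (∀ k, evalHom 0 (c k) = 0) ∧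
      (∃ u, IsUnit u ∧
        coord 0 0 ^ d + ∑ k, tailPullback n (c k) * coord 0 0 ^ (k : ℕ) = u * germ 0 g hg) ∧
      ∀ ψ, ∃ q, ∃ r : Fin d → LocalRingAt (0 : Fin n → ℂ),
        ψ = q * germ 0 g hg + ∑ k, tailPullback n (r k) * coord 0 0 ^ (k : ℕ) := by
  obtain ⟨d, ⟨c, u, hc, hc0, hu, hu0, hW⟩, hdiv⟩ := weierstrass hg hne
  refine ⟨d, fun k => germ 0 (c k) (hc k), hc0, ⟨germ 0 u hu, ?_, ?_⟩, fun ψ => ?_⟩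
  · rwa [isUnit_iff_evalHom_ne_zero, evalHom_germ]
  · rw [← germ_weierstrass c hc (analyticAt_weierstrass c hc)]
    exact (germ_eq_iff (((analyticAt_coord 0 0).pow d).add (analyticAt_weierstrass c hc))
      (hu.mul hg)).2 hW
  · obtain ⟨f, hf, rfl⟩ := exists_germ_eq ψ
    obtain ⟨q, r, hq, hr, hqr⟩ := hdiv f hf
    refine ⟨germ 0 q hq, fun k => germ 0 (r k) (hr k), ?_⟩
    rw [← germ_weierstrass r hr (analyticAt_weierstrass r hr)]
    exact (germ_eq_iff hf ((hq.mul hg).add (analyticAt_weierstrass r hr))).2 hqr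

/-- After a linear change of coordinates, a nonzero germ is regular in the coordinate `0`. -/
theorem exists_linear_regular {g : (Fin (n + 1) → ℂ) → ℂ} (hg : AnalyticAt ℂ g 0)
    (hne : ¬ ∀ᶠ x in 𝓝 0, g x = 0) :
    ∃ A : (Fin (n + 1) → ℂ) ≃L[ℂ] (Fin (n + 1) → ℂ),
      ¬ ∀ᶠ z : ℂ in 𝓝 0, g (A (Fin.cons z 0)) = 0 := by
  obtain ⟨r, hr, hball⟩ := Metric.eventually_nhds_iff_ball.1 hg.eventually_analyticAt
  have h1 : ∃ v ∈ Metric.ball (0 : Fin (n + 1) → ℂ) r, g v ≠ 0 := by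
    by_contra hcon
    push Not at hcon
    exact hne (Filter.mem_of_superset (Metric.ball_mem_nhds 0 hr) hcon)
  obtain ⟨v, hv, hgv⟩ := h1
  -- The complex line through a point where `g` is nonzero works: by the identity theorem on the
  -- convex set of admissible `z`, vanishing near `z = 0` would reach `z = 1`.
  have h2 : ∃ w : Fin (n + 1) → ℂ, w ≠ 0 ∧ ¬ ∀ᶠ z : ℂ in 𝓝 0, g (z • w) = 0 := by
    by_cases hv0 : v = 0
    · refine ⟨fun _ => 1, fun h => one_ne_zero (congrFun h 0), fun h => ?_⟩
      have := h.self_of_nhds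
      rw [zero_smul] at this
      exact hgv (hv0 ▸ this)
    · refine ⟨v, hv0, fun h => hgv ?_⟩
      have hS : Convex ℝ {z : ℂ | z • v ∈ Metric.ball (0 : Fin (n + 1) → ℂ) r} := by
        intro a ha b hb s t hs ht hst
        simp only [Set.mem_ofPred_eq, add_smul, smul_assoc] at ha hb ⊢
        exact convex_ball _ _ ha hb hs ht hst
      have han : AnalyticOnNhd ℂ (fun z : ℂ => g (z • v))
          {z : ℂ | z • v ∈ Metric.ball (0 : Fin (n + 1) → ℂ) r} := by
        intro z hz
        exact (hball _ hz).comp (f := fun z : ℂ => z • v) (analyticAt_id.smul analyticAt_const)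
      have := han.eqOn_zero_of_preconnected_of_eventuallyEq_zero hS.isPreconnected
        (z₀ := 0) (by simpa using hr) h (show (1 : ℂ) ∈ _ by simpa using hv)
      simpa using this
  obtain ⟨w, hw, hgw⟩ := h2
  obtain ⟨A, hA⟩ := SeparatingDual.exists_continuousLinearEquiv_apply_eq (R := ℂ)
    (x := (Pi.single 0 1 : Fin (n + 1) → ℂ)) (y := w) (by simp) hw
  refine ⟨A, fun h => hgw (h.mono fun z hz => ?_)⟩
  have : (Fin.cons z 0 : Fin (n + 1) → ℂ) = z • Pi.single 0 1 := by
    ext i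
    refine Fin.cases ?_ (fun j => ?_) i <;> simp
  rw [← hA, ← map_smul, ← this, hz]

end Basic

end AnalyticGerm

namespace AnalyticGerm

open IsLocalRing

/-! ### Finiteness, the maximal ideal, the Noetherian property -/

/-- Division by a regular germ in the kernel of `θ` leaves only the remainder, so `B` is generated
over `𝒪_n` by the images of `x₀ ^ k` with `k < d`. -/
theorem finite_comp_tailPullback {n : ℕ} {B : Type} [CommRing B]
    (θ : LocalRingAt (0 : Fin (n + 1) → ℂ) →+* B) (hθ : Function.Surjective θ)
    {g : (Fin (n + 1) → ℂ) → ℂ} (hg : AnalyticAt ℂ g 0)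
    (hne : ¬ ∀ᶠ z : ℂ in 𝓝 0, g (Fin.cons z 0) = 0) (hg0 : θ (germ 0 g hg) = 0) :
    (θ.comp (tailPullback n : LocalRingAt (0 : Fin n → ℂ) →+* _)).Finite := by
  obtain ⟨d, -, -, -, hdiv⟩ := exists_weierstrass hg hne
  algebraize [θ.comp (tailPullback n : LocalRingAt (0 : Fin n → ℂ) →+* _)]
  refine Module.Finite.of_surjective
    (Fintype.linearCombination (LocalRingAt (0 : Fin n → ℂ)) fun k : Fin d =>
      θ (coord 0 0 ^ (k : ℕ))) fun b => ?_
  obtain ⟨ψ, rfl⟩ := hθ b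
  obtain ⟨q, r, rfl⟩ := hdiv ψ
  refine ⟨r, ?_⟩
  rw [Fintype.linearCombination_apply, map_add, map_mul, hg0, mul_zero, zero_add, map_sum]
  refine Finset.sum_congr rfl fun k _ => ?_
  rw [map_mul]
  rfl

theorem evalHom_injective_of_isEmpty (p : Fin 0 → ℂ) : Function.Injective (evalHom p) := by
  rw [injective_iff_map_eq_zero]
  intro φ h
  obtain ⟨g, hg, rfl⟩ := exists_germ_eq φ
  refine (germ_eq_zero_iff hg).2 (Eventually.of_forall fun x => ?_)
  rwa [Subsingleton.elim x p]

/-- Coordinates adapted to a germ that is killed by a ring homomorphism which is not injective. -/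
theorem exists_finite_comp {n : ℕ} {B : Type} [CommRing B]
    (θ : LocalRingAt (0 : Fin (n + 1) → ℂ) →+* B) (hθ : Function.Surjective θ)
    (hinj : ¬ Function.Injective θ) :
    ∃ f : LocalRingAt (0 : Fin n → ℂ) →ₐ[ℂ] LocalRingAt (0 : Fin (n + 1) → ℂ),
      (θ.comp (f : LocalRingAt (0 : Fin n → ℂ) →+* _)).Finite := by
  rw [injective_iff_map_eq_zero] at hinj
  push Not at hinj
  obtain ⟨φ, hφ, hφ0⟩ := hinj
  obtain ⟨g, hg, rfl⟩ := exists_germ_eq φ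
  rw [Ne, germ_eq_zero_iff] at hφ0
  obtain ⟨A, hA⟩ := exists_linear_regular hg hφ0
  set E := linearEquivPullback A
  refine ⟨(E.symm : _ →ₐ[ℂ] _).comp (tailPullback n), ?_⟩
  refine finite_comp_tailPullback (θ.comp (E.symm : _ →+* _)) (hθ.comp E.symm.surjective)
    (AnalyticAt.comp_pullback (A.toContinuousLinearMap.analyticAt _) (map_zero A) hg) hA ?_
  change θ (E.symm (E (germ 0 g hg))) = 0
  rw [E.symm_apply_apply, hφ]

/-- A nonzero ideal contains some `φ ≠ 0`. The quotient by `φ` is finite over a ring of germs in one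
variable fewer, hence Noetherian, so the ideal is finitely generated modulo `φ`. -/
instance isNoetherianRing_zero (n : ℕ) : IsNoetherianRing (LocalRingAt (0 : Fin n → ℂ)) := by
  induction n with
  | zero =>
    have e : LocalRingAt (0 : Fin 0 → ℂ) ≃+* ℂ := RingEquiv.ofBijective (evalHom 0)
      ⟨evalHom_injective_of_isEmpty 0, fun c => ⟨algebraMap ℂ _ c, rfl⟩⟩
    exact isNoetherianRing_of_ringEquiv _ e.symm
  | succ n ih =>
    rw [isNoetherianRing_iff_ideal_fg]
    intro I
    by_cases hI : I = ⊥
    · rw [hI]; exact Submodule.fg_bot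
    obtain ⟨φ, hφI, hφ0⟩ := Submodule.exists_mem_ne_zero_of_ne_bot hI
    set K := Ideal.span {φ} with hK
    obtain ⟨f, hf⟩ := exists_finite_comp (Ideal.Quotient.mk K) Ideal.Quotient.mk_surjective
      fun hinj => hφ0 (hinj (by
        rw [map_zero, Ideal.Quotient.eq_zero_iff_mem]
        exact Ideal.mem_span_singleton_self φ))
    algebraize [(f : LocalRingAt (0 : Fin n → ℂ) →+* LocalRingAt (0 : Fin (n + 1) → ℂ))]
    have hfin : Module.Finite (LocalRingAt (0 : Fin n → ℂ)) (LocalRingAt (0 : Fin (n + 1) → ℂ) ⧸ K) :=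
      RingHom.finite_algebraMap.1 hf
    have h1 : IsNoetherian (LocalRingAt (0 : Fin n → ℂ)) (LocalRingAt (0 : Fin (n + 1) → ℂ) ⧸ K) :=
      isNoetherian_of_isNoetherianRing_of_finite _ _
    have h2 : IsNoetherian (LocalRingAt (0 : Fin (n + 1) → ℂ))
        (LocalRingAt (0 : Fin (n + 1) → ℂ) ⧸ K) :=
      isNoetherian_of_tower (LocalRingAt (0 : Fin n → ℂ)) h1
    refine Submodule.fg_of_fg_map_of_fg_inf_ker (Submodule.mkQ K) (IsNoetherian.noetherian _) ?_
    rw [Submodule.ker_mkQ, inf_eq_right.2 ((Ideal.span_singleton_le_iff_mem I).2 hφI)]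
    exact ⟨{φ}, by simp⟩

instance {n : ℕ} (p : Fin n → ℂ) : IsNoetherianRing (LocalRingAt p) :=
  isNoetherianRing_of_ringEquiv _ (translationEquiv p).toRingEquiv.symm

/-- Division by `x₀` reduces the germ modulo `x₀` to one that does not depend on `x₀` and still
vanishes at `0`; induction handles it. -/
theorem mem_span_coord {n : ℕ} (φ : LocalRingAt (0 : Fin n → ℂ)) (h : evalHom 0 φ = 0) :
    φ ∈ Ideal.span (Set.range (coord (0 : Fin n → ℂ))) := by
  induction n with
  | zero => rw [evalHom_injective_of_isEmpty 0 (h.trans (map_zero _).symm)]; exact zero_mem _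
  | succ n ih =>
    obtain ⟨d, -, -, -, hdiv⟩ := exists_weierstrass (analyticAt_coord 0 (0 : Fin (n + 1) → ℂ))
      fun hev => by
        simp only [Fin.cons_zero] at hev
        have : ∀ᶠ z : ℂ in 𝓝[≠] 0, z = 0 := hev.filter_mono nhdsWithin_le_nhds
        obtain ⟨z, hz, hz'⟩ := (this.and self_mem_nhdsWithin).exists
        exact hz' hz
    have hz : coord (0 : Fin (n + 1) → ℂ) 0 ∈ Ideal.span (Set.range (coord (0 : Fin (n + 1) → ℂ))) :=
      Ideal.subset_span ⟨0, rfl⟩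
    have hz0 : evalHom (0 : Fin (n + 1) → ℂ) (coord 0 0) = 0 := rfl
    have htail : ∀ ψ : LocalRingAt (0 : Fin n → ℂ), evalHom 0 ψ = 0 →
        tailPullback n ψ ∈ Ideal.span (Set.range (coord (0 : Fin (n + 1) → ℂ))) := by
      intro ψ hψ
      have := Ideal.mem_map_of_mem (tailPullback n) (ih ψ hψ)
      rw [Ideal.map_span] at this
      refine Ideal.span_mono ?_ this
      rintro _ ⟨_, ⟨j, rfl⟩, rfl⟩
      exact ⟨j.succ, rfl⟩
    obtain ⟨q, r, hqr⟩ := hdiv φ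
    change φ = q * coord 0 0 + _ at hqr
    rw [hqr]
    refine add_mem (Ideal.mul_mem_left _ _ hz) ?_
    -- The division statement does not record that `d = 1` here, so all `d` are treated: terms of
    -- positive degree in `x₀` are multiples of `x₀` in any case.
    cases d with
    | zero => rw [Fin.sum_univ_zero]; exact zero_mem _
    | succ d =>
      rw [Fin.sum_univ_succ] at hqr ⊢
      refine add_mem ?_ (sum_mem fun k _ => ?_)
      · rw [hqr] at h
        simp only [map_add, map_mul, hz0, mul_zero, zero_add, map_sum, map_pow, Fin.val_succ,
          Fin.val_zero, pow_zero, mul_one, ne_eq, Nat.add_eq_zero_iff, one_ne_zero, and_false,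
          not_false_eq_true, zero_pow, Finset.sum_const_zero, add_zero] at h
        simp only [Fin.val_zero, pow_zero, mul_one]
        exact htail _ (by rwa [tailPullback, evalHom_pullback] at h)
      · rw [Fin.val_succ, pow_succ, ← mul_assoc]
        exact Ideal.mul_mem_left _ _ hz

/-- The coordinate `x_j - p_j` at `p`. -/
def localCoord {n : ℕ} (p : Fin n → ℂ) (j : Fin n) : LocalRingAt p :=
  coord p j - algebraMap ℂ _ (p j)

@[simp] theorem evalHom_localCoord {n : ℕ} (p : Fin n → ℂ) (j : Fin n) :
    evalHom p (localCoord p j) = 0 := by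
  rw [localCoord, map_sub, AlgHom.commutes]
  exact sub_self _

theorem maximalIdeal_eq_span {n : ℕ} (p : Fin n → ℂ) :
    maximalIdeal (LocalRingAt p) = Ideal.span (Set.range (localCoord p)) := by
  apply le_antisymm
  · intro φ hφ
    rw [mem_maximalIdeal_iff] at hφ
    have h1 := mem_span_coord (translationEquiv p φ)
      ((evalHom_translationEquiv p φ).trans hφ)
    have h2 := Ideal.mem_map_of_mem (translationEquiv p).symm h1
    rw [AlgEquiv.symm_apply_apply, Ideal.map_span] at h2
    refine Ideal.span_mono ?_ h2
    rintro _ ⟨_, ⟨j, rfl⟩, rfl⟩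
    refine ⟨j, ?_⟩
    apply (translationEquiv p).injective
    rw [AlgEquiv.apply_symm_apply, localCoord, map_sub, AlgEquiv.commutes]
    refine (germ_eq_iff (((analyticAt_const.add (analyticAt_coord j 0)).sub
      analyticAt_const)) (analyticAt_coord j 0)).2 (Eventually.of_forall fun x => ?_)
    simp
  · rw [Ideal.span_le]
    rintro _ ⟨j, rfl⟩
    exact (mem_maximalIdeal_iff _).2 (evalHom_localCoord p j)

/-! ### Noether normalization -/

/-- If `θ` has a kernel, `B` is finite over the image of a ring of germs in one variable fewer. That
image is again a domain, so the induction applies to it; finiteness and injectivity compose. -/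
theorem exists_noether_zero {n : ℕ} {B : Type} [CommRing B] [IsDomain B]
    (θ : LocalRingAt (0 : Fin n → ℂ) →+* B) (hθ : Function.Surjective θ) :
    ∃ (d : ℕ) (f : LocalRingAt (0 : Fin d → ℂ) →ₐ[ℂ] LocalRingAt (0 : Fin n → ℂ)),
      Function.Injective (θ.comp (f : LocalRingAt (0 : Fin d → ℂ) →+* _)) ∧
      (θ.comp (f : LocalRingAt (0 : Fin d → ℂ) →+* _)).Finite := by
  induction n generalizing B with
  | zero =>
    refine ⟨0, AlgHom.id _ _, ?_, RingHom.Finite.of_surjective _ hθ⟩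
    rw [injective_iff_map_eq_zero]
    intro φ hφ
    by_contra hne
    have : IsUnit φ := by
      rw [isUnit_iff_evalHom_ne_zero]
      exact fun h => hne (evalHom_injective_of_isEmpty 0 (h.trans (map_zero _).symm))
    exact (this.map θ).ne_zero hφ
  | succ n ih =>
    by_cases hinj : Function.Injective θ
    · exact ⟨n + 1, AlgHom.id _ _, hinj, RingHom.Finite.of_surjective _ hθ⟩
    obtain ⟨f, hf⟩ := exists_finite_comp θ hθ hinj
    set η := θ.comp (f : LocalRingAt (0 : Fin n → ℂ) →+* _) with hη
    obtain ⟨d, f', hf'inj, hf'fin⟩ := ih η.rangeRestrict η.rangeRestrict_surjective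
    have hfac : θ.comp ((f.comp f' : LocalRingAt (0 : Fin d → ℂ) →ₐ[ℂ] _) :
        LocalRingAt (0 : Fin d → ℂ) →+* _) =
        η.range.subtype.comp (η.rangeRestrict.comp (f' : LocalRingAt (0 : Fin d → ℂ) →+* _)) := rfl
    refine ⟨d, f.comp f', ?_, ?_⟩
    · rw [hfac]
      exact Subtype.val_injective.comp hf'inj
    · rw [hfac]
      refine RingHom.Finite.comp ?_ hf'fin
      exact RingHom.Finite.of_comp_finite (f := η.rangeRestrict) hf

/-- Noether normalization for quotients of `𝒪_{ℂⁿ,p}`. -/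
theorem exists_noether {n : ℕ} {p : Fin n → ℂ} {B : Type} [CommRing B] [IsDomain B]
    (θ : LocalRingAt p →+* B) (hθ : Function.Surjective θ) :
    ∃ (d : ℕ) (f : LocalRingAt (0 : Fin d → ℂ) →ₐ[ℂ] LocalRingAt p),
      Function.Injective (θ.comp (f : LocalRingAt (0 : Fin d → ℂ) →+* _)) ∧
      (θ.comp (f : LocalRingAt (0 : Fin d → ℂ) →+* _)).Finite := by
  obtain ⟨d, f, h1, h2⟩ := exists_noether_zero
    (θ.comp ((translationEquiv p).symm : LocalRingAt (0 : Fin n → ℂ) →+* _))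
    (hθ.comp (translationEquiv p).symm.surjective)
  exact ⟨d, ((translationEquiv p).symm : LocalRingAt (0 : Fin n → ℂ) →ₐ[ℂ] LocalRingAt p).comp f,
    h1, h2⟩

end AnalyticGerm

namespace AnalyticGerm

open IsLocalRing Polynomial

/-! ### Isolated common zeros -/

/-- If `‖ζ‖ ≥ δ`, then `‖ζ‖ ^ k δ ^ d ≤ ‖ζ‖ ^ d` for all `k < d`, so the lower terms are too small
to cancel `ζ ^ d`. -/
theorem norm_lt_of_monic_root {d : ℕ} {δ : ℝ} (hδ : 0 < δ) (hδ1 : δ ≤ 1) (c : Fin d → ℂ)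
    (hc : ∑ k, ‖c k‖ < δ ^ d) {ζ : ℂ} (hζ : ζ ^ d + ∑ k, c k * ζ ^ (k : ℕ) = 0) : ‖ζ‖ < δ := by
  by_contra! hge
  have hζ0 : 0 < ‖ζ‖ := hδ.trans_le hge
  have h1 : ‖ζ‖ ^ d ≤ ∑ k, ‖c k‖ * ‖ζ‖ ^ (k : ℕ) := by
    have : ζ ^ d = -∑ k, c k * ζ ^ (k : ℕ) := by linear_combination hζ
    rw [← norm_pow, this, norm_neg]
    refine (norm_sum_le _ _).trans (le_of_eq (Finset.sum_congr rfl fun k _ => ?_))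
    rw [norm_mul, norm_pow]
  have h2 : ∀ k : Fin d, ‖ζ‖ ^ (k : ℕ) * δ ^ d ≤ ‖ζ‖ ^ d := by
    intro k
    have hk : (k : ℕ) + (d - k) = d := by omega
    calc ‖ζ‖ ^ (k : ℕ) * δ ^ d ≤ ‖ζ‖ ^ (k : ℕ) * δ ^ (d - k) := by
          refine mul_le_mul_of_nonneg_left ?_ (by positivity)
          exact pow_le_pow_of_le_one hδ.le hδ1 (by omega)
      _ ≤ ‖ζ‖ ^ (k : ℕ) * ‖ζ‖ ^ (d - k) := by gcongr
      _ = ‖ζ‖ ^ d := by rw [← pow_add, hk]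
  have h3 : ‖ζ‖ ^ d * δ ^ d ≤ (∑ k, ‖c k‖) * ‖ζ‖ ^ d := by
    calc ‖ζ‖ ^ d * δ ^ d ≤ (∑ k, ‖c k‖ * ‖ζ‖ ^ (k : ℕ)) * δ ^ d := by gcongr
      _ = ∑ k, ‖c k‖ * (‖ζ‖ ^ (k : ℕ) * δ ^ d) := by
        rw [Finset.sum_mul]
        exact Finset.sum_congr rfl fun k _ => by ring
      _ ≤ ∑ k, ‖c k‖ * ‖ζ‖ ^ d := Finset.sum_le_sum fun k _ =>
        mul_le_mul_of_nonneg_left (h2 k) (norm_nonneg _)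
      _ = _ := (Finset.sum_mul _ _ _).symm
  have h4 : (∑ k, ‖c k‖) * ‖ζ‖ ^ d < δ ^ d * ‖ζ‖ ^ d :=
    mul_lt_mul_of_pos_right hc (by positivity)
  linarith [mul_comm (‖ζ‖ ^ d) (δ ^ d)]

/-- If the resultants of a monic polynomial `W` with sufficiently many linear combinations
`∑ lⁱ Rᵢ` vanish, then `W` and all the `Rᵢ` have a common root. -/
theorem exists_common_root {d s : ℕ} {W : ℂ[X]} (hW : W.Monic) (hd : W.natDegree = d)
    (R : Fin s → ℂ[X]) (hR : ∀ i, (R i).natDegree ≤ d)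
    (hres : ∀ l : Fin (d * s + 1),
      resultant W (∑ i : Fin s, ((l : ℕ) : ℂ[X]) ^ (i : ℕ) * R i) d d = 0) :
    ∃ ζ, W.eval ζ = 0 ∧ ∀ i, (R i).eval ζ = 0 := by
  classical
  have h1 : ∀ l : Fin (d * s + 1), ∃ ζ ∈ W.roots,
      (∑ i : Fin s, ((l : ℕ) : ℂ[X]) ^ (i : ℕ) * R i).eval ζ = 0 := by
    intro l
    have hdeg : (∑ i : Fin s, ((l : ℕ) : ℂ[X]) ^ (i : ℕ) * R i).natDegree ≤ d := by
      refine natDegree_sum_le_of_forall_le _ _ fun i _ => ?_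
      have : (((l : ℕ) : ℂ[X]) ^ (i : ℕ) * R i) = C (((l : ℕ) : ℂ) ^ (i : ℕ)) * R i := by simp
      rw [this]
      exact (natDegree_C_mul_le _ _).trans (hR i)
    have h2 := resultant_eq_prod_eval W _ d hdeg (IsAlgClosed.splits W)
    rw [hd, hres l, hW.leadingCoeff, one_pow, one_mul, eq_comm, Multiset.prod_eq_zero_iff,
      Multiset.mem_map] at h2
    exact h2
  choose ζ hζ hζ0 using h1
  -- Pigeonhole: at most `d` roots serve `d * s + 1` parameters, so one root is shared by more than
  -- `s` of them.
  have hcard : W.roots.toFinset.card * s < (Finset.univ : Finset (Fin (d * s + 1))).card := by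
    rw [Finset.card_univ, Fintype.card_fin, Nat.lt_succ_iff]
    refine Nat.mul_le_mul_right s ((Multiset.toFinset_card_le _).trans ?_)
    exact (card_roots' W).trans hd.le
  obtain ⟨ξ, hξ, hlt⟩ := Finset.exists_lt_card_fiber_of_mul_lt_card_of_maps_to
    (f := ζ) (fun l _ => Multiset.mem_toFinset.2 (hζ l)) hcard
  refine ⟨ξ, (mem_roots hW.ne_zero).1 (Multiset.mem_toFinset.1 hξ), ?_⟩
  -- As a polynomial in the parameter `l`, this has more zeros than its degree allows, so all its
  -- coefficients `Rᵢ(ξ)` vanish.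
  set Q : ℂ[X] := ∑ i : Fin s, C ((R i).eval ξ) * X ^ (i : ℕ) with hQ
  have hQ0 : Q = 0 := by
    refine eq_zero_of_natDegree_lt_card_of_eval_eq_zero' Q
      ((Finset.univ.filter fun l => ζ l = ξ).image fun l : Fin (d * s + 1) => ((l : ℕ) : ℂ)) ?_ ?_
    · intro w hw
      obtain ⟨l, hl, rfl⟩ := Finset.mem_image.1 hw
      rw [Finset.mem_filter] at hl
      have := hζ0 l
      rw [hl.2] at this
      rw [hQ]
      simp only [eval_finsetSum, eval_mul, eval_pow, eval_natCast, eval_C, eval_X] at this ⊢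
      rw [← this]
      exact Finset.sum_congr rfl fun i _ => mul_comm _ _
    · rw [Finset.card_image_of_injective _ fun a b h => Fin.ext (Nat.cast_injective h)]
      refine lt_of_le_of_lt ?_ hlt
      refine natDegree_sum_le_of_forall_le _ _ fun i _ => ?_
      exact (natDegree_C_mul_X_pow_le _ _).trans i.2.le
  intro i
  have := congrArg (fun P => P.coeff i) hQ0
  simp only [hQ, finsetSum_coeff, coeff_C_mul, coeff_X_pow, coeff_zero, mul_ite, mul_one,
    mul_zero, Fin.val_inj, Finset.sum_ite_eq, Finset.mem_univ, if_true] at this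
  exact this

theorem degree_sum_C_mul_X_pow_lt {R : Type*} [CommRing R] {d : ℕ} (c : Fin d → R) :
    (∑ k : Fin d, C (c k) * X ^ (k : ℕ)).degree < (d : WithBot ℕ) :=
  (degree_sum_le _ _).trans_lt ((Finset.sup_lt_iff (WithBot.bot_lt_coe d)).2 fun k _ =>
    (degree_C_mul_X_pow_le _ _).trans_lt (WithBot.coe_lt_coe.2 k.2))

/-- The inductive step for `le_radical_of_isolated_zero`, in coordinates in which one of the
functions is regular. -/
theorem le_radical_of_isolated_zero_of_regular {n s : ℕ}
    (ih : ∀ (t : ℕ) (g : Fin t → (Fin n → ℂ) → ℂ) (hg : ∀ i, AnalyticAt ℂ (g i) 0),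
      (∀ᶠ x in 𝓝[≠] 0, ∃ i, g i x ≠ 0) →
      maximalIdeal (LocalRingAt (0 : Fin n → ℂ)) ≤
        (Ideal.span (Set.range fun i => germ 0 (g i) (hg i))).radical)
    (g : Fin s → (Fin (n + 1) → ℂ) → ℂ) (hg : ∀ i, AnalyticAt ℂ (g i) 0)
    (hiso : ∀ᶠ x in 𝓝[≠] 0, ∃ i, g i x ≠ 0) (i₀ : Fin s)
    (hreg : ¬ ∀ᶠ z : ℂ in 𝓝 0, g i₀ (Fin.cons z 0) = 0) :
    maximalIdeal (LocalRingAt (0 : Fin (n + 1) → ℂ)) ≤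
      (Ideal.span (Set.range fun i => germ 0 (g i) (hg i))).radical := by
  classical
  set J := Ideal.span (Set.range fun i => germ 0 (g i) (hg i)) with hJ
  have hgJ : ∀ i, germ 0 (g i) (hg i) ∈ J := fun i => Ideal.subset_span ⟨i, rfl⟩
  obtain ⟨d, ⟨c, u, hc, hc0, hu, hu0, hW⟩, hdiv⟩ := weierstrass (hg i₀) hreg
  choose q r hq hr hqr using fun i => hdiv (g i) (hg i)
  let ct : Fin d → analyticAtSubring (0 : Fin n → ℂ) := fun k => ⟨c k, hc k⟩
  let rt : Fin s → Fin d → analyticAtSubring (0 : Fin n → ℂ) := fun i k => ⟨r i k, hr i k⟩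
  let W : (analyticAtSubring (0 : Fin n → ℂ))[X] := X ^ d + ∑ k : Fin d, C (ct k) * X ^ (k : ℕ)
  let R : Fin s → (analyticAtSubring (0 : Fin n → ℂ))[X] := fun i =>
    ∑ k : Fin d, C (rt i k) * X ^ (k : ℕ)
  let G : Fin (d * s + 1) → (analyticAtSubring (0 : Fin n → ℂ))[X] := fun l =>
    ∑ i : Fin s, ((l : ℕ) : (analyticAtSubring (0 : Fin n → ℂ))[X]) ^ (i : ℕ) * R i
  let Res : Fin (d * s + 1) → analyticAtSubring (0 : Fin n → ℂ) := fun l =>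
    resultant W (G l) d d
  have hWdeg : W.natDegree ≤ d := by
    refine natDegree_le_of_degree_le ((degree_add_le _ _).trans (max_le (degree_X_pow_le _) ?_))
    exact (degree_sum_C_mul_X_pow_lt ct).le
  have hRdeg : ∀ i, (R i).natDegree ≤ d := fun i =>
    natDegree_le_of_degree_le (degree_sum_C_mul_X_pow_lt (rt i)).le
  have hGdeg : ∀ l, (G l).natDegree ≤ d := fun l => by
    refine natDegree_sum_le_of_forall_le _ _ fun i _ => ?_
    refine natDegree_mul_le.trans ?_
    rw [← Nat.cast_pow, natDegree_natCast, zero_add]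
    exact hRdeg i
  -- substitution of the coordinate `0` for the variable
  let Φ : (analyticAtSubring (0 : Fin n → ℂ))[X] →+* LocalRingAt (0 : Fin (n + 1) → ℂ) :=
    eval₂RingHom ((tailPullback n : LocalRingAt (0 : Fin n → ℂ) →+* _).comp (germHom 0))
      (coord 0 0)
  have hΦC : ∀ a, Φ (C a) = tailPullback n (germHom 0 a) := fun a => by simp [Φ]
  have hΦX : Φ X = coord 0 0 := by simp [Φ]
  have hΦW' : Φ W = coord 0 0 ^ d + ∑ k, tailPullback n (germ 0 (c k) (hc k)) *
      coord 0 0 ^ (k : ℕ) := by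
    simp only [W, map_add, map_pow, map_sum, map_mul, hΦC, hΦX]
    rfl
  have hΦW : Φ W = germ 0 u hu * germ 0 (g i₀) (hg i₀) := by
    rw [hΦW', ← germ_weierstrass c hc (analyticAt_weierstrass c hc)]
    exact (germ_eq_iff (((analyticAt_coord 0 0).pow d).add (analyticAt_weierstrass c hc))
      (hu.mul (hg i₀))).2 hW
  have hΦWJ : Φ W ∈ J := hΦW ▸ Ideal.mul_mem_left _ _ (hgJ i₀)
  have hΦR : ∀ i, Φ (R i) ∈ J := by
    intro i
    have h1 : Φ (R i) = ∑ k, tailPullback n (germ 0 (r i k) (hr i k)) * coord 0 0 ^ (k : ℕ) := by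
      simp only [R, map_pow, map_sum, map_mul, hΦC, hΦX]
      rfl
    have h2 : germ 0 (g i) (hg i) = germ 0 (q i) (hq i) * germ 0 (g i₀) (hg i₀) + Φ (R i) := by
      rw [h1, ← germ_weierstrass (r i) (hr i) (analyticAt_weierstrass (r i) (hr i))]
      exact (germ_eq_iff (hg i) (((hq i).mul (hg i₀)).add
        (analyticAt_weierstrass (r i) (hr i)))).2 (hqr i)
    have h3 : Φ (R i) = germ 0 (g i) (hg i) - germ 0 (q i) (hq i) * germ 0 (g i₀) (hg i₀) :=
      eq_sub_of_add_eq' h2.symm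
    rw [h3]
    exact sub_mem (hgJ i) (Ideal.mul_mem_left _ _ (hgJ i₀))
  -- In degree zero `W = 1` already lies in `J`. The resultant identity used below needs positive
  -- degree.
  by_cases hd : d = 0
  · have : J = ⊤ := by
      subst hd
      have h1 : Φ W = 1 := by
        rw [hΦW', Fin.sum_univ_zero, pow_zero, add_zero]
      exact (Ideal.eq_top_iff_one _).2 (h1 ▸ hΦWJ)
    rw [this, Ideal.radical_top]
    exact le_top
  -- Elimination: the resultant is a combination of `W` and `G l`, both of which map into `J`.
  have hΦRes : ∀ l, tailPullback n (germHom 0 (Res l)) ∈ J := by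
    intro l
    obtain ⟨a, b, -, -, hab⟩ :=
      exists_mul_add_mul_eq_C_resultant W (G l) hWdeg (hGdeg l) (Or.inl hd)
    rw [← hΦC, ← hab, map_add, map_mul, map_mul]
    refine add_mem (Ideal.mul_mem_right _ _ hΦWJ) (Ideal.mul_mem_right _ _ ?_)
    rw [map_sum]
    refine sum_mem fun i _ => ?_
    rw [map_mul]
    exact Ideal.mul_mem_left _ _ (hΦR i)
  -- If all resultants vanish at `y ≠ 0`, then `W` and the remainders have a common root `ζ` over
  -- `y`. It is small because the `c k` vanish at `0`, so `(ζ, y)` is a common zero of the `g i`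
  -- near the origin, contradicting isolation.
  have hRes : ∀ᶠ y in 𝓝[≠] 0, ∃ l, (Res l).1 y ≠ 0 := by
    have hall : ∀ᶠ x in 𝓝 (0 : Fin (n + 1) → ℂ), (x ≠ 0 → ∃ i, g i x ≠ 0) ∧
        x 0 ^ d + ∑ k, c k (Fin.tail x) * x 0 ^ (k : ℕ) = u x * g i₀ x ∧ u x ≠ 0 ∧
        ∀ i, g i x = q i x * g i₀ x + ∑ k, r i k (Fin.tail x) * x 0 ^ (k : ℕ) :=
      (eventually_nhdsWithin_iff.1 hiso).and (hW.and
        ((hu.continuousAt.eventually_ne hu0).and (eventually_all.2 hqr)))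
    obtain ⟨ε, hε, hball⟩ := Metric.eventually_nhds_iff_ball.1 hall
    set δ := min ε 1 with hδdef
    have hδ : 0 < δ := lt_min hε one_pos
    have hcsmall : ∀ᶠ y in 𝓝 (0 : Fin n → ℂ), ∑ k, ‖c k y‖ < δ ^ d := by
      have hcont : ContinuousAt (fun y => ∑ k, ‖c k y‖) 0 :=
        tendsto_finsetSum _ fun k _ => (hc k).continuousAt.norm
      refine hcont.eventually_lt continuousAt_const ?_
      simp only [hc0, norm_zero, Finset.sum_const_zero]
      positivity
    rw [eventually_nhdsWithin_iff]
    filter_upwards [hcsmall, Metric.ball_mem_nhds 0 hδ] with y hy hyδ hy0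
    by_contra! hcon
    let ev : analyticAtSubring (0 : Fin n → ℂ) →+* ℂ :=
      (Pi.evalRingHom (fun _ => ℂ) y).comp (analyticAtSubring (0 : Fin n → ℂ)).subtype
    have hWev : W.map ev = X ^ d + ∑ k : Fin d, C (c k y) * X ^ (k : ℕ) := by
      simp only [W, Polynomial.map_add, Polynomial.map_pow, Polynomial.map_sum,
        Polynomial.map_mul, map_X, map_C]
      rfl
    have hRev : ∀ i, (R i).map ev = ∑ k : Fin d, C (r i k y) * X ^ (k : ℕ) := by
      intro i
      simp only [R, Polynomial.map_pow, Polynomial.map_sum, Polynomial.map_mul, map_X, map_C]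
      rfl
    have hmonic : (W.map ev).Monic := by
      rw [hWev]
      exact monic_X_pow_add (degree_sum_C_mul_X_pow_lt _)
    have hnat : (W.map ev).natDegree = d := by
      rw [hWev]
      refine natDegree_eq_of_degree_eq_some ?_
      rw [degree_add_eq_left_of_degree_lt, degree_X_pow]
      rw [degree_X_pow]
      exact degree_sum_C_mul_X_pow_lt _
    obtain ⟨ζ, hζW, hζR⟩ := exists_common_root hmonic hnat (fun i => (R i).map ev)
      (fun i => natDegree_map_le.trans (hRdeg i)) fun l => by
        have h1 : ev (Res l) = 0 := hcon l
        rw [← resultant_map_map] at h1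
        rw [← h1]
        congr 1
        simp only [G, Polynomial.map_sum, Polynomial.map_mul, Polynomial.map_pow,
          Polynomial.map_natCast]
    rw [hWev] at hζW
    simp only [eval_add, eval_pow, eval_X, eval_finsetSum, eval_mul, eval_C] at hζW
    have hζδ : ‖ζ‖ < δ := norm_lt_of_monic_root hδ (min_le_right _ _) (fun k => c k y) hy hζW
    have hx : (Fin.cons ζ y : Fin (n + 1) → ℂ) ∈ Metric.ball 0 ε := by
      rw [mem_ball_zero_iff, pi_norm_lt_iff hε]
      rw [mem_ball_zero_iff, pi_norm_lt_iff hδ] at hyδ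
      intro i
      refine Fin.cases ?_ (fun j => ?_) i
      · exact hζδ.trans_le (min_le_left _ _)
      · exact (hyδ j).trans_le (min_le_left _ _)
    obtain ⟨h1, h2, h3, h4⟩ := hball _ hx
    simp only [Fin.cons_zero, Fin.tail_cons] at h2 h4
    have hg0 : g i₀ (Fin.cons ζ y) = 0 := by
      rw [hζW] at h2
      exact (mul_eq_zero.1 h2.symm).resolve_left h3
    obtain ⟨i, hi⟩ := h1 fun h0 => hy0 (by
      funext j
      simpa using congrFun h0 j.succ)
    apply hi
    have h5 := hζR i
    simp only [hRev, eval_pow, eval_X, eval_finsetSum, eval_mul, eval_C] at h5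
    rw [h4 i, hg0, mul_zero, zero_add, h5]
  have htail : ∀ ψ : LocalRingAt (0 : Fin n → ℂ), evalHom 0 ψ = 0 →
      tailPullback n ψ ∈ J.radical := by
    intro ψ hψ
    obtain ⟨N, hN⟩ := ih _ (fun l => (Res l).1) (fun l => (Res l).2) hRes
      ((mem_maximalIdeal_iff ψ).2 hψ)
    refine ⟨N, ?_⟩
    rw [← map_pow]
    refine Ideal.mem_comap.1 ((Ideal.span_le.2 ?_) hN : ψ ^ N ∈ J.comap (tailPullback n))
    rintro _ ⟨l, rfl⟩
    exact hΦRes l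
  -- Modulo the radical the coefficients `c k` vanish, and the Weierstrass polynomial becomes `x₀ ^
  -- d`.
  have hz : coord (0 : Fin (n + 1) → ℂ) 0 ∈ J.radical := by
    refine J.radical_isRadical ⟨d, ?_⟩
    rw [eq_sub_of_add_eq hΦW'.symm]
    refine sub_mem (Ideal.le_radical hΦWJ) (sum_mem fun k _ => Ideal.mul_mem_right _ _ ?_)
    exact htail _ (hc0 k)
  intro φ hφ
  refine (Ideal.span_le.2 ?_) (mem_span_coord φ ((mem_maximalIdeal_iff φ).1 hφ))
  rintro _ ⟨j, rfl⟩
  refine Fin.cases hz (fun j => ?_) j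
  exact htail (coord 0 j) rfl

theorem le_radical_of_isolated_zero_fin (n : ℕ) : ∀ (s : ℕ) (g : Fin s → (Fin n → ℂ) → ℂ)
    (hg : ∀ i, AnalyticAt ℂ (g i) 0), (∀ᶠ x in 𝓝[≠] 0, ∃ i, g i x ≠ 0) →
      maximalIdeal (LocalRingAt (0 : Fin n → ℂ)) ≤
        (Ideal.span (Set.range fun i => germ 0 (g i) (hg i))).radical := by
  induction n with
  | zero =>
    intro s g hg _ φ hφ
    rw [mem_maximalIdeal_iff] at hφ
    rw [evalHom_injective_of_isEmpty 0 (hφ.trans (map_zero _).symm)]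
    exact zero_mem _
  | succ n ih =>
    intro s g hg hiso
    have h1 : ∃ i₀, ¬ ∀ᶠ x in 𝓝 0, g i₀ x = 0 := by
      by_contra! hcon
      have h2 := (eventually_all.2 hcon).filter_mono
        (nhdsWithin_le_nhds (a := (0 : Fin (n + 1) → ℂ)) (s := {0}ᶜ))
      have : (𝓝[≠] (0 : Fin (n + 1) → ℂ)).NeBot := Module.punctured_nhds_neBot ℂ _ _
      obtain ⟨x, ⟨i, hi⟩, hx⟩ := (hiso.and h2).exists
      exact hi (hx i)
    obtain ⟨i₀, hi₀⟩ := h1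
    obtain ⟨A, hA⟩ := exists_linear_regular (hg i₀) hi₀
    have hgA : ∀ i, AnalyticAt ℂ (fun x => g i (A x)) 0 := fun i =>
      AnalyticAt.comp_pullback (A.toContinuousLinearMap.analyticAt _) (map_zero A) (hg i)
    have hAt : Tendsto A (𝓝[≠] 0) (𝓝[≠] 0) := by
      refine tendsto_nhdsWithin_iff.2 ⟨?_, ?_⟩
      · have := A.continuous.tendsto 0
        rw [map_zero] at this
        exact this.mono_left nhdsWithin_le_nhds
      · filter_upwards [self_mem_nhdsWithin] with x hx
        simpa using hx
    have h3 := le_radical_of_isolated_zero_of_regular ih (fun i x => g i (A x)) hgA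
      (hAt.eventually hiso) i₀ hA
    intro φ hφ
    have h4 : linearEquivPullback A φ ∈ maximalIdeal (LocalRingAt (0 : Fin (n + 1) → ℂ)) := by
      rw [mem_maximalIdeal_iff] at hφ ⊢
      exact (evalHom_pullback (A.toContinuousLinearMap.analyticAt 0) (map_zero A) φ).trans hφ
    obtain ⟨N, hN⟩ := h3 h4
    refine ⟨N, ?_⟩
    have h5 := Ideal.mem_map_of_mem (linearEquivPullback A).symm hN
    rw [map_pow, AlgEquiv.symm_apply_apply, Ideal.map_span] at h5
    refine Ideal.span_mono ?_ h5
    rintro _ ⟨_, ⟨i, rfl⟩, rfl⟩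
    refine ⟨i, ?_⟩
    exact ((linearEquivPullback A).symm_apply_apply (germ 0 (g i) (hg i))).symm

/-- If finitely many holomorphic functions have `p` as an isolated common zero, then the ideal
they generate is primary to the maximal ideal. -/
theorem le_radical_of_isolated_zero {n : ℕ} {p : Fin n → ℂ} {ι : Type*} [Finite ι]
    (g : ι → (Fin n → ℂ) → ℂ) (hg : ∀ i, AnalyticAt ℂ (g i) p)
    (hiso : ∀ᶠ x in 𝓝[≠] p, ∃ i, g i x ≠ 0) :
    maximalIdeal (LocalRingAt p) ≤
      (Ideal.span (Set.range fun i => germ p (g i) (hg i))).radical := by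
  obtain ⟨s, ⟨e⟩⟩ := Finite.exists_equiv_fin ι
  have hT : AnalyticAt ℂ (fun x => p + x) 0 := analyticAt_const.add analyticAt_id
  have ht : Tendsto (fun x => p + x) (𝓝[≠] 0) (𝓝[≠] p) := by
    refine tendsto_nhdsWithin_iff.2 ⟨?_, ?_⟩
    · have := hT.continuousAt.tendsto
      rw [add_zero] at this
      exact this.mono_left nhdsWithin_le_nhds
    · filter_upwards [self_mem_nhdsWithin] with x hx
      simpa using hx
  have h3 := le_radical_of_isolated_zero_fin n s (fun i x => g (e.symm i) (p + x))
    (fun i => AnalyticAt.comp_pullback hT (add_zero p) (hg (e.symm i)))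
    ((ht.eventually hiso).mono fun x ⟨i, hi⟩ => ⟨e i, by rwa [e.symm_apply_apply]⟩)
  intro φ hφ
  have h4 : translationEquiv p φ ∈ maximalIdeal (LocalRingAt (0 : Fin n → ℂ)) := by
    rw [mem_maximalIdeal_iff] at hφ ⊢
    rwa [evalHom_translationEquiv]
  obtain ⟨N, hN⟩ := h3 h4
  refine ⟨N, ?_⟩
  have h5 := Ideal.mem_map_of_mem (translationEquiv p).symm hN
  rw [map_pow, AlgEquiv.symm_apply_apply, Ideal.map_span] at h5
  refine Ideal.span_mono ?_ h5
  rintro _ ⟨_, ⟨i, rfl⟩, rfl⟩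
  refine ⟨e.symm i, ?_⟩
  exact ((translationEquiv p).symm_apply_apply (germ p (g (e.symm i)) (hg (e.symm i)))).symm

end AnalyticGerm

/-! ### Sections over the residue field -/

/-- In characteristic zero, an algebraic field extension of the fraction field of `A` lifts along
nilpotent thickenings. -/
theorem exists_algHom_section {A S κ : Type*} [CommRing A] [IsDomain A] [CharZero A] [CommRing S]
    [Field κ] [Algebra A S] [Algebra A κ] [Algebra.IsAlgebraic A κ] (π : S →ₐ[A] κ)
    (hπ : Function.Surjective π) (hker : IsNilpotent (RingHom.ker (π : S →+* κ)))
    (hinj : Function.Injective (algebraMap A κ)) : ∃ σ : κ →ₐ[A] S, ∀ x, π (σ x) = x := by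
  let K := FractionRing A
  -- An element that is invertible modulo a nilpotent ideal is invertible; therefore `S` becomes an
  -- algebra over the fraction field.
  have hS : ∀ a : nonZeroDivisors A, IsUnit (algebraMap A S a) := by
    intro a
    have ha : π (algebraMap A S a) ≠ 0 := by
      rw [AlgHom.commutes]
      exact (map_ne_zero_iff _ hinj).2 (nonZeroDivisors.ne_zero a.2)
    obtain ⟨s, hs⟩ := hπ (π (algebraMap A S a))⁻¹
    obtain ⟨N, hN⟩ := hker
    have h1 : IsNilpotent (1 - algebraMap A S a * s) := by
      refine ⟨N, ?_⟩
      have h2 : 1 - algebraMap A S a * s ∈ RingHom.ker (π : S →+* κ) := by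
        rw [RingHom.mem_ker]
        simp only [map_sub, map_one, map_mul, RingHom.coe_coe, hs]
        rw [mul_inv_cancel₀ ha, sub_self]
      have h3 := Ideal.pow_mem_pow h2 N
      rwa [hN, Ideal.zero_eq_bot, Ideal.mem_bot] at h3
    have h4 := h1.isUnit_one_sub
    rw [sub_sub_cancel] at h4
    exact isUnit_of_mul_isUnit_left h4
  have hκ : ∀ a : nonZeroDivisors A, IsUnit (algebraMap A κ a) := fun a =>
    IsUnit.mk0 _ ((map_ne_zero_iff _ hinj).2 (nonZeroDivisors.ne_zero a.2))
  let : Algebra K S := (IsLocalization.lift hS).toAlgebra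
  let : Algebra K κ := (IsLocalization.lift hκ).toAlgebra
  have : IsScalarTower A K S := IsScalarTower.of_algebraMap_eq fun a =>
    (IsLocalization.lift_eq hS a).symm
  have : IsScalarTower A K κ := IsScalarTower.of_algebraMap_eq fun a =>
    (IsLocalization.lift_eq hκ a).symm
  have hcomp : (π : S →+* κ).comp (algebraMap K S) = algebraMap K κ := by
    refine IsLocalization.ringHom_ext (nonZeroDivisors A) (RingHom.ext fun a => ?_)
    simp only [RingHom.comp_apply]
    rw [← IsScalarTower.algebraMap_apply, ← IsScalarTower.algebraMap_apply]
    exact π.commutes a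
  let π' : S →ₐ[K] κ := { (π : S →+* κ) with commutes' := fun k => RingHom.congr_fun hcomp k }
  have : Algebra.IsAlgebraic K κ := IsFractionRing.comap_isAlgebraic_iff.1 ‹_›
  have : CharZero K := charZero_of_injective_algebraMap (IsFractionRing.injective A K)
  -- Characteristic zero makes the algebraic extension separable, and the identity of `κ` then lifts
  -- through `π`.
  have : Algebra.FormallyEtale K κ := Algebra.FormallyEtale.of_isSeparable K κ
  let σ : κ →ₐ[K] S := Algebra.FormallySmooth.liftOfSurjective (AlgHom.id K κ) π' hπ hker
  refine ⟨σ.restrictScalars A, fun x => ?_⟩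
  exact Algebra.FormallySmooth.liftOfSurjective_apply (AlgHom.id K κ) π' hπ hker x

namespace AnalyticGerm

open IsLocalRing

/-! ### Derivations of the ring of germs -/

section Derivations

variable {n : ℕ} {p : Fin n → ℂ}

theorem partialDeriv_add {g h : (Fin n → ℂ) → ℂ} {x : Fin n → ℂ} (j : Fin n)
    (hg : AnalyticAt ℂ g x) (hh : AnalyticAt ℂ h x) :
    partialDeriv j (g + h) x = partialDeriv j g x + partialDeriv j h x := by
  simp only [partialDeriv]
  rw [fderiv_add hg.differentiableAt hh.differentiableAt]
  rfl

theorem partialDeriv_mul {g h : (Fin n → ℂ) → ℂ} {x : Fin n → ℂ} (j : Fin n)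
    (hg : AnalyticAt ℂ g x) (hh : AnalyticAt ℂ h x) :
    partialDeriv j (g * h) x = g x * partialDeriv j h x + h x * partialDeriv j g x := by
  simp only [partialDeriv]
  rw [fderiv_mul hg.differentiableAt hh.differentiableAt]
  rfl

theorem pderiv_add (j : Fin n) (φ ψ : LocalRingAt p) :
    pderiv j (φ + ψ) = pderiv j φ + pderiv j ψ := by
  obtain ⟨g, hg, rfl⟩ := exists_germ_eq φ
  obtain ⟨h, hh, rfl⟩ := exists_germ_eq ψ
  refine (germ_eq_iff (analyticAt_partialDeriv j (hg.add hh))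
    ((analyticAt_partialDeriv j hg).add (analyticAt_partialDeriv j hh))).2 ?_
  filter_upwards [hg.eventually_analyticAt, hh.eventually_analyticAt] with x hx hx'
  exact partialDeriv_add j hx hx'

theorem pderiv_mul (j : Fin n) (φ ψ : LocalRingAt p) :
    pderiv j (φ * ψ) = φ * pderiv j ψ + ψ * pderiv j φ := by
  obtain ⟨g, hg, rfl⟩ := exists_germ_eq φ
  obtain ⟨h, hh, rfl⟩ := exists_germ_eq ψ
  refine (germ_eq_iff (analyticAt_partialDeriv j (hg.mul hh))
    ((hg.mul (analyticAt_partialDeriv j hh)).add (hh.mul (analyticAt_partialDeriv j hg)))).2 ?_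
  filter_upwards [hg.eventually_analyticAt, hh.eventually_analyticAt] with x hx hx'
  exact partialDeriv_mul j hx hx'

theorem pderiv_algebraMap (j : Fin n) (c : ℂ) :
    pderiv j (algebraMap ℂ (LocalRingAt p) c) = 0 := by
  refine (germ_eq_iff (analyticAt_partialDeriv j analyticAt_const)
    (analyticAt_const (v := (0 : ℂ)))).2 (Eventually.of_forall fun x => ?_)
  simp [partialDeriv]

/-- The partial derivative `∂/∂x_j` as a derivation. -/
def pderivation (p : Fin n → ℂ) (j : Fin n) : Derivation ℂ (LocalRingAt p) (LocalRingAt p) :=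
  Derivation.mk'
    { toFun := pderiv j
      map_add' := pderiv_add j
      map_smul' := fun c φ => by
        rw [Algebra.smul_def, pderiv_mul, pderiv_algebraMap, mul_zero, add_zero, RingHom.id_apply,
          Algebra.smul_def] }
    fun φ ψ => pderiv_mul j φ ψ

@[simp] theorem pderivation_apply (j : Fin n) (φ : LocalRingAt p) :
    pderivation p j φ = pderiv j φ := rfl

theorem pderiv_localCoord (i j : Fin n) :
    pderiv j (localCoord p i) = if i = j then 1 else 0 := by
  have h1 : pderiv j (localCoord p i) = pderiv j (coord p i) := by
    rw [← pderivation_apply, localCoord, map_sub, Derivation.map_algebraMap, sub_zero]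
    rfl
  rw [h1, coord, pderiv_germ]
  have h2 : partialDeriv j (fun x : Fin n → ℂ => x i) = fun _ => if i = j then 1 else 0 := by
    funext x
    have : fderiv ℂ (fun x : Fin n → ℂ => x i) x =
        ContinuousLinearMap.proj (R := ℂ) (φ := fun _ : Fin n => ℂ) i :=
      (ContinuousLinearMap.proj (R := ℂ) (φ := fun _ : Fin n => ℂ) i).fderiv
    rw [partialDeriv, this, ContinuousLinearMap.proj_apply, Pi.single_apply]
  simp only [h2]
  split_ifs <;> rfl

/-- A derivation with values in a finitely generated module is determined by its values on the
coordinates. -/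
theorem derivation_eq_sum {V : Type*} [AddCommGroup V] [Module (LocalRingAt p) V] [Module ℂ V]
    (δ : Derivation ℂ (LocalRingAt p) V) (M : Submodule (LocalRingAt p) V) (hM : M.FG)
    (hδ : ∀ φ, δ φ ∈ M) (φ : LocalRingAt p) :
    δ φ = ∑ j, pderiv j φ • δ (localCoord p j) := by
  classical
  have hE : ∀ φ, δ φ - ∑ j, pderiv j φ • δ (localCoord p j) ∈ M := fun φ =>
    sub_mem (hδ φ) (sum_mem fun j _ => M.smul_mem _ (hδ _))
  let E : LocalRingAt p → M := fun φ => ⟨_, hE φ⟩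
  have hEadd : ∀ φ ψ, E (φ + ψ) = E φ + E ψ := by
    intro φ ψ
    apply Subtype.ext
    simp only [E, Submodule.coe_add, map_add, pderiv_add, add_smul, Finset.sum_add_distrib]
    abel
  have hEmul : ∀ φ ψ, E (φ * ψ) = φ • E ψ + ψ • E φ := by
    intro φ ψ
    apply Subtype.ext
    simp only [E, Submodule.coe_add, Submodule.coe_smul, Derivation.leibniz, pderiv_mul, add_smul,
      Finset.sum_add_distrib, smul_sub, Finset.smul_sum, smul_smul]
    abel
  have hEconst : ∀ c : ℂ, E (algebraMap ℂ _ c) = 0 := by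
    intro c
    apply Subtype.ext
    simp [E, pderiv_algebraMap]
  have hEcoord : ∀ i, E (localCoord p i) = 0 := by
    intro i
    apply Subtype.ext
    simp [E, pderiv_localCoord]
  have hEsum : ∀ a : Fin n → LocalRingAt p, E (∑ i, a i * localCoord p i) =
      ∑ i, localCoord p i • E (a i) := by
    intro a
    have : ∀ s : Finset (Fin n), E (∑ i ∈ s, a i * localCoord p i) =
        ∑ i ∈ s, localCoord p i • E (a i) := by
      intro s
      induction s using Finset.induction_on with
      | empty =>
        rw [Finset.sum_empty, Finset.sum_empty]
        simpa using hEconst 0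
      | insert i s hi ih =>
        rw [Finset.sum_insert hi, Finset.sum_insert hi, hEadd, ih, hEmul, hEcoord, smul_zero,
          zero_add]
    exact this _
  -- The error `E` obeys the Leibniz rule and kills constants and coordinates. Each subtraction of
  -- the value at `p` gains one power of the maximal ideal, and Krull's intersection theorem in the
  -- finitely generated `M` gives `E = 0`.
  have hpow : ∀ (k : ℕ) (φ : LocalRingAt p),
      E φ ∈ (maximalIdeal (LocalRingAt p) ^ k • ⊤ : Submodule (LocalRingAt p) M) := by
    intro k
    induction k with
    | zero => intro φ; simp
    | succ k ih =>
      intro φ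
      have h1 : φ - algebraMap ℂ _ (evalHom p φ) ∈ maximalIdeal (LocalRingAt p) := by
        rw [mem_maximalIdeal_iff, map_sub, AlgHom.commutes]
        exact sub_self _
      rw [maximalIdeal_eq_span, Ideal.mem_span_range_iff_exists_fun] at h1
      obtain ⟨a, ha⟩ := h1
      have h2 : φ = ∑ i, a i * localCoord p i + algebraMap ℂ _ (evalHom p φ) := by
        rw [ha, sub_add_cancel]
      rw [h2, hEadd, hEconst, add_zero, hEsum, pow_succ', Submodule.mul_smul]
      refine sum_mem fun i _ => Submodule.smul_mem_smul ?_ (ih _)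
      exact (mem_maximalIdeal_iff _).2 (evalHom_localCoord p i)
  have : Module.Finite (LocalRingAt p) M := Module.Finite.iff_fg.2 hM
  have hbot := Ideal.iInf_pow_smul_eq_bot_of_isLocalRing (M := M)
    (maximalIdeal (LocalRingAt p)) (maximalIdeal.isMaximal _).ne_top
  have h0 : E φ ∈ (⊥ : Submodule (LocalRingAt p) M) := by
    rw [← hbot, Submodule.mem_iInf]
    exact fun k => hpow k φ
  have h1 := congrArg Subtype.val ((Submodule.mem_bot _).1 h0)
  exact sub_eq_zero.1 h1

end Derivations

end AnalyticGerm

theorem RingHom.isNilpotent_ker_of_mul_eq_zero {S κ : Type*} [CommRing S] [CommRing κ]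
    (π : S →+* κ) (h : ∀ x y, π x = 0 → π y = 0 → x * y = 0) : IsNilpotent (RingHom.ker π) := by
  refine ⟨2, ?_⟩
  rw [pow_two, Ideal.zero_eq_bot, eq_bot_iff, Ideal.mul_le]
  exact fun x hx y hy => h x y hx hy

/-! ### Germs that lie in a prime ideal together with their derivatives -/

namespace AnalyticGerm

open IsLocalRing

section

variable {n : ℕ} {p : Fin n → ℂ}

instance (p : Fin n → ℂ) : CharZero (LocalRingAt p) :=
  charZero_of_injective_algebraMap (algebraMap ℂ (LocalRingAt p)).injective

/-- An abstract form of the injectivity of `I/I² → Ω¹ ⊗ 𝒪/I` at a generic point. -/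
theorem algebraMap_eq_zero_of_pderiv_mem (P : Ideal (LocalRingAt p)) [P.IsPrime]
    {S : Type} [CommRing S] [Algebra (LocalRingAt p) S] [Algebra ℂ S]
    [IsScalarTower ℂ (LocalRingAt p) S]
    (π : S →ₐ[LocalRingAt p] P.ResidueField) (hπ : Function.Surjective π)
    (hsq : ∀ x y, π x = 0 → π y = 0 → x * y = 0) {g : LocalRingAt p} (hg : g ∈ P)
    (hdg : ∀ j, pderiv j g ∈ P) : algebraMap (LocalRingAt p) S g = 0 := by
  classical
  obtain ⟨d, f, hinj, hfin⟩ := exists_noether (Ideal.Quotient.mk P) Ideal.Quotient.mk_surjective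
  let A := LocalRingAt (0 : Fin d → ℂ)
  have : IsDomain A := Function.Injective.isDomain _ hinj
  let : Algebra A (LocalRingAt p ⧸ P) := ((Ideal.Quotient.mk P).comp (f : A →+* _)).toAlgebra
  have hfinite : Module.Finite A (LocalRingAt p ⧸ P) := hfin
  let : Algebra A S := ((algebraMap (LocalRingAt p) S).comp (f : A →+* _)).toAlgebra
  let : Algebra A P.ResidueField :=
    ((algebraMap (LocalRingAt p) P.ResidueField).comp (f : A →+* _)).toAlgebra
  have : IsScalarTower A (LocalRingAt p ⧸ P) P.ResidueField :=
    IsScalarTower.of_algebraMap_eq fun a => by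
      change algebraMap (LocalRingAt p) P.ResidueField (f a) = algebraMap (LocalRingAt p ⧸ P) _
        (algebraMap (LocalRingAt p) (LocalRingAt p ⧸ P) (f a))
      rw [← IsScalarTower.algebraMap_apply]
  have : FaithfulSMul A (LocalRingAt p ⧸ P) := (faithfulSMul_iff_algebraMap_injective _ _).2 hinj
  have : Algebra.IsAlgebraic (LocalRingAt p ⧸ P) P.ResidueField :=
    IsLocalization.isAlgebraic _ (nonZeroDivisors (LocalRingAt p ⧸ P))
  have : Algebra.IsAlgebraic A P.ResidueField :=
    Algebra.IsAlgebraic.trans A (LocalRingAt p ⧸ P) P.ResidueField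
  have hAκ : Function.Injective (algebraMap A P.ResidueField) := by
    rw [IsScalarTower.algebraMap_eq A (LocalRingAt p ⧸ P) P.ResidueField]
    exact (IsFractionRing.injective (LocalRingAt p ⧸ P) P.ResidueField).comp hinj
  let πA : S →ₐ[A] P.ResidueField :=
    { (π : S →+* P.ResidueField) with commutes' := fun a => π.commutes (f a) }
  have hker : IsNilpotent (RingHom.ker (πA : S →+* P.ResidueField)) :=
    RingHom.isNilpotent_ker_of_mul_eq_zero _ hsq
  obtain ⟨σ, hσ⟩ := exists_algHom_section πA hπ hker hAκ
  have hσ' : ∀ x, π (σ x) = x := hσ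
  have hσf : ∀ a, σ (algebraMap (LocalRingAt p) P.ResidueField (f a)) =
      algebraMap (LocalRingAt p) S (f a) := σ.commutes
  -- The difference between the structure map and the section composed with reduction takes values
  -- in the square-zero kernel of `π`, hence is a derivation. It is zero on the Noether
  -- normalization and agrees with the structure map on `P`.
  let q : LocalRingAt p → S := fun φ =>
    algebraMap (LocalRingAt p) S φ - σ (algebraMap (LocalRingAt p) P.ResidueField φ)
  have hq : ∀ φ, π (q φ) = 0 := fun φ => by
    simp only [q, map_sub, hσ', AlgHom.commutes, sub_self]
  have hqmul : ∀ φ ψ, q (φ * ψ) = φ • q ψ + ψ • q φ := by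
    intro φ ψ
    have h := hsq _ _ (hq φ) (hq ψ)
    simp only [q, map_mul, Algebra.smul_def] at h ⊢
    linear_combination (-1 : S) * h
  have hqadd : ∀ φ ψ, q (φ + ψ) = q φ + q ψ := by
    intro φ ψ
    simp only [q, map_add]
    ring
  have hqf : ∀ a, q (f a) = 0 := fun a => by simp only [q, hσf, sub_self]
  have hqlin : ∀ a φ, q (f a * φ) = f a • q φ := fun a φ => by
    rw [hqmul, hqf, smul_zero, add_zero]
  let δ : Derivation ℂ (LocalRingAt p) S := Derivation.mk'
    { toFun := q
      map_add' := hqadd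
      map_smul' := fun c φ => by
        rw [Algebra.smul_def, ← f.commutes, hqlin, f.commutes, algebraMap_smul, RingHom.id_apply] }
    hqmul
  have hδP : ∀ φ ∈ P, δ φ = algebraMap (LocalRingAt p) S φ := by
    intro φ hφ
    change algebraMap (LocalRingAt p) S φ - σ (algebraMap (LocalRingAt p) P.ResidueField φ) = _
    rw [Ideal.algebraMap_residueField_eq_zero.2 hφ, map_zero, sub_zero]
  obtain ⟨s, hs⟩ := hfinite.fg_top
  let e : LocalRingAt p ⧸ P → LocalRingAt p := Function.surjInv Ideal.Quotient.mk_surjective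
  have he : ∀ b, Ideal.Quotient.mk P (e b) = b :=
    Function.surjInv_eq Ideal.Quotient.mk_surjective
  -- `S` is not assumed finitely generated over the ring of germs. The values of `δ` nevertheless
  -- lie in a finitely generated submodule, because `δ` is `A`-linear, `𝒪/P` is finite over `A`, and
  -- `P` is finitely generated.
  let M : Submodule (LocalRingAt p) S :=
    Submodule.span _ ((fun b => δ (e b)) '' (s : Set (LocalRingAt p ⧸ P))) ⊔
      Submodule.map (Algebra.linearMap (LocalRingAt p) S) P
  have hM : M.FG := by
    refine Submodule.FG.sup (Submodule.fg_span (s.finite_toSet.image _)) (Submodule.FG.map _ ?_)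
    exact IsNoetherian.noetherian P
  have hrep : ∀ b ∈ Submodule.span A (s : Set (LocalRingAt p ⧸ P)), ∀ φ,
      Ideal.Quotient.mk P φ = b → δ φ ∈ M := by
    have hP : ∀ φ ∈ P, δ φ ∈ M := fun φ hφ =>
      Submodule.mem_sup_right ⟨φ, hφ, (hδP φ hφ).symm⟩
    have hred : ∀ φ ψ, Ideal.Quotient.mk P φ = Ideal.Quotient.mk P ψ → δ ψ ∈ M → δ φ ∈ M := by
      intro φ ψ h hψ
      have := add_mem (hP _ (Ideal.Quotient.eq.1 h)) hψ
      rwa [← map_add, sub_add_cancel] at this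
    intro b hb
    induction hb using Submodule.span_induction with
    | mem b hb =>
      intro φ hφ
      exact hred φ (e b) (hφ.trans (he b).symm)
        (Submodule.mem_sup_left (Submodule.subset_span ⟨b, hb, rfl⟩))
    | zero => exact fun φ hφ => hP φ (Ideal.Quotient.eq_zero_iff_mem.1 hφ)
    | add b c _ _ hb hc =>
      intro φ hφ
      refine hred φ (e b + e c) (by rw [hφ, map_add, he, he]) ?_
      rw [map_add]
      exact add_mem (hb _ (he b)) (hc _ (he c))
    | smul a b _ hb =>
      intro φ hφ
      refine hred φ (f a * e b) (by rw [hφ, map_mul, he]; rfl) ?_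
      have : δ (f a * e b) = f a • δ (e b) := hqlin a (e b)
      rw [this]
      exact M.smul_mem _ (hb _ (he b))
  have hδM : ∀ φ, δ φ ∈ M := fun φ => hrep _ (hs ▸ Submodule.mem_top) φ rfl
  rw [← hδP g hg, derivation_eq_sum δ M hM hδM g]
  refine Finset.sum_eq_zero fun j _ => ?_
  rw [Algebra.smul_def]
  -- In each summand both `∂ⱼg` and `δ(xⱼ)` map to zero in the residue field, so their product
  -- vanishes.
  refine hsq _ _ ?_ (hq _)
  rw [AlgHom.commutes, Ideal.algebraMap_residueField_eq_zero.2 (hdg j)]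

/-- A germ that lies in a prime `P` together with its partial derivatives lies in the symbolic
square of `P`. -/
theorem algebraMap_mem_maximalIdeal_sq (P : Ideal (LocalRingAt p)) [P.IsPrime]
    {g : LocalRingAt p} (hg : g ∈ P) (hdg : ∀ j, pderiv j g ∈ P) :
    algebraMap (LocalRingAt p) (Localization.AtPrime P) g ∈
      maximalIdeal (Localization.AtPrime P) ^ 2 := by
  let L := Localization.AtPrime P
  have hle : maximalIdeal L ^ 2 ≤ maximalIdeal L := Ideal.pow_le_self two_ne_zero
  let π : (L ⧸ maximalIdeal L ^ 2) →ₐ[LocalRingAt p] P.ResidueField :=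
    { (Ideal.Quotient.factor hle : L ⧸ maximalIdeal L ^ 2 →+* P.ResidueField) with
      commutes' := fun a => rfl }
  have h := algebraMap_eq_zero_of_pderiv_mem P (S := L ⧸ maximalIdeal L ^ 2) π
    (Ideal.Quotient.factor_surjective hle) ?_ hg hdg
  · rwa [IsScalarTower.algebraMap_apply (LocalRingAt p) L (L ⧸ maximalIdeal L ^ 2),
      Ideal.Quotient.algebraMap_eq, Ideal.Quotient.eq_zero_iff_mem] at h
  · intro x y
    obtain ⟨x, rfl⟩ := Ideal.Quotient.mk_surjective x
    obtain ⟨y, rfl⟩ := Ideal.Quotient.mk_surjective y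
    intro hx hy
    have hx' : x ∈ maximalIdeal L := Ideal.Quotient.eq_zero_iff_mem.1 hx
    have hy' : y ∈ maximalIdeal L := Ideal.Quotient.eq_zero_iff_mem.1 hy
    rw [← map_mul, Ideal.Quotient.eq_zero_iff_mem, pow_two]
    exact Ideal.mul_mem_mul hx' hy'

end

end AnalyticGerm

/-! ### Syzygies of regular sequences -/

section Syzygies

variable {R : Type*} [CommRing R]

/-- Regularity puts the last coefficient in the ideal of the earlier elements. Substituting that
expression turns the relation into a syzygy of the shorter sequence, with coefficients changed only
by multiples of the last element. -/
theorem mem_span_of_sum_mul_eq_zero {r : ℕ} (F : Fin r → R)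
    (hF : ∀ (k : Fin r) (a : R), a * F k ∈ Ideal.span (F '' Set.Iio k) →
      a ∈ Ideal.span (F '' Set.Iio k)) (a : Fin r → R) (ha : ∑ i, a i * F i = 0) (i : Fin r) :
    a i ∈ Ideal.span (Set.range F) := by
  induction r with
  | zero => exact i.elim0
  | succ r ih =>
    have himg : F '' Set.Iio (Fin.last r) = Set.range (F ∘ Fin.castSucc) := by
      rw [Set.range_comp, Fin.range_castSucc]
      congr 1
    have hle : Ideal.span (Set.range (F ∘ Fin.castSucc)) ≤ Ideal.span (Set.range F) :=
      Ideal.span_mono (Set.range_comp_subset_range _ _)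
    rw [Fin.sum_univ_castSucc] at ha
    have hlast : a (Fin.last r) ∈ Ideal.span (Set.range (F ∘ Fin.castSucc)) := by
      have := hF (Fin.last r) (a (Fin.last r))
      rw [himg] at this
      refine this ?_
      rw [← neg_eq_of_add_eq_zero_right ha]
      refine neg_mem (sum_mem fun j _ => Ideal.mul_mem_left _ _ (Ideal.subset_span ⟨j, rfl⟩))
    obtain ⟨c, hc⟩ := (Ideal.mem_span_range_iff_exists_fun).1 hlast
    have hsum : ∑ j : Fin r, (a j.castSucc + c j * F (Fin.last r)) * (F ∘ Fin.castSucc) j = 0 := by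
      rw [← ha, ← hc, Finset.sum_mul, ← Finset.sum_add_distrib]
      refine Finset.sum_congr rfl fun j _ => ?_
      simp only [Function.comp_apply]
      ring
    have hF' : ∀ (k : Fin r) (b : R), b * (F ∘ Fin.castSucc) k ∈
        Ideal.span ((F ∘ Fin.castSucc) '' Set.Iio k) →
        b ∈ Ideal.span ((F ∘ Fin.castSucc) '' Set.Iio k) := by
      intro k b
      have := hF k.castSucc b
      rwa [← Fin.image_castSucc_Iio, ← Set.image_comp] at this
    refine Fin.lastCases (hle hlast) (fun j => ?_) i
    have h1 := hle (ih _ hF' _ hsum j)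
    have h2 : c j * F (Fin.last r) ∈ Ideal.span (Set.range F) :=
      Ideal.mul_mem_left _ _ (Ideal.subset_span ⟨_, rfl⟩)
    simpa using sub_mem h1 h2

theorem mem_span_image_Iio_of_isWeaklyRegular {r : ℕ} (F : Fin r → R)
    (hF : RingTheory.Sequence.IsWeaklyRegular R (List.ofFn F)) (k : Fin r) (a : R)
    (ha : a * F k ∈ Ideal.span (F '' Set.Iio k)) : a ∈ Ideal.span (F '' Set.Iio k) := by
  have hlist : Ideal.ofList ((List.ofFn F).take k) = Ideal.span (F '' Set.Iio k) := by
    rw [Ideal.ofList]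
    congr 1
    ext x
    simp only [Set.mem_ofPred_eq, List.mem_take_iff_getElem, List.getElem_ofFn, Set.mem_image,
      Set.mem_Iio, List.length_ofFn]
    constructor
    · rintro ⟨i, hi, rfl⟩
      exact ⟨⟨i, by omega⟩, by rw [Fin.lt_def]; simp only; omega, rfl⟩
    · rintro ⟨i, hi, rfl⟩
      exact ⟨i, by have := i.2; have := k.2; rw [Fin.lt_def] at hi; omega, rfl⟩
  have h := hF.regular_mod_prev k (by simp)
  rw [hlist, isSMulRegular_quotient_iff_mem_of_smul_mem] at h
  simp only [smul_eq_mul, Ideal.mul_top, List.getElem_ofFn] at h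
  exact h a (by rwa [mul_comm])

/-- The conormal module of a regular sequence is free. -/
theorem mem_span_of_sum_mul_mem_sq {r : ℕ} (F : Fin r → R)
    (hF : RingTheory.Sequence.IsWeaklyRegular R (List.ofFn F)) (a : Fin r → R)
    (ha : ∑ i, a i * F i ∈ Ideal.span (Set.range F) ^ 2) (i : Fin r) :
    a i ∈ Ideal.span (Set.range F) := by
  -- An element of the square is a combination of the `Fᵢ` with coefficients in the ideal;
  -- subtracting it leaves a genuine syzygy.
  have hsq : Ideal.span (Set.range F) ^ 2 ≤
      Submodule.map (Fintype.linearCombination R F) (Submodule.pi Set.univ fun _ =>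
        Ideal.span (Set.range F)) := by
    rw [pow_two, Ideal.mul_le]
    intro x hx y hy
    obtain ⟨c, rfl⟩ := Ideal.mem_span_range_iff_exists_fun.1 hy
    refine ⟨fun i => x * c i, fun i _ => Ideal.mul_mem_right _ _ hx, ?_⟩
    simp [Fintype.linearCombination_apply, Finset.mul_sum, mul_assoc]
  obtain ⟨c, hc, hca⟩ := hsq ha
  have h0 : ∑ i, (a i - c i) * F i = 0 := by
    simp only [sub_mul, Finset.sum_sub_distrib]
    rw [← hca]
    simp [Fintype.linearCombination_apply]
  have h1 := mem_span_of_sum_mul_eq_zero F (mem_span_image_Iio_of_isWeaklyRegular F hF) _ h0 i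
  simpa using add_mem h1 (hc i trivial)

/-- A radical ideal generates the maximal ideal of the localization at each of its minimal
primes. -/
theorem exists_mul_mem_sq_of_algebraMap_mem_sq {I P : Ideal R} (hI : I.IsRadical)
    (hP : P ∈ I.minimalPrimes) [P.IsPrime] {g : R}
    (hg : algebraMap R (Localization.AtPrime P) g ∈
      IsLocalRing.maximalIdeal (Localization.AtPrime P) ^ 2) :
    ∃ s, s ∉ P ∧ s * g ∈ I ^ 2 := by
  have hmap : IsLocalRing.maximalIdeal (Localization.AtPrime P) ≤
      I.map (algebraMap R (Localization.AtPrime P)) := by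
    rw [← Localization.AtPrime.map_eq_maximalIdeal, Ideal.map_le_iff_le_comap]
    intro x hx
    have h1 := Ideal.mem_map_of_mem (algebraMap R (Localization.AtPrime P)) hx
    rw [← IsLocalization.AtPrime.radical_map_of_mem_minimalPrimes _ P I hP] at h1
    obtain ⟨N, hN⟩ := h1
    rw [← map_pow, IsLocalization.algebraMap_mem_map_algebraMap_iff P.primeCompl] at hN
    obtain ⟨s, hs, hsx⟩ := hN
    rw [Ideal.mem_comap, IsLocalization.algebraMap_mem_map_algebraMap_iff P.primeCompl]
    -- Minimality of `P` only gives `s x ^ N ∈ I`; radicality of `I` upgrades this to `s x ∈ I`. The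
    -- exponent `N + 1` also covers `N = 0`.
    refine ⟨s, hs, hI ⟨N + 1, ?_⟩⟩
    have : (s * x) ^ (N + 1) = s ^ N * x * (s * x ^ N) := by ring
    rw [this]
    exact Ideal.mul_mem_left _ _ hsx
  have h2 := Ideal.pow_right_mono hmap 2 hg
  rw [← Ideal.map_pow, IsLocalization.algebraMap_mem_map_algebraMap_iff P.primeCompl] at h2
  obtain ⟨s, hs, h⟩ := h2
  exact ⟨s, hs, h⟩

end Syzygies

/-! ### Independence of the differentials of the equations -/

namespace AnalyticGerm

/-- The Jacobian matrix of a reduced complete intersection has linearly independent rows. -/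
theorem mem_of_sum_mul_pderiv_mem {n r : ℕ} {p : Fin n → ℂ} (F : Fin r → LocalRingAt p)
    (hci : RingTheory.Sequence.IsWeaklyRegular (LocalRingAt p) (List.ofFn F))
    (hred : (idealOf F).IsRadical) (a : Fin r → LocalRingAt p)
    (ha : ∀ j, ∑ i, a i * pderiv j (F i) ∈ idealOf F) (i : Fin r) : a i ∈ idealOf F := by
  rw [← hred.radical, ← Ideal.sInf_minimalPrimes, Ideal.mem_sInf]
  intro P hP
  have : P.IsPrime := hP.1.1
  have hIP : idealOf F ≤ P := hP.1.2
  have hF : ∀ i, F i ∈ idealOf F := fun i => Ideal.subset_span ⟨i, rfl⟩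
  have hg : ∑ i, a i * F i ∈ idealOf F := sum_mem fun i _ => Ideal.mul_mem_left _ _ (hF i)
  have hdg : ∀ j, pderiv j (∑ i, a i * F i) ∈ P := by
    intro j
    rw [← pderivation_apply, map_sum]
    simp only [pderivation_apply, pderiv_mul, Finset.sum_add_distrib]
    -- The Leibniz terms in which the derivative falls on `aᵢ` keep the factor `Fᵢ ∈ I`.
    exact hIP (add_mem (ha j) (sum_mem fun i _ => Ideal.mul_mem_right _ _ (hF i)))
  obtain ⟨s, hs, hsg⟩ := exists_mul_mem_sq_of_algebraMap_mem_sq hred hP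
    (algebraMap_mem_maximalIdeal_sq P (hIP hg) hdg)
  rw [Finset.mul_sum] at hsg
  simp only [← mul_assoc] at hsg
  have hsa : s * a i ∈ P := hIP (mem_span_of_sum_mul_mem_sq F hci (fun i => s * a i) hsg i)
  exact (Ideal.IsPrime.mem_or_mem ‹_› hsa).resolve_left hs

end AnalyticGerm

/-! ### `Ext¹` of a cokernel of an injective matrix -/

section ExtOfPresentation

open CategoryTheory CategoryTheory.Abelian

variable {R : Type} [CommRing R] {n r : ℕ}

/-- If `0 → Rʳ → Rⁿ → Rⁿ ⧸ N → 0` is exact, with first map the transpose of `J`, then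
`Ext¹(Rⁿ ⧸ N, R)` is the cokernel of `J : Rⁿ → Rʳ`. -/
theorem nonempty_ext_linearEquiv_coker (J : Matrix (Fin r) (Fin n) R)
    (hJ : Function.Injective J.transpose.mulVecLin) (N : Submodule R (Fin n → R))
    (hN : LinearMap.range J.transpose.mulVecLin = N) :
    Nonempty (Ext.{0} (ModuleCat.of R ((Fin n → R) ⧸ N)) (ModuleCat.of R R) 1 ≃ₗ[R]
      (Fin r → R) ⧸ LinearMap.range J.mulVecLin) := by
  let S : ShortComplex (ModuleCat.{0} R) := ShortComplex.mk
    (ModuleCat.ofHom J.transpose.mulVecLin) (ModuleCat.ofHom N.mkQ) (by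
      rw [← ModuleCat.ofHom_comp, ← hN, LinearMap.range_mkQ_comp]
      rfl)
  have hS : S.ShortExact := by
    refine ModuleCat.shortComplex_shortExact S ?_ hJ N.mkQ_surjective
    rw [LinearMap.exact_iff]
    exact (Submodule.ker_mkQ N).trans hN.symm
  have : Projective S.X₂ :=
    inferInstanceAs (Projective (ModuleCat.of R (Fin n → R)))
  -- The dot product identifies vectors with functionals; under it, precomposition with the
  -- transpose of `J` becomes `J`.
  let dual (m : ℕ) : (Fin m → R) →ₗ[R] (ModuleCat.of R (Fin m → R) ⟶ ModuleCat.of R R) :=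
    (ModuleCat.homLinearEquiv (S := R)).symm.toLinearMap ∘ₗ
      (dotProductBilin R R : (Fin m → R) →ₗ[R] (Fin m → R) →ₗ[R] R)
  have happly (m : ℕ) (v u : Fin m → R) : (dual m v).hom u = v ⬝ᵥ u := rfl
  have hdual (m : ℕ) : Function.Surjective (dual m) := by
    intro φ
    refine ⟨fun i => φ.hom (Pi.single i 1), ?_⟩
    refine ModuleCat.hom_ext (LinearMap.pi_ext' fun i => LinearMap.ext_ring ?_)
    simp only [LinearMap.comp_apply, LinearMap.single_apply]
    rw [happly, dotProduct_single_one]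
  have hcomp (w : Fin n → R) : S.f ≫ dual n w = dual r (J.mulVec w) := by
    refine ModuleCat.hom_ext (LinearMap.ext fun u => ?_)
    change w ⬝ᵥ J.transpose.mulVec u = J.mulVec w ⬝ᵥ u
    rw [Matrix.mulVec_transpose, dotProduct_comm w, ← Matrix.dotProduct_mulVec, dotProduct_comm]
  let Φ : (Fin r → R) →ₗ[R] Ext.{0} S.X₃ (ModuleCat.of R R) 1 :=
    (Ext.bilinearCompOfLinear R S.X₃ S.X₁ (ModuleCat.of R R) 1 0 1 (add_zero 1) hS.extClass) ∘ₗ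
      (Ext.linearEquiv₀ (R := R)).symm.toLinearMap ∘ₗ dual r
  have hΦ (v : Fin r → R) : Φ v = hS.extClass.comp (Ext.mk₀ (dual r v)) (add_zero 1) := rfl
  have hsurj : Function.Surjective Φ := by
    intro x
    -- The connecting map out of `Hom(Rʳ, R)` is onto because the middle term `Rⁿ` is projective.
    obtain ⟨y, hy⟩ := precomp_extClass_surjective_of_projective_X₂ (ModuleCat.of R R) hS 0 x
    obtain ⟨φ, rfl⟩ := (Ext.mk₀_bijective _ _).2 y
    obtain ⟨v, rfl⟩ := hdual r φ
    exact ⟨v, hy⟩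
  have hker : LinearMap.ker Φ = LinearMap.range J.mulVecLin := by
    ext v
    rw [LinearMap.mem_ker, LinearMap.mem_range, hΦ]
    constructor
    · intro h
      obtain ⟨y, hy⟩ := Ext.contravariant_sequence_exact₁ hS _ _ (add_zero 1) h
      obtain ⟨φ, rfl⟩ := (Ext.mk₀_bijective _ _).2 y
      obtain ⟨w, rfl⟩ := hdual n φ
      rw [Ext.mk₀_comp_mk₀, hcomp] at hy
      have h2 := (Ext.mk₀_bijective _ _).1 hy
      refine ⟨w, ?_⟩
      funext i
      have h3 := congrArg (fun ψ => ψ.hom (Pi.single i (1 : R))) h2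
      simpa only [happly, dotProduct_single_one, Matrix.mulVecLin_apply] using h3
    · rintro ⟨w, rfl⟩
      rw [Matrix.mulVecLin_apply, ← hcomp, ← Ext.mk₀_comp_mk₀, hS.extClass_comp_assoc]
  exact ⟨((Submodule.quotEquivOfEq _ _ hker.symm).trans
    (Φ.quotKerEquivOfSurjective hsurj)).symm⟩

end ExtOfPresentation

/-! ### `T¹` of a reduced complete intersection -/

namespace AnalyticGerm

/-- Modulo `I` the Leibniz rule reads `d(∑ aᵢFᵢ) = ∑ aᵢ dFᵢ`, so the `dFᵢ` alone span the relations
of `Ω¹`; they are linearly independent by `mem_of_sum_mul_pderiv_mem`. -/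
theorem nonempty_T1_linearEquiv_jacobianCoker {n r : ℕ} {p : Fin n → ℂ}
    (F : Fin r → LocalRingAt p)
    (hci : RingTheory.Sequence.IsWeaklyRegular (LocalRingAt p) (List.ofFn F))
    (hred : (idealOf F).IsRadical) :
    Nonempty (T1 (idealOf F) ≃ₗ[LocalRingAt p ⧸ idealOf F] jacobianCoker F) := by
  have hcol : ∀ v, (jacobianGerm F).transpose.mulVecLin v =
      ∑ i, v i • differential (idealOf F) (F i) := by
    intro v
    funext j
    simp only [Matrix.mulVecLin_apply, Matrix.mulVec, dotProduct, jacobianGerm, differential,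
      Matrix.transpose_apply, Matrix.of_apply, Finset.sum_apply, Pi.smul_apply, smul_eq_mul,
      mul_comm]
  refine nonempty_ext_linearEquiv_coker (jacobianGerm F) ?_ _ ?_
  · rw [← LinearMap.ker_eq_bot, LinearMap.ker_eq_bot']
    intro v hv
    choose a ha using fun i => Ideal.Quotient.mk_surjective (v i)
    have h := mem_of_sum_mul_pderiv_mem F hci hred a fun j => by
      have := congrFun hv j
      rw [hcol] at this
      rw [← Ideal.Quotient.eq_zero_iff_mem, map_sum]
      simpa [differential, ← ha] using this
    funext i
    rw [← ha]
    exact Ideal.Quotient.eq_zero_iff_mem.2 (h i)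
  · apply le_antisymm
    · rintro _ ⟨v, rfl⟩
      rw [hcol]
      exact sum_mem fun i _ => Submodule.smul_mem _ _
        (Submodule.subset_span ⟨_, Ideal.subset_span ⟨i, rfl⟩, rfl⟩)
    · rw [Submodule.span_le]
      rintro _ ⟨φ, hφ, rfl⟩
      obtain ⟨a, rfl⟩ := Ideal.mem_span_range_iff_exists_fun.1 hφ
      refine ⟨fun i => Ideal.Quotient.mk _ (a i), ?_⟩
      rw [hcol]
      funext j
      have hF : ∀ i, Ideal.Quotient.mk (idealOf F) (F i) = 0 := fun i =>
        Ideal.Quotient.eq_zero_iff_mem.2 (Ideal.subset_span ⟨i, rfl⟩)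
      simp only [Finset.sum_apply, Pi.smul_apply, smul_eq_mul, differential]
      rw [← pderivation_apply, map_sum, map_sum]
      simp only [pderivation_apply, pderiv_mul, map_add, map_mul, hF, zero_mul, add_zero]

end AnalyticGerm

namespace AnalyticGerm

open IsLocalRing

/-! ### Modules of finite complex dimension -/

section FiniteDimension

variable {n : ℕ} {p : Fin n → ℂ}

/-- On `M ⧸ 𝔪M` germs act through their value at `p`, so module generators span it over `ℂ`. The
submodule `𝔪M` is killed by a smaller power of `𝔪`. -/
theorem finite_complex_of_pow_smul_eq_zero (N : ℕ) {M : Type*} [AddCommGroup M]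
    [Module (LocalRingAt p) M] [Module ℂ M] [IsScalarTower ℂ (LocalRingAt p) M]
    [Module.Finite (LocalRingAt p) M]
    (h : ∀ φ ∈ maximalIdeal (LocalRingAt p) ^ N, ∀ x : M, φ • x = 0) : Module.Finite ℂ M := by
  induction N generalizing M with
  | zero =>
    have : Subsingleton M := ⟨fun x y => by
      rw [← one_smul (LocalRingAt p) x, ← one_smul (LocalRingAt p) y, h 1 (by simp), h 1 (by simp)]⟩
    infer_instance
  | succ N ih =>
    let K : Submodule (LocalRingAt p) M := maximalIdeal (LocalRingAt p) • ⊤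
    have hK : Module.Finite ℂ K := by
      refine ih fun φ hφ x => ?_
      suffices K ≤ LinearMap.ker (LinearMap.lsmul (LocalRingAt p) M φ) from Subtype.ext (this x.2)
      refine Submodule.smul_le.2 fun ψ hψ y _ => ?_
      rw [LinearMap.mem_ker, LinearMap.lsmul_apply, smul_smul]
      exact h _ (by rw [pow_succ]; exact Ideal.mul_mem_mul hφ hψ) y
    have hQ : Module.Finite ℂ (M ⧸ K) := by
      obtain ⟨s, hs⟩ := (inferInstance : Module.Finite (LocalRingAt p) (M ⧸ K)).fg_top
      refine ⟨s, eq_top_iff.2 fun x _ => ?_⟩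
      have hx : x ∈ Submodule.span (LocalRingAt p) (s : Set (M ⧸ K)) := hs ▸ Submodule.mem_top
      induction hx using Submodule.span_induction with
      | mem x hx => exact Submodule.subset_span hx
      | zero => exact zero_mem _
      | add x y _ _ hx hy => exact add_mem (hx trivial) (hy trivial)
      | smul φ x _ hx =>
        have h1 : φ • x = evalHom p φ • x := by
          rw [← algebraMap_smul (LocalRingAt p) (evalHom p φ) x, ← sub_eq_zero, ← sub_smul]
          obtain ⟨y, rfl⟩ := K.mkQ_surjective x
          rw [← map_smul, Submodule.mkQ_apply, Submodule.Quotient.mk_eq_zero]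
          refine Submodule.smul_mem_smul ?_ trivial
          rw [mem_maximalIdeal_iff, map_sub, AlgHom.commutes]
          exact sub_self _
        rw [h1]
        exact Submodule.smul_mem _ _ (hx trivial)
    have : Module.Finite ℂ (K.restrictScalars ℂ) := hK
    have : Module.Finite ℂ (M ⧸ K.restrictScalars ℂ) := hQ
    exact Module.Finite.of_submodule_quotient (K.restrictScalars ℂ)

/-- A finitely generated module has finite complex dimension if and only if it is killed by a
power of the maximal ideal. -/
theorem finite_complex_iff {M : Type*} [AddCommGroup M]
    [Module (LocalRingAt p) M] [Module ℂ M] [IsScalarTower ℂ (LocalRingAt p) M]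
    [Module.Finite (LocalRingAt p) M] : Module.Finite ℂ M ↔
      ∃ N : ℕ, ∀ φ ∈ maximalIdeal (LocalRingAt p) ^ N, ∀ x : M, φ • x = 0 := by
  refine ⟨fun hM => ?_, fun ⟨N, hN⟩ => finite_complex_of_pow_smul_eq_zero N hN⟩
  have : IsArtinian (LocalRingAt p) M := isArtinian_of_tower ℂ inferInstance
  -- Finite dimension makes the chain `𝔪ᵏM` stabilize, and Nakayama's lemma shows that the stable
  -- term is zero.
  have hanti : Antitone fun k : ℕ =>
      maximalIdeal (LocalRingAt p) ^ k • (⊤ : Submodule (LocalRingAt p) M) :=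
    fun a b hab => Submodule.smul_mono_left (Ideal.pow_le_pow_right hab)
  obtain ⟨N, hN⟩ := IsArtinian.monotone_stabilizes ⟨_, hanti.dual_right⟩
  have h1 : maximalIdeal (LocalRingAt p) ^ N • (⊤ : Submodule (LocalRingAt p) M) =
      maximalIdeal (LocalRingAt p) ^ (N + 1) • (⊤ : Submodule (LocalRingAt p) M) :=
    OrderDual.toDual.injective (hN (N + 1) (Nat.le_succ N))
  have : IsNoetherian (LocalRingAt p) M := isNoetherian_of_isNoetherianRing_of_finite _ _
  have h2 := Submodule.eq_bot_of_le_smul_of_le_jacobson_bot (maximalIdeal (LocalRingAt p))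
    (maximalIdeal (LocalRingAt p) ^ N • (⊤ : Submodule (LocalRingAt p) M))
    (IsNoetherian.noetherian _) (by rw [← Submodule.mul_smul, ← pow_succ', ← h1])
    (maximalIdeal_le_jacobson _)
  refine ⟨N, fun φ hφ x => ?_⟩
  have := Submodule.smul_mem_smul hφ (Submodule.mem_top (R := LocalRingAt p) (x := x))
  rwa [h2, Submodule.mem_bot] at this

end FiniteDimension

/-! ### The ideal of a germ of a set -/

section VanishingIdeal

variable {n : ℕ} {p : Fin n → ℂ} {S : Set (Fin n → ℂ)}

theorem germ_mem_vanishingIdeal_iff {g : (Fin n → ℂ) → ℂ} (hg : AnalyticAt ℂ g p) :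
    germ p g hg ∈ vanishingIdeal S p ↔ ∀ᶠ x in 𝓝[S] p, g x = 0 := by
  constructor
  · rintro ⟨h, hh, hS⟩
    have e : h =ᶠ[𝓝 p] g := Germ.coe_eq.1 hh
    filter_upwards [hS, e.filter_mono nhdsWithin_le_nhds] with x h1 h2
    rw [← h2, h1]
  · exact fun h => ⟨g, rfl, h⟩

theorem vanishingIdeal_isRadical : (vanishingIdeal S p).IsRadical := by
  rintro φ ⟨N, hN⟩
  obtain ⟨g, hg, rfl⟩ := exists_germ_eq φ
  have h : germ p g hg ^ N = germ p (g ^ N) (hg.pow N) := by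
    rw [← show germHom p ⟨g, hg⟩ = germ p g hg from rfl, ← map_pow]
    rfl
  rw [h, germ_mem_vanishingIdeal_iff] at hN
  rw [germ_mem_vanishingIdeal_iff]
  filter_upwards [hN] with x hx
  exact eq_zero_of_pow_eq_zero hx

theorem vanishingIdeal_le_maximalIdeal (hS : p ∈ S) :
    vanishingIdeal S p ≤ maximalIdeal (LocalRingAt p) := by
  intro φ hφ
  obtain ⟨g, hg, rfl⟩ := exists_germ_eq φ
  rw [mem_maximalIdeal_iff, evalHom_germ]
  exact ((germ_mem_vanishingIdeal_iff hg).1 hφ).self_of_nhdsWithin hS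

theorem vanishingIdeal_anti {T : Set (Fin n → ℂ)} (h : S ⊆ T) :
    vanishingIdeal T p ≤ vanishingIdeal S p := by
  intro φ hφ
  obtain ⟨g, hg, rfl⟩ := exists_germ_eq φ
  rw [germ_mem_vanishingIdeal_iff] at hφ ⊢
  exact hφ.filter_mono (nhdsWithin_mono p h)

/-- The vanishing ideal is radical, hence the intersection of the primes above it. In dimension zero
these are maximal, and by locality all equal the maximal ideal. -/
theorem posDimAt_iff :
    PosDimAt S p ↔ p ∈ S ∧ ¬ maximalIdeal (LocalRingAt p) ≤ vanishingIdeal S p := by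
  refine and_congr_right fun hS => ?_
  have hle := vanishingIdeal_le_maximalIdeal hS
  have : Nontrivial (LocalRingAt p ⧸ vanishingIdeal S p) :=
    Ideal.Quotient.nontrivial_iff.2 fun h =>
      (maximalIdeal.isMaximal (LocalRingAt p)).ne_top (top_le_iff.1 (h ▸ hle))
  rw [dimAt, ← not_le, not_iff_not]
  constructor
  · intro h
    have : Ring.KrullDimLE 0 (LocalRingAt p ⧸ vanishingIdeal S p) := by
      rw [Ring.krullDimLE_iff]
      exact_mod_cast h
    rw [← (vanishingIdeal_isRadical (S := S) (p := p)).radical, Ideal.radical_eq_sInf]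
    refine le_sInf fun P hP => ?_
    have hPprime : P.IsPrime := hP.2
    have hQ : (P.map (Ideal.Quotient.mk (vanishingIdeal S p))).IsPrime :=
      Ideal.map_isPrime_of_surjective Ideal.Quotient.mk_surjective (by
        rw [Ideal.mk_ker]; exact hP.1)
    have hmax := Ideal.IsPrime.isMaximal' hQ
    have h1 : P = (P.map (Ideal.Quotient.mk (vanishingIdeal S p))).comap
        (Ideal.Quotient.mk (vanishingIdeal S p)) := by
      rw [Ideal.comap_map_of_surjective' _ Ideal.Quotient.mk_surjective, Ideal.mk_ker,
        sup_eq_left.2 hP.1]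
    have h2 : P.IsMaximal := by
      rw [h1]
      exact Ideal.comap_isMaximal_of_surjective _ Ideal.Quotient.mk_surjective
    exact (IsLocalRing.eq_maximalIdeal h2).ge
  · intro h
    have h1 : vanishingIdeal S p = maximalIdeal (LocalRingAt p) := le_antisymm hle h
    have h2 : IsField (LocalRingAt p ⧸ vanishingIdeal S p) := by
      rw [← Ideal.Quotient.maximal_ideal_iff_isField_quotient, h1]
      exact maximalIdeal.isMaximal _
    exact (ringKrullDim_eq_zero_of_isField h2).le

end VanishingIdeal

end AnalyticGerm

/-! ### Maximal minors -/

section Minors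

variable {r n : ℕ}

/-- A basis of the column space can be chosen among the columns. -/
theorem Matrix.exists_det_submatrix_ne_zero {K : Type*} [Field K] (A : Matrix (Fin r) (Fin n) K)
    (hA : ¬ A.rank < r) : ∃ s : Fin r → Fin n, (A.submatrix id s).det ≠ 0 := by
  have hr : A.rank = r := le_antisymm A.rank_le_height (not_lt.1 hA)
  rw [Matrix.rank_eq_finrank_span_cols] at hr
  obtain ⟨v, hv, -, hli⟩ := Submodule.exists_fun_fin_finrank_span_eq K (Set.range A.col)
  revert v
  rw [hr]
  intro v hv hli
  choose s hs using hv
  refine ⟨s, ?_⟩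
  have hcol : (A.submatrix id s).col = v := by
    funext k
    rw [← hs k]
    rfl
  rw [← hcol, Matrix.linearIndependent_cols_iff_isUnit, Matrix.isUnit_iff_isUnit_det] at hli
  exact hli.ne_zero

/-- Cramer's rule for the chosen columns, with the solution extended to all `n` coordinates by the
column selection matrix. -/
theorem Matrix.det_submatrix_smul_mem_range {R : Type*} [CommRing R] (J : Matrix (Fin r) (Fin n) R)
    (s : Fin r → Fin n) (v : Fin r → R) :
    (J.submatrix id s).det • v ∈ LinearMap.range J.mulVecLin := by
  refine ⟨((1 : Matrix (Fin n) (Fin n) R).submatrix id s).mulVec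
    ((J.submatrix id s).cramer v), ?_⟩
  rw [Matrix.mulVecLin_apply, Matrix.mulVec_mulVec, ← Matrix.mulVec_cramer]
  congr 1
  ext i k
  simp [Matrix.mul_apply, Matrix.one_apply]

theorem Matrix.le_rank_of_mulVec_eq {K : Type*} [Field K] (A : Matrix (Fin r) (Fin n) K) {c : K}
    (hc : c ≠ 0) (a : Fin r → Fin n → K) (h : ∀ i, A.mulVec (a i) = Pi.single i c) :
    r ≤ A.rank := by
  have htop : LinearMap.range A.mulVecLin = ⊤ := by
    rw [eq_top_iff, ← (Pi.basisFun K (Fin r)).span_eq, Submodule.span_le]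
    rintro _ ⟨i, rfl⟩
    refine ⟨c⁻¹ • a i, ?_⟩
    rw [map_smul, Matrix.mulVecLin_apply, h, ← Pi.single_smul, smul_eq_mul, inv_mul_cancel₀ hc,
      Pi.basisFun_apply]
  rw [Matrix.rank, htop, finrank_top, Module.finrank_fin_fun]

end Minors

namespace AnalyticGerm

open IsLocalRing

/-! ### The cokernel of the Jacobian matrix and the singular locus -/

section SingularLocus

variable {n r : ℕ} {p : Fin n → ℂ} {U : Set (Fin n → ℂ)} {f : Fin r → (Fin n → ℂ) → ℂ}

/-- Evaluation at `x` of functions that are holomorphic near `p`. -/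
def evalAt (p x : Fin n → ℂ) : analyticAtSubring p →+* ℂ :=
  (Pi.evalRingHom (fun _ : Fin n → ℂ => ℂ) x).comp (analyticAtSubring p).subtype

theorem eventually_evalAt_eq {g h : analyticAtSubring p} (e : germHom p g = germHom p h) :
    ∀ᶠ x in 𝓝 p, evalAt p x g = evalAt p x h :=
  (germ_eq_iff g.2 h.2).1 e

/-- That `φ` kills the class of each basis vector gives `J aᵢ = φ eᵢ` modulo the equations.
Evaluated at points of `X` near `p`, this forces `J` to have rank `r` wherever `φ` is nonzero. -/
theorem mem_vanishingIdeal_of_smul_eq_zero (hf : ∀ i, AnalyticAt ℂ (f i) p) {φ : LocalRingAt p}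
    (hφ : ∀ x : jacobianCoker (fun i => germ p (f i) (hf i)), φ • x = 0) :
    φ ∈ vanishingIdeal (singLocus U f) p := by
  obtain ⟨g, hg, rfl⟩ := exists_germ_eq φ
  rw [germ_mem_vanishingIdeal_iff]
  have h1 : ∀ i : Fin r, ∃ a : Fin n → analyticAtSubring p,
      ∀ k, ∀ᶠ x in 𝓝 p, (∀ i, f i x = 0) →
        ∑ j, partialDeriv j (f k) x * evalAt p x (a j) =
          (Pi.single i (g x) : Fin r → ℂ) k := by
    intro i
    have h2 := hφ (Submodule.Quotient.mk (Pi.single i 1))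
    rw [← Submodule.Quotient.mk_smul, Submodule.Quotient.mk_eq_zero] at h2
    obtain ⟨b, hb⟩ := h2
    choose b' hb' using fun j => Ideal.Quotient.mk_surjective (b j)
    choose a ha using fun j => germHom_surjective p (b' j)
    refine ⟨a, fun k => ?_⟩
    have h3 := congrFun hb k
    have h4 : Ideal.Quotient.mk (idealOf fun i => germ p (f i) (hf i))
        (∑ j, germHom p ⟨_, analyticAt_partialDeriv j (hf k)⟩ * germHom p (a j) -
          if k = i then germHom p ⟨g, hg⟩ else 0) = 0 := by
      rw [map_sub, sub_eq_zero, map_sum]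
      simp only [map_mul, ha, hb']
      refine h3.trans ?_
      rw [Pi.smul_apply, Pi.single_apply]
      split_ifs
      · rw [Algebra.smul_def, mul_one]; rfl
      · rw [smul_zero, map_zero]
    rw [Ideal.Quotient.eq_zero_iff_mem] at h4
    obtain ⟨c, hc⟩ := Ideal.mem_span_range_iff_exists_fun.1 h4
    choose c' hc' using fun l => germHom_surjective p (c l)
    -- All finitely many germs are replaced by functions holomorphic near `p`, so the congruence
    -- modulo the ideal becomes an identity at nearby points, where the `f l` can be set to zero.
    have h5 : germHom p (∑ l, c' l * ⟨f l, hf l⟩) = germHom p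
        (∑ j, ⟨_, analyticAt_partialDeriv j (hf k)⟩ * a j - if k = i then ⟨g, hg⟩ else 0) := by
      rw [map_sub, map_sum, map_sum, apply_ite (germHom p), map_zero]
      simp only [map_mul, hc']
      exact hc
    filter_upwards [eventually_evalAt_eq h5] with x hx h0
    rw [map_sub, map_sum, map_sum, apply_ite (evalAt p x), map_zero] at hx
    simp only [map_mul] at hx
    rw [Finset.sum_eq_zero fun l _ => by
      rw [show evalAt p x ⟨f l, hf l⟩ = 0 from h0 l, mul_zero], eq_comm, sub_eq_zero] at hx
    rw [Pi.single_apply]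
    exact hx
  choose a ha using h1
  have h2 : ∀ᶠ x in 𝓝 p, ∀ i k, (∀ i, f i x = 0) →
      ∑ j, partialDeriv j (f k) x * evalAt p x (a i j) = (Pi.single i (g x) : Fin r → ℂ) k := by
    simpa only [eventually_all] using ha
  filter_upwards [h2.filter_mono nhdsWithin_le_nhds, self_mem_nhdsWithin] with x hx hS
  by_contra hne
  refine absurd ((jacobianAt f x).le_rank_of_mulVec_eq hne (fun i j => evalAt p x (a i j))
    fun i => ?_) (not_le.2 hS.2)
  funext k
  exact hx i k hS.1.2

/-- The equations and the maximal minors of `J` have no common zero near `p` except possibly `p`, so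
they generate an ideal containing a power of the maximal ideal. Both kinds of generators annihilate
the cokernel, the minors by Cramer's rule. -/
theorem exists_pow_smul_eq_zero (hU : U ∈ 𝓝 p) (hf : ∀ i, AnalyticAt ℂ (f i) p)
    (hiso : ∀ᶠ x in 𝓝[≠] p, x ∉ singLocus U f) :
    ∃ N : ℕ, ∀ φ ∈ maximalIdeal (LocalRingAt p) ^ N,
      ∀ x : jacobianCoker (fun i => germ p (f i) (hf i)), φ • x = 0 := by
  let D : Matrix (Fin r) (Fin n) (analyticAtSubring p) :=
    Matrix.of fun i j => ⟨partialDeriv j (f i), analyticAt_partialDeriv j (hf i)⟩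
  let g : Fin r ⊕ (Fin r → Fin n) → analyticAtSubring p :=
    Sum.elim (fun i => ⟨f i, hf i⟩) fun s => (D.submatrix id s).det
  have hdet : ∀ s x, evalAt p x (D.submatrix id s).det =
      ((jacobianAt f x).submatrix id s).det := fun s x => by
    rw [RingHom.map_det]
    rfl
  have hrad := le_radical_of_isolated_zero (p := p) (fun i => (g i).1) (fun i => (g i).2) (by
    filter_upwards [hiso, mem_nhdsWithin_of_mem_nhds hU] with x hx hxU
    by_contra! h0
    refine hx ⟨⟨hxU, fun i => h0 (Sum.inl i)⟩, ?_⟩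
    by_contra hlt
    obtain ⟨s, hs⟩ := (jacobianAt f x).exists_det_submatrix_ne_zero hlt
    exact hs ((hdet s x).symm.trans (h0 (Sum.inr s))))
  obtain ⟨N, hN⟩ := Ideal.exists_pow_le_of_le_radical_of_fg hrad (IsNoetherian.noetherian _)
  refine ⟨N, fun φ hφ => ?_⟩
  suffices Ideal.span (Set.range fun i => germ p (g i).1 (g i).2) ≤
      Module.annihilator (LocalRingAt p) (jacobianCoker fun i => germ p (f i) (hf i)) from
    Module.mem_annihilator.1 (this (hN hφ))
  rw [Ideal.span_le]
  rintro _ ⟨i, rfl⟩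
  refine Module.mem_annihilator.2 fun x => ?_
  rw [← algebraMap_smul (LocalRingAt p ⧸ idealOf fun i => germ p (f i) (hf i)),
    Ideal.Quotient.algebraMap_eq]
  rcases i with i | s
  · have h0 : germ p (g (Sum.inl i)).1 (g (Sum.inl i)).2 ∈ idealOf fun i => germ p (f i) (hf i) :=
      Ideal.subset_span ⟨i, rfl⟩
    rw [Ideal.Quotient.eq_zero_iff_mem.2 h0, zero_smul]
  · obtain ⟨v, rfl⟩ := Submodule.Quotient.mk_surjective _ x
    rw [← Submodule.Quotient.mk_smul, Submodule.Quotient.mk_eq_zero]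
    have h1 : Ideal.Quotient.mk (idealOf fun i => germ p (f i) (hf i))
        (germHom p (D.submatrix id s).det) =
          ((jacobianGerm fun i => germ p (f i) (hf i)).submatrix id s).det := by
      rw [RingHom.map_det, RingHom.map_det]
      rfl
    change Ideal.Quotient.mk _ (germHom p (D.submatrix id s).det) • v ∈ _
    rw [h1]
    exact Matrix.det_submatrix_smul_mem_range _ s v

/-- If the germs vanishing on a set contain the maximal ideal, then the point is isolated. -/
theorem eventually_notMem_of_maximalIdeal_le {S : Set (Fin n → ℂ)}
    (h : maximalIdeal (LocalRingAt p) ≤ vanishingIdeal S p) : ∀ᶠ x in 𝓝[≠] p, x ∉ S := by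
  have h1 : ∀ j : Fin n, ∀ᶠ x in 𝓝[S] p, x j - p j = 0 := by
    intro j
    have ha : AnalyticAt ℂ (fun x : Fin n → ℂ => x j - p j) p :=
      (analyticAt_coord j p).sub analyticAt_const
    refine (germ_mem_vanishingIdeal_iff ha).1 (h ?_)
    rw [mem_maximalIdeal_iff, evalHom_germ, sub_self]
  have h2 : ∀ᶠ x in 𝓝[S] p, x = p := by
    filter_upwards [eventually_all.2 h1] with x hx
    exact funext fun j => sub_eq_zero.1 (hx j)
  rw [eventually_nhdsWithin_iff] at h2 ⊢
  filter_upwards [h2] with x hx hne hS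
  exact hne (hx hS)

/-- A maximal minor that is nonzero at `p` stays nonzero nearby. -/
theorem eventually_notMem_singLocus (hU : U ∈ 𝓝 p) (hf : ∀ i, AnalyticAt ℂ (f i) p)
    (hX : ∀ i, f i p = 0) (hp : p ∉ singLocus U f) : ∀ᶠ x in 𝓝 p, x ∉ singLocus U f := by
  have hrank : ¬ (jacobianAt f p).rank < r := fun h => hp ⟨⟨mem_of_mem_nhds hU, hX⟩, h⟩
  obtain ⟨s, hs⟩ := (jacobianAt f p).exists_det_submatrix_ne_zero hrank
  have hcont : ContinuousAt (fun x => ((jacobianAt f x).submatrix id s).det) p := by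
    have hdet : Continuous (Matrix.det : Matrix (Fin r) (Fin r) ℂ → ℂ) := continuous_id.matrix_det
    refine hdet.continuousAt.comp ?_
    refine continuousAt_pi.2 fun i => continuousAt_pi.2 fun k => ?_
    exact (analyticAt_partialDeriv (s k) (hf i)).continuousAt
  filter_upwards [hcont.eventually_ne hs] with x hx hS
  have hunit : IsUnit ((jacobianAt f x).submatrix id s) := by
    rw [Matrix.isUnit_iff_isUnit_det]
    exact hx.isUnit
  have h1 := Matrix.rank_of_isUnit _ hunit
  have h2 : ((jacobianAt f x).submatrix id s).rank ≤ (jacobianAt f x).rank := by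
    have : (jacobianAt f x).submatrix id s =
        jacobianAt f x * (1 : Matrix (Fin n) (Fin n) ℂ).submatrix id s := by
      ext i k
      simp [Matrix.mul_apply, Matrix.one_apply]
    rw [this]
    exact Matrix.rank_mul_le_left _ _
  rw [h1, Fintype.card_fin] at h2
  exact not_lt.2 h2 hS.2

theorem finite_jacobianCoker_iff (hU : U ∈ 𝓝 p) (hf : ∀ i, AnalyticAt ℂ (f i) p)
    (hX : ∀ i, f i p = 0) : ¬ Module.Finite ℂ (jacobianCoker fun i => germ p (f i) (hf i)) ↔
      PosDimAt (singLocus U f) p := by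
  rw [posDimAt_iff, finite_complex_iff (p := p), ← not_iff_not, not_not]
  constructor
  · rintro ⟨N, hN⟩ ⟨-, h⟩
    refine h fun φ hφ => vanishingIdeal_isRadical ⟨N, ?_⟩
    exact mem_vanishingIdeal_of_smul_eq_zero hf (hN _ (Ideal.pow_mem_pow hφ N))
  · intro h
    refine exists_pow_smul_eq_zero hU hf ?_
    -- Failure of positive dimension has two causes: `p` is isolated in the singular locus, or it is
    -- a smooth point.
    by_cases hp : p ∈ singLocus U f
    · exact eventually_notMem_of_maximalIdeal_le (not_not.1 fun h' => h ⟨hp, h'⟩)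
    · exact (eventually_notMem_singLocus hU hf hX hp).filter_mono nhdsWithin_le_nhds

/-- If the cokernel were zero, the germ `1` would kill it and hence vanish on the singular locus, in
particular at `p`. -/
theorem nontrivial_jacobianCoker (hf : ∀ i, AnalyticAt ℂ (f i) p) (hp : p ∈ singLocus U f) :
    Nontrivial (jacobianCoker fun i => germ p (f i) (hf i)) := by
  by_contra h
  rw [not_nontrivial_iff_subsingleton] at h
  have h1 : (1 : LocalRingAt p) ∈ vanishingIdeal (singLocus U f) p :=
    mem_vanishingIdeal_of_smul_eq_zero hf fun x => Subsingleton.elim _ _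
  have h2 := (mem_maximalIdeal_iff _).1 (vanishingIdeal_le_maximalIdeal hp h1)
  rw [map_one] at h2
  exact one_ne_zero h2

end SingularLocus

end AnalyticGerm

/-! ### Derivations of algebraic extensions and their constants -/

section Constants

open Polynomial

theorem derivation_int_mul {R : Type*} [CommRing R] (D : Derivation ℤ R R) (x y : R) :
    D (x * y) = x * D y + y * D x := D.leibniz x y

/-- In characteristic zero, derivations extend along algebraic extensions. -/
theorem exists_derivation_extension {A κ : Type*} [CommRing A] [IsDomain A] [CharZero A] [Field κ]
    [Algebra A κ] [Algebra.IsAlgebraic A κ] (hinj : Function.Injective (algebraMap A κ))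
    (D : Derivation ℤ A A) :
    ∃ D' : Derivation ℤ κ κ, ∀ a, D' (algebraMap A κ a) = algebraMap A κ (D a) := by
  -- A derivation is a ring map `a ↦ a + ε D a` into the dual numbers. Extending it means lifting
  -- `κ` through the square-zero thickening, with the dual numbers regarded as an `A`-algebra by
  -- this map.
  let ρ : A →+* TrivSqZeroExt κ κ :=
    { toFun := fun a => TrivSqZeroExt.inl (algebraMap A κ a) +
        TrivSqZeroExt.inr (algebraMap A κ (D a))
      map_one' := by ext <;> simp
      map_zero' := by ext <;> simp
      map_add' := fun a b => by ext <;> simp [Algebra.smul_def]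
      map_mul' := fun a b => by
        ext
        · simp
        · simp only [map_mul, Derivation.leibniz, smul_eq_mul, map_add, TrivSqZeroExt.snd_mul,
            TrivSqZeroExt.snd_add, TrivSqZeroExt.fst_add, TrivSqZeroExt.snd_inl,
            TrivSqZeroExt.snd_inr, TrivSqZeroExt.fst_inl, TrivSqZeroExt.fst_inr, zero_add, add_zero,
            op_smul_eq_smul] }
  let : Algebra A (TrivSqZeroExt κ κ) := ρ.toAlgebra
  let π : TrivSqZeroExt κ κ →ₐ[A] κ :=
    { (TrivSqZeroExt.fstHom ℤ κ κ : TrivSqZeroExt κ κ →+* κ) with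
      commutes' := fun a => by
        change (ρ a).fst = _
        simp [ρ] }
  have hker : IsNilpotent (RingHom.ker (π : TrivSqZeroExt κ κ →+* κ)) := by
    refine RingHom.isNilpotent_ker_of_mul_eq_zero _ fun x y hx hy => ?_
    have hx' : x.fst = 0 := hx
    have hy' : y.fst = 0 := hy
    ext <;> simp [hx', hy']
  obtain ⟨σ, hσ⟩ := exists_algHom_section π
    (fun x => ⟨TrivSqZeroExt.inl x, rfl⟩) hker hinj
  refine ⟨Derivation.mk' (AddMonoidHom.toIntLinearMap
    { toFun := fun x => (σ x).snd
      map_zero' := by simp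
      map_add' := fun x y => by simp }) fun x y => ?_, fun a => ?_⟩
  · change (σ (x * y)).snd = x * (σ y).snd + y * (σ x).snd
    have hx : (σ x).fst = x := hσ x
    have hy : (σ y).fst = y := hσ y
    simp [hx, hy, mul_comm]
  · change (σ (algebraMap A κ a)).snd = _
    rw [σ.commutes]
    change (TrivSqZeroExt.inl (algebraMap A κ a) +
      TrivSqZeroExt.inr (algebraMap A κ (D a)) : TrivSqZeroExt κ κ).snd = _
    rw [TrivSqZeroExt.snd_add, TrivSqZeroExt.snd_inl, TrivSqZeroExt.snd_inr, zero_add]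

/-- Differentiating the minimal equation of a constant `b` shows that the polynomial with
differentiated coefficients also has root `b`. Monicity lowers its degree, so it is zero. -/
theorem derivation_coeff_minpoly_eq_zero {K κ : Type*} [Field K] [Field κ] [Algebra K κ]
    (D : Derivation ℤ K K) (D' : Derivation ℤ κ κ)
    (hD : ∀ a, D' (algebraMap K κ a) = algebraMap K κ (D a)) {b : κ} (hb : IsIntegral K b)
    (h0 : D' b = 0) (i : ℕ) : D ((minpoly K b).coeff i) = 0 := by
  let : Differential K := ⟨D⟩
  let : Differential κ := ⟨D'⟩
  have : DifferentialAlgebra K κ := ⟨hD⟩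
  have h1 := Differential.deriv_aeval_eq b (minpoly K b)
  have h2 : Differential.deriv b = 0 := h0
  rw [minpoly.aeval, map_zero, h2, mul_zero, add_zero] at h1
  have hmonic := minpoly.monic hb
  have h3 : (Differential.mapCoeffs (minpoly K b)).degree < (minpoly K b).degree := by
    rw [degree_eq_natDegree hmonic.ne_zero, degree_lt_iff_coeff_zero]
    intro m hm
    rw [Differential.coeff_mapCoeffs]
    rcases eq_or_lt_of_le hm with rfl | hm
    · rw [coeff_natDegree, hmonic.leadingCoeff, Derivation.map_one_eq_zero]
    · rw [coeff_eq_zero_of_natDegree_lt hm, map_zero]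
  have h4 := eq_zero_of_dvd_of_degree_lt (minpoly.dvd K b h1.symm) h3
  have h5 := congrArg (fun q => q.coeff i) h4
  exact h5.trans (coeff_zero i)

/-- If the common constants of a family of derivations of the fraction field of `A` lie in an
algebraically closed field `k`, then so do those of an algebraic extension. -/
theorem exists_derivations_extension {k A κ ι : Type*} [Field k] [IsAlgClosed k] [CommRing A]
    [IsDomain A] [CharZero A] [Algebra k A] [Field κ] [Algebra A κ] [Algebra.IsAlgebraic A κ]
    (hinj : Function.Injective (algebraMap A κ)) (D : ι → Derivation ℤ A A)
    (hD : ∀ u v : A, v ≠ 0 → (∀ i, v * D i u = u * D i v) → ∃ c : k, u = algebraMap k A c * v) :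
    ∃ D' : ι → Derivation ℤ κ κ, (∀ i a, D' i (algebraMap A κ a) = algebraMap A κ (D i a)) ∧
      ∀ b, (∀ i, D' i b = 0) → ∃ c : k, b = algebraMap A κ (algebraMap k A c) := by
  let K := FractionRing A
  have : FaithfulSMul A κ := (faithfulSMul_iff_algebraMap_injective _ _).2 hinj
  let : Algebra K κ := FractionRing.liftAlgebra A κ
  have : IsScalarTower A K κ := FractionRing.isScalarTower_liftAlgebra A κ
  have : Algebra.IsAlgebraic A K := IsLocalization.isAlgebraic _ (nonZeroDivisors A)
  have : Algebra.IsAlgebraic K κ := IsFractionRing.comap_isAlgebraic_iff.1 ‹_›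
  have hAK : Function.Injective (algebraMap A K) := IsFractionRing.injective A K
  have : CharZero K := charZero_of_injective_algebraMap hAK
  choose DK hDK using fun i => exists_derivation_extension hAK (D i)
  choose D' hD' using fun i =>
    exists_derivation_extension (algebraMap K κ).injective (DK i)
  have hleib : ∀ i x y, DK i (x * y) = x * DK i y + y * DK i x := fun i x y =>
    derivation_int_mul (DK i) x y
  refine ⟨D', fun i a => ?_, fun b hb => ?_⟩
  · rw [IsScalarTower.algebraMap_apply A K κ, hD', hDK, ← IsScalarTower.algebraMap_apply]
  -- For a fraction `u / v` the quotient rule turns vanishing of all derivatives into the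
  -- cross-multiplied hypothesis on `A`.
  have hconst : ∀ x : K, (∀ i, DK i x = 0) → ∃ c : k, algebraMap A K (algebraMap k A c) = x := by
    intro x hx
    obtain ⟨u, v, hv, rfl⟩ := IsFractionRing.div_surjective (A := A) x
    have hv0 : v ≠ 0 := nonZeroDivisors.ne_zero hv
    have hv1 : algebraMap A K v ≠ 0 := (map_ne_zero_iff _ hAK).2 hv0
    have h1 : ∀ i, v * D i u = u * D i v := by
      intro i
      have h2 : DK i (algebraMap A K u) = algebraMap A K u / algebraMap A K v *
          DK i (algebraMap A K v) := by
        conv_lhs => rw [← div_mul_cancel₀ (algebraMap A K u) hv1]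
        rw [hleib, hx, mul_zero, add_zero]
      rw [hDK, hDK] at h2
      apply hAK
      rw [map_mul, map_mul, h2, ← mul_assoc, mul_div_cancel₀ _ hv1]
    obtain ⟨c, rfl⟩ := hD u v hv0 h1
    exact ⟨c, by rw [map_mul, mul_div_cancel_right₀ _ hv1]⟩
  have hint : IsIntegral K b := (Algebra.IsAlgebraic.isAlgebraic b).isIntegral
  -- The minimal polynomial of a constant has constant coefficients, so it comes from `k`, splits
  -- there, and its root `b` comes from `k` too.
  have hlift : minpoly K b ∈ lifts ((algebraMap A K).comp (algebraMap k A)) := by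
    rw [lifts_iff_coeff_lifts]
    exact fun m => hconst _ fun i => derivation_coeff_minpoly_eq_zero (DK i) (D' i) (hD' i) hint
      (hb i) m
  obtain ⟨q, hq⟩ := (mem_lifts _).1 hlift
  have hq0 : q ≠ 0 := by
    rintro rfl
    rw [Polynomial.map_zero] at hq
    exact minpoly.ne_zero hint hq.symm
  let j : k →+* κ := (algebraMap K κ).comp ((algebraMap A K).comp (algebraMap k A))
  have hroot : b ∈ (q.map j).roots := by
    rw [mem_roots (Polynomial.map_ne_zero hq0), IsRoot, ← Polynomial.map_map, hq, eval_map_algebraMap,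
      minpoly.aeval]
  rw [(IsAlgClosed.splits q).roots_map, Multiset.mem_map] at hroot
  obtain ⟨c, -, hc⟩ := hroot
  exact ⟨c, by rw [← hc, IsScalarTower.algebraMap_apply A K κ]; rfl⟩

end Constants

/-! ### Germs with all derivatives in a prime ideal -/

namespace AnalyticGerm

open IsLocalRing

variable {n : ℕ} {p : Fin n → ℂ}

/-- A quotient of germs of holomorphic functions all of whose derivatives vanish is constant. -/
theorem exists_eq_const_mul {u v : LocalRingAt p} (hv : v ≠ 0)
    (h : ∀ j, v * pderiv j u = u * pderiv j v) : ∃ c : ℂ, u = algebraMap ℂ _ c * v := by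
  obtain ⟨a, ha, rfl⟩ := exists_germ_eq u
  obtain ⟨b, hb, rfl⟩ := exists_germ_eq v
  have h1 : ∀ j, ∀ᶠ x in 𝓝 p, b x * partialDeriv j a x = a x * partialDeriv j b x := fun j =>
    (germ_eq_iff (hb.mul (analyticAt_partialDeriv j ha))
      (ha.mul (analyticAt_partialDeriv j hb))).1 (h j)
  obtain ⟨ρ, hρ, hball⟩ := Metric.eventually_nhds_iff_ball.1
    ((eventually_all.2 h1).and (ha.eventually_analyticAt.and hb.eventually_analyticAt))
  obtain ⟨y, hy, hby⟩ : ∃ y ∈ Metric.ball p ρ, b y ≠ 0 := by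
    by_contra! hcon
    exact hv ((germ_eq_zero_iff hb).2 (mem_of_superset (Metric.ball_mem_nhds p hρ) hcon))
  obtain ⟨δ, hδ, hsub⟩ := Metric.eventually_nhds_iff_ball.1
    (((hball y hy).2.2.continuousAt.eventually_ne hby).and (Metric.isOpen_ball.mem_nhds hy))
  have hw : ∀ x ∈ Metric.ball y δ, AnalyticAt ℂ (fun z => a z / b z) x := fun x hx =>
    (hball x (hsub x hx).2).2.1.div (hball x (hsub x hx).2).2.2 (hsub x hx).1
  -- Near a point `y` where `b` is nonzero the quotient `a / b` has zero derivative; the identity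
  -- theorem then carries the proportionality back to `p`.
  have hderiv : (Metric.ball y δ).EqOn (fderiv ℂ fun z => a z / b z) 0 := by
    intro x hx
    obtain ⟨hbx, hxρ⟩ := hsub x hx
    refine ContinuousLinearMap.coe_inj.1 (LinearMap.pi_ext' fun j => LinearMap.ext_ring ?_)
    change partialDeriv j (fun z => a z / b z) x = 0
    have h2 : a =ᶠ[𝓝 x] b * fun z => a z / b z := by
      filter_upwards [(hball x hxρ).2.2.continuousAt.eventually_ne hbx] with z hz
      exact (mul_div_cancel₀ (a z) hz).symm
    have h3 := (partialDeriv_congr j h2).self_of_nhds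
    rw [partialDeriv_mul j (hball x hxρ).2.2 (hw x hx)] at h3
    have h4 := (hball x hxρ).1 j
    rw [h3] at h4
    have h5 : b x * b x * partialDeriv j (fun z => a z / b z) x = 0 := by
      field_simp at h4
      linear_combination h4
    exact (mul_eq_zero.1 h5).resolve_left (mul_ne_zero hbx hbx)
  refine ⟨a y / b y, ?_⟩
  have hd : AnalyticOnNhd ℂ (fun z => a z - a y / b y * b z) (Metric.ball p ρ) := fun x hx =>
    (hball x hx).2.1.sub (analyticAt_const.mul (hball x hx).2.2)
  have hzero := hd.eqOn_zero_of_preconnected_of_eventuallyEq_zero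
    (convex_ball p ρ).isPreconnected hy (by
      filter_upwards [Metric.ball_mem_nhds y hδ] with x hx
      have h6 : a x / b x = a y / b y :=
        Metric.isOpen_ball.is_const_of_fderiv_eq_zero (convex_ball y δ).isPreconnected
          (fun z hz => (hw z hz).differentiableAt.differentiableWithinAt) hderiv hx
          (Metric.mem_ball_self hδ)
      change a x - a y / b y * b x = 0
      rw [← h6, div_mul_cancel₀ _ (hsub x hx).1, sub_self])
  refine (germ_eq_iff ha (analyticAt_const.mul hb)).2 ?_
  filter_upwards [Metric.ball_mem_nhds p hρ] with x hx
  exact sub_eq_zero.1 (hzero hx)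

/-- A germ whose partial derivatives lie in a prime ideal is constant modulo that ideal. -/
theorem exists_sub_const_mem (P : Ideal (LocalRingAt p)) [P.IsPrime] {φ : LocalRingAt p}
    (hφ : ∀ j, pderiv j φ ∈ P) : ∃ c : ℂ, φ - algebraMap ℂ _ c ∈ P := by
  obtain ⟨d, f, hinj, hfin⟩ := exists_noether (Ideal.Quotient.mk P) Ideal.Quotient.mk_surjective
  let A := LocalRingAt (0 : Fin d → ℂ)
  have : IsDomain A := Function.Injective.isDomain _ hinj
  let : Algebra A (LocalRingAt p ⧸ P) := ((Ideal.Quotient.mk P).comp (f : A →+* _)).toAlgebra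
  have hfinite : Module.Finite A (LocalRingAt p ⧸ P) := hfin
  let : Algebra A P.ResidueField :=
    ((algebraMap (LocalRingAt p) P.ResidueField).comp (f : A →+* _)).toAlgebra
  have : IsScalarTower A (LocalRingAt p ⧸ P) P.ResidueField :=
    IsScalarTower.of_algebraMap_eq fun a => by
      change algebraMap (LocalRingAt p) P.ResidueField (f a) = algebraMap (LocalRingAt p ⧸ P) _
        (algebraMap (LocalRingAt p) (LocalRingAt p ⧸ P) (f a))
      rw [← IsScalarTower.algebraMap_apply]
  have : FaithfulSMul A (LocalRingAt p ⧸ P) := (faithfulSMul_iff_algebraMap_injective _ _).2 hinj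
  have : Algebra.IsAlgebraic (LocalRingAt p ⧸ P) P.ResidueField :=
    IsLocalization.isAlgebraic _ (nonZeroDivisors (LocalRingAt p ⧸ P))
  have : Algebra.IsAlgebraic A P.ResidueField :=
    Algebra.IsAlgebraic.trans A (LocalRingAt p ⧸ P) P.ResidueField
  have hAκ : Function.Injective (algebraMap A P.ResidueField) := by
    rw [IsScalarTower.algebraMap_eq A (LocalRingAt p ⧸ P) P.ResidueField]
    exact (IsFractionRing.injective (LocalRingAt p ⧸ P) P.ResidueField).comp hinj
  -- The partial derivatives of the Noether normalization extend to the residue field of `P` without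
  -- acquiring constants outside `ℂ`. It remains to see that they kill the class of `φ`.
  obtain ⟨D, hD, hconst⟩ := exists_derivations_extension (k := ℂ) hAκ
    (fun k => (pderivation (0 : Fin d → ℂ) k).restrictScalars ℤ) fun u v hv h =>
      exists_eq_const_mul hv h
  let q : LocalRingAt p →+* P.ResidueField := algebraMap (LocalRingAt p) P.ResidueField
  have hqf : ∀ k a, D k (q (f a)) = q (f (pderiv k a)) := hD
  have hleib : ∀ k x y, D k (x * y) = x * D k y + y * D k x := fun k x y =>
    derivation_int_mul (D k) x y
  have hqsmul : ∀ ψ (x : P.ResidueField), ψ • x = q ψ * x := fun ψ x => Algebra.smul_def ψ x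
  have hqP : ∀ ψ ∈ P, q ψ = 0 := fun ψ hψ => Ideal.algebraMap_residueField_eq_zero.2 hψ
  suffices h0 : ∀ k, D k (q φ) = 0 by
    obtain ⟨c, hc⟩ := hconst (q φ) h0
    refine ⟨c, Ideal.algebraMap_residueField_eq_zero.1 ?_⟩
    change q (φ - _) = 0
    rw [map_sub, hc, sub_eq_zero, ← f.commutes]
    rfl
  intro k
  let δ : Derivation ℂ (LocalRingAt p) P.ResidueField := Derivation.mk'
    { toFun := fun ψ => D k (q ψ)
      map_add' := fun ψ χ => by rw [map_add, map_add]
      map_smul' := fun c ψ => by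
        rw [Algebra.smul_def, map_mul, hleib, ← f.commutes, hqf, pderiv_algebraMap,
          map_zero, map_zero, mul_zero, add_zero, f.commutes, RingHom.id_apply,
          ← algebraMap_smul (LocalRingAt p) c, hqsmul] }
    fun ψ χ => by
      change D k (q (ψ * χ)) = ψ • D k (q χ) + χ • D k (q ψ)
      rw [map_mul, hleib, hqsmul, hqsmul]
  have hδ : ∀ ψ, δ ψ = D k (q ψ) := fun ψ => rfl
  obtain ⟨s, hs⟩ := hfinite.fg_top
  let e : LocalRingAt p ⧸ P → LocalRingAt p := Function.surjInv Ideal.Quotient.mk_surjective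
  have he : ∀ b, Ideal.Quotient.mk P (e b) = b :=
    Function.surjInv_eq Ideal.Quotient.mk_surjective
  -- The chain rule `derivation_eq_sum` needs finitely generated values. Here `δ` is not `A`-linear,
  -- so the span of `1` is added to absorb the terms where `δ` falls on elements of `A`.
  let M : Submodule (LocalRingAt p) P.ResidueField :=
    Submodule.span _ ((fun b => δ (e b)) '' (s : Set (LocalRingAt p ⧸ P))) ⊔
      Submodule.span _ {1}
  have hM : M.FG := Submodule.FG.sup (Submodule.fg_span (s.finite_toSet.image _))
    (Submodule.fg_span_singleton _)
  have hqM : ∀ ψ, q ψ ∈ M := fun ψ => Submodule.mem_sup_right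
    (Submodule.mem_span_singleton.2 ⟨ψ, by rw [Algebra.smul_def, mul_one]⟩)
  have hrep : ∀ b ∈ Submodule.span A (s : Set (LocalRingAt p ⧸ P)), ∀ ψ,
      Ideal.Quotient.mk P ψ = b → δ ψ ∈ M := by
    have hred : ∀ ψ χ, Ideal.Quotient.mk P ψ = Ideal.Quotient.mk P χ → δ χ ∈ M → δ ψ ∈ M := by
      intro ψ χ h hχ
      have h1 := hqP _ (Ideal.Quotient.eq.1 h)
      rw [map_sub, sub_eq_zero] at h1
      rwa [hδ, h1]
    intro b hb
    induction hb using Submodule.span_induction with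
    | mem b hb =>
      intro ψ hψ
      exact hred ψ (e b) (hψ.trans (he b).symm)
        (Submodule.mem_sup_left (Submodule.subset_span ⟨b, hb, rfl⟩))
    | zero =>
      intro ψ hψ
      exact hred ψ 0 (hψ.trans (map_zero _).symm) (by rw [map_zero]; exact zero_mem _)
    | add b c _ _ hb hc =>
      intro ψ hψ
      refine hred ψ (e b + e c) (by rw [hψ, map_add, he, he]) ?_
      rw [map_add]
      exact add_mem (hb _ (he b)) (hc _ (he c))
    | smul a b _ hb =>
      intro ψ hψ
      refine hred ψ (f a * e b) (by rw [hψ, map_mul, he]; rfl) ?_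
      rw [Derivation.leibniz]
      refine add_mem (M.smul_mem _ (hb _ (he b))) (M.smul_mem _ ?_)
      rw [hδ, hqf]
      exact hqM _
  have hδM : ∀ ψ, δ ψ ∈ M := fun ψ => hrep _ (hs ▸ Submodule.mem_top) ψ rfl
  rw [← hδ, derivation_eq_sum δ M hM hδM φ]
  refine Finset.sum_eq_zero fun j _ => ?_
  rw [hqsmul, hqP _ (hφ j), zero_mul]

end AnalyticGerm

/-- A linear equivalence over `R`, as one over `k` on the restriction of scalars. -/
def RestrictScalars.linearEquivOfTower (k : Type*) {R M N : Type*} [CommSemiring k] [Semiring R]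
    [Algebra k R] [AddCommMonoid M] [Module R M] [AddCommMonoid N] [Module R N] [Module k N]
    [IsScalarTower k R N] (e : M ≃ₗ[R] N) : RestrictScalars k R M ≃ₗ[k] N :=
  { (RestrictScalars.addEquiv k R M).trans e.toAddEquiv with
    map_smul' := fun c x => by
      change e (RestrictScalars.addEquiv k R M (c • x)) = c • e (RestrictScalars.addEquiv k R M x)
      rw [RestrictScalars.addEquiv_map_smul, map_smul, algebraMap_smul] }

namespace AnalyticGerm

open IsLocalRing

/-! ### Hypersurfaces -/

section Hypersurface

variable {n : ℕ} {p : Fin n → ℂ} {U : Set (Fin n → ℂ)} {f : (Fin n → ℂ) → ℂ}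

/-- With a single row, the cokernel is cyclic, generated by the class of `1`; the germs that die in
it are those in the ideal of `F 0` and its partials. -/
theorem nonempty_jacobianCoker_linearEquiv (F : Fin 1 → LocalRingAt p) :
    Nonempty (jacobianCoker F ≃ₗ[LocalRingAt p] LocalRingAt p ⧸ tjurinaIdeal (F 0)) := by
  let L : LocalRingAt p →ₗ[LocalRingAt p] jacobianCoker F :=
    ((LinearMap.range (jacobianGerm F).mulVecLin).mkQ.restrictScalars (LocalRingAt p)) ∘ₗ
      LinearMap.pi fun _ => Algebra.linearMap (LocalRingAt p) (LocalRingAt p ⧸ idealOf F)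
  have hL : ∀ φ, L φ = 0 ↔ ∃ w : Fin n → LocalRingAt p ⧸ idealOf F,
      ∑ j, Ideal.Quotient.mk (idealOf F) (pderiv j (F 0)) * w j =
        Ideal.Quotient.mk (idealOf F) φ := by
    intro φ
    refine (Submodule.Quotient.mk_eq_zero _).trans ⟨?_, ?_⟩
    · rintro ⟨w, hw⟩
      exact ⟨w, congrFun hw 0⟩
    · rintro ⟨w, hw⟩
      refine ⟨w, funext fun i => ?_⟩
      rw [Subsingleton.elim i 0]
      exact hw
  have hsurj : Function.Surjective L := by
    refine (Submodule.mkQ_surjective _).comp fun v => ?_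
    obtain ⟨φ, hφ⟩ := Ideal.Quotient.mk_surjective (v 0)
    refine ⟨φ, funext fun i => ?_⟩
    rw [Subsingleton.elim i 0]
    exact hφ
  have hF : F 0 ∈ tjurinaIdeal (F 0) := Ideal.subset_span (Or.inl rfl)
  have hdF : ∀ j, pderiv j (F 0) ∈ tjurinaIdeal (F 0) := fun j =>
    Ideal.subset_span (Or.inr ⟨j, rfl⟩)
  have hker : LinearMap.ker L = tjurinaIdeal (F 0) := by
    apply le_antisymm
    · intro φ hφ
      obtain ⟨w, hw⟩ := (hL φ).1 hφ
      choose c hc using fun j => Ideal.Quotient.mk_surjective (w j)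
      have h1 : ∑ j, pderiv j (F 0) * c j - φ ∈ idealOf F := by
        rw [← Ideal.Quotient.eq_zero_iff_mem, map_sub, map_sum, sub_eq_zero, ← hw]
        simp only [map_mul, hc]
      have h2 : idealOf F ≤ tjurinaIdeal (F 0) := by
        refine Ideal.span_le.2 ?_
        rintro _ ⟨i, rfl⟩
        rw [Subsingleton.elim i 0]
        exact hF
      have h3 : ∑ j, pderiv j (F 0) * c j ∈ tjurinaIdeal (F 0) :=
        sum_mem fun j _ => Ideal.mul_mem_right _ _ (hdF j)
      simpa using sub_mem h3 (h2 h1)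
    · refine Ideal.span_le.2 ?_
      rintro _ (rfl | ⟨j, rfl⟩)
      · have h0 : F 0 ∈ idealOf F := Ideal.subset_span ⟨0, rfl⟩
        exact (hL _).2 ⟨0, by simp [Ideal.Quotient.eq_zero_iff_mem.2 h0]⟩
      · refine (hL _).2 ⟨Pi.single j 1, ?_⟩
        simp [Pi.single_apply]
  exact ⟨((Submodule.quotEquivOfEq _ _ hker.symm).trans
    (L.quotKerEquivOfSurjective hsurj)).symm⟩

theorem singLocus_subset_criticalLocus (f : Fin 1 → (Fin n → ℂ) → ℂ) :
    singLocus U f ⊆ criticalLocus U (f 0) := by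
  rintro x ⟨⟨hxU, -⟩, hr⟩
  refine ⟨hxU, fun j => ?_⟩
  by_contra hne
  refine absurd ((jacobianAt f x).le_rank_of_mulVec_eq hne (fun _ => Pi.single j 1)
    fun i => ?_) (not_le.2 hr)
  funext k
  rw [Subsingleton.elim k 0, Subsingleton.elim i 0]
  simp [jacobianAt]

/-- If the Tjurina algebra is finite dimensional, then so is the Milnor algebra. -/
theorem maximalIdeal_le_radical_span_pderiv {φ : LocalRingAt p}
    (hφ : φ ∈ maximalIdeal (LocalRingAt p)) {N : ℕ}
    (hN : maximalIdeal (LocalRingAt p) ^ N ≤ tjurinaIdeal φ) :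
    maximalIdeal (LocalRingAt p) ≤ (Ideal.span (Set.range fun j => pderiv j φ)).radical := by
  rw [Ideal.radical_eq_sInf]
  refine le_sInf fun P ⟨hP, hPprime⟩ => ?_
  have hdP : ∀ j, pderiv j φ ∈ P := fun j => hP (Ideal.subset_span ⟨j, rfl⟩)
  obtain ⟨c, hc⟩ := exists_sub_const_mem P hdP
  -- Both `φ` and the primes in question lie in the maximal ideal, so the constant has value zero at
  -- `p`.
  have hc0 : c = 0 := by
    have h1 := sub_mem hφ (le_maximalIdeal hPprime.ne_top hc)
    rw [sub_sub_cancel, mem_maximalIdeal_iff, AlgHom.commutes] at h1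
    exact h1
  rw [hc0, map_zero, sub_zero] at hc
  have h2 : tjurinaIdeal φ ≤ P := by
    refine Ideal.span_le.2 ?_
    rintro _ (rfl | ⟨j, rfl⟩)
    · exact hc
    · exact hdP j
  exact fun ψ hψ => hPprime.mem_of_pow_mem N (h2 (hN (Ideal.pow_mem_pow hψ N)))

/-- The partials alone already generate an ideal whose radical contains the maximal ideal, and they
vanish on the critical locus. -/
theorem not_posDimAt_criticalLocus (hf : AnalyticAt ℂ f p) (h0 : f p = 0)
    (hfin : Module.Finite ℂ (LocalRingAt p ⧸ tjurinaIdeal (germ p f hf))) :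
    ¬ PosDimAt (criticalLocus U f) p := by
  rw [posDimAt_iff]
  rintro ⟨-, h⟩
  obtain ⟨N, hN⟩ := (finite_complex_iff (p := p)).1 hfin
  have hle : maximalIdeal (LocalRingAt p) ^ N ≤ tjurinaIdeal (germ p f hf) := by
    intro φ hφ
    have h1 := hN φ hφ 1
    rwa [Algebra.smul_def, mul_one, Ideal.Quotient.algebraMap_eq,
      Ideal.Quotient.eq_zero_iff_mem] at h1
  refine h ((maximalIdeal_le_radical_span_pderiv ((mem_maximalIdeal_iff _).2 ?_) hle).trans ?_)
  · rw [evalHom_germ, h0]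
  · rw [vanishingIdeal_isRadical.radical_le_iff, Ideal.span_le]
    rintro _ ⟨j, rfl⟩
    refine (germ_mem_vanishingIdeal_iff (analyticAt_partialDeriv j hf)).2 ?_
    filter_upwards [self_mem_nhdsWithin] with x hx
    exact hx.2 j

end Hypersurface

end AnalyticGerm

end

/-! ### Assembly of the four statements -/

open AnalyticGerm in
theorem theorem3p4 {n r : ℕ} (U : Set (Fin n → ℂ)) (hU : IsOpen U)
    (f : Fin r → (Fin n → ℂ) → ℂ) (hf : ∀ i, AnalyticOnNhd ℂ (f i) U)
    (p : Fin n → ℂ) (hp : p ∈ zeroLocus U f)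
    (F : Fin r → LocalRingAt p) (hF : ∀ i, F i = germ p (f i) (hf i p hp.1))
    (hci : RingTheory.Sequence.IsRegular (LocalRingAt p) (List.ofFn F))
    (hred : IsReduced (LocalRingAt p ⧸ idealOf F)) :
    Nonempty (T1 (idealOf F) ≃ₗ[LocalRingAt p ⧸ idealOf F] jacobianCoker F) ∧
    (¬ Module.Finite ℂ (T1Complex (idealOf F)) ↔ PosDimAt (singLocus U f) p) ∧
    (p ∈ singLocus U f → Nontrivial (T1 (idealOf F))) ∧
    (∀ i : Fin r, r = 1 →
      Nonempty (T1Ambient (idealOf F) ≃ₗ[LocalRingAt p] LocalRingAt p ⧸ tjurinaIdeal (F i)) ∧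
      Module.rank ℂ (T1Complex (idealOf F)) =
        Module.rank ℂ (LocalRingAt p ⧸ tjurinaIdeal (F i)) ∧
      (¬ Module.Finite ℂ (LocalRingAt p ⧸ tjurinaIdeal (F i)) ↔
        PosDimAt (criticalLocus U (f i)) p)) := by
  have hUp : U ∈ 𝓝 p := hU.mem_nhds hp.1
  obtain rfl : F = fun i => germ p (f i) (hf i p hp.1) := funext hF
  have hrad : (idealOf fun i => germ p (f i) (hf i p hp.1)).IsRadical :=
    (Ideal.isRadical_iff_quotient_reduced _).2 hred
  obtain ⟨e⟩ := nonempty_T1_linearEquiv_jacobianCoker _ hci.toIsWeaklyRegular hrad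
  have eC := RestrictScalars.linearEquivOfTower ℂ e
  have hT1 := finite_jacobianCoker_iff hUp (fun i => hf i p hp.1) hp.2
  refine ⟨⟨e⟩, ?_, fun hs => ?_, ?_⟩
  · rw [← hT1, not_iff_not]
    exact ⟨fun _ => Module.Finite.equiv eC, fun _ => Module.Finite.equiv eC.symm⟩
  · have := nontrivial_jacobianCoker (fun i => hf i p hp.1) hs
    exact e.toEquiv.nontrivial
  · rintro i rfl
    obtain rfl : i = 0 := Subsingleton.elim i 0
    obtain ⟨e'⟩ := nonempty_jacobianCoker_linearEquiv fun i => germ p (f i) (hf i p hp.1)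
    have e'C := e'.restrictScalars ℂ
    refine ⟨⟨(RestrictScalars.linearEquivOfTower (LocalRingAt p) e).trans e'⟩,
      (eC.trans e'C).rank_eq, fun hinf => ?_, fun hpos hfin => ?_⟩
    · have h1 := posDimAt_iff.1 (hT1.1 fun _ => hinf (Module.Finite.equiv e'C))
      -- This inclusion gives one implication only; the other, in the next case, relies on `f` being
      -- constant modulo primes that contain its partials.
      have hsub := singLocus_subset_criticalLocus (U := U) f
      exact posDimAt_iff.2 ⟨hsub h1.1, fun h => h1.2 (h.trans (vanishingIdeal_anti hsub))⟩
    · exact not_posDimAt_criticalLocus (hf 0 p hp.1) (hp.2 0) hfin hpos
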